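/- **Notation.** $K_n=\mathrm U(n)$ carries its normalized Haar measure $d^*k$. $\Pi_{n,m}$ is the $n\times m$ matrix with entries $\delta_{ij}$. For positive integers $n\le l,m$, $G_{l,m}^{(n)}$ is the set of complex $l\times m$ matrices of rank $n$, and $H_l^{(n)}$ is the set of Hermitian $l\times l$ matrices of rank $n$. Let $s^{(n)}=(n-1,\dots,1,0)\in\mathbb C^n$, and let $L^{(n)}\in\mathbb Z_2^n$ be its reduction modulo $2$. For $s\in\mathbb C^n$ and $L\in\mathbb Z_2^n$ put $s_{n+1}=-1$ and $L_{n+1}=-1$. For $x\in H_l^{(n)}$ and $s$ in $$D_n=\{s\in\mathbb C^n:\ \mathrm{Re}(s_j-s_{j+1})\ge 1,\ j=1,\dots,n\}$$ define $$C_{l,n}(s)=\int_{K_l}d^*k\prod_{j=1}^n|\det \Pi_{j,l}k\Pi_{l,n}\Pi_{n,l}k^*\Pi_{l,j}|^{s_j-s_{j+1}-1},$$ $$\Phi(s,L;x)=\frac1{C_{l,n}(s)}\int_{K_l}d^*k\prod_{j=1}^n \mathrm{sign}[\det \Pi_{j,l}kxk^*\Pi_{l,j}]^{L_j-L_{j+1}-1}\,|\det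 \Pi_{j,l}kxk^*\Pi_{l,j}|^{s_j-s_{j+1}-1},$$ and continue both meromorphically in $s$ to $\mathbb C^n$. For $g\in G_{l,m}^{(n)}$ let $\Psi(s;g)=\Phi(s,L^{(n)};gg^*)$. Let $n_1,n_2$ be positive integers, $r=\min\{n_1,n_2\}$ and $d=|n_1-n_2|$. For $s\in\mathbb C^r$ and $L\in\mathbb Z_2^r$ put $$\tilde s=(s_1+d,\dots,s_r+d,\,d-1,\dots,1,0)\in\mathbb C^{r+d},\qquad \tilde L=(L_1+d,\dots,L_r+d,\,L^{(d)})\in\mathbb Z_2^{r+d}.$$ **Proposition 1.** In both parts suppose that $s_j\ne -i$ for all $j$ and all integers $i$ with $d<i\le m-r$ (the singular hyperplanes of $s\mapsto C_{m,r+d}(\tilde s)$). 1. Let $g\in G_{l,m}^{(n_1)}$, $x\in H_m^{(n_2)}$ and $L\in\mathbb Z_2^r$. Let $s\in\mathbb C^r$ be such that, unless $x$ is positive or negative semidefinite, the pair $(\sigma,\Lambda)=(\tilde s,\tilde L)$ (if $n_1=r$), respectively $(\sigma,\Lambda)=(s,L)$ (if $n_2=r$), satisfies $\Lambda_b=\Lambda_c$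 whenever $\sigma_b=\sigma_c$ (so that $\Phi(\sigma,\Lambda;x)$ is not at a pole). Then $$\int_{K_m}d^*k\,\Phi(s,L;gkxk^*g^*)=C_{m,r+|n_1-n_2|}(\tilde s)\begin{cases}\Psi(s;g)\,\Phi(\tilde s,\tilde L;x),& n_1=r,\\ \Psi(\tilde s;g)\,\Phi(s,L;x),& n_2=r.\end{cases}$$ 2. Let $g_1\in G_{l,m}^{(n_1)}$, $g_2\in G_{m,o}^{(n_2)}$ and $s\in\mathbb C^r$. Then $$\int_{K_m}d^*k\,\Psi(s;g_1kg_2)=C_{m,r+|n_1-n_2|}(\tilde s)\begin{cases}\Psi(s;g_1)\,\Psi(\tilde s;g_2),& n_1=r,\\ \Psi(\tilde s;g_1)\,\Psi(s;g_2),& n_2=r.\end{cases}$$ The formulas have the following meaning. For $s\in D_r$ the integral on the left converges absolutely and equals the right hand side. For every other admissible $s$ the equality holds whenever the integral converges absolutely. Whether or not it converges, the function on $D_r$ given by the left hand side has a meromorphic continuation to $\mathbb C^r$ that is regular at $s$ with the right hand side as its value. -/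

import Mathlib

open MeasureTheory Matrix

noncomputable section

namespace SphericalFactorization

/-! ## The unitary group with its normalized Haar measure -/

/-- The unitary group `U(n)`. -/
abbrev K (n : ℕ) : Type := Matrix.unitaryGroup (Fin n) ℂ

instance instMeasurableSpaceK (n : ℕ) : MeasurableSpace (K n) := borel _

instance instBorelSpaceK (n : ℕ) : BorelSpace (K n) := ⟨rfl⟩

instance instCompactSpaceK (n : ℕ) : CompactSpace (K n) := by
  refine isCompact_iff_compactSpace.mp ?_
  have hcpt : IsCompact (Set.univ.pi fun _ : Fin n => Set.univ.pi fun _ : Fin n =>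
      Metric.closedBall (0 : ℂ) 1) :=
    isCompact_univ_pi fun _ => isCompact_univ_pi fun _ => isCompact_closedBall 0 1
  refine IsCompact.of_isClosed_subset (X := Matrix (Fin n) (Fin n) ℂ) hcpt ?_ ?_
  · exact isClosed_unitary
  · intro U hU i _ j _
    simpa using entry_norm_bound_of_unitary hU i j

/-- The normalized Haar measure `d^*k` on `U(n)`. -/
def haarK (n : ℕ) : Measure (K n) := Measure.haarMeasure ⊤

/-! ## Matrices -/

/-- The projection / inclusion matrix `Π_{n,m}` of size `n × m`. -/
def proj (n m : ℕ) : Matrix (Fin n) (Fin m) ℂ :=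
  Matrix.of fun i j => if (i : ℕ) = (j : ℕ) then 1 else 0

/-- The complex `l × m` matrices of rank `n`. -/
def GSet (l m n : ℕ) : Set (Matrix (Fin l) (Fin m) ℂ) := {g | g.rank = n}

/-- The Hermitian `l × l` matrices of rank `n`. -/
def HSet (l n : ℕ) : Set (Matrix (Fin l) (Fin l) ℂ) := {x | x.IsHermitian ∧ x.rank = n}

/-- The leading principal minor `det Π_{j,l} x Π_{l,j}`; it is real when `x` is Hermitian. -/
def minor {l : ℕ} (j : ℕ) (x : Matrix (Fin l) (Fin l) ℂ) : ℝ :=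
  (proj j l * x * proj l j).det.re

/-! ## Parameters -/

/-- `s_j - s_{j+1} - 1` for `j = 1, …, n` (here indexed from `0`), with `s_{n+1} = -1`.
It is used both for `s ∈ ℂ^n` and for `L ∈ (ℤ/2)^n`. -/
def gap {R : Type*} [Ring R] {n : ℕ} (s : Fin n → R) (j : Fin n) : R :=
  s j - (if h : (j : ℕ) + 1 < n then s ⟨(j : ℕ) + 1, h⟩ else -1) - 1

/-- The vector `(n-1, n-2, …, 1, 0)`: this is `s^{(n)}` for `R = ℂ` and `L^{(n)}` for
`R = ℤ/2`. -/
def stair (R : Type*) [Ring R] (n : ℕ) : Fin n → R := fun j => ((Fin.rev j : ℕ) : R)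

/-- `(s_1 + d, …, s_r + d, d-1, …, 1, 0)`: this is `s̃` for `R = ℂ` and `L̃` for `R = ℤ/2`. -/
def ext {R : Type*} [Ring R] {r : ℕ} (d : ℕ) (s : Fin r → R) : Fin (r + d) → R :=
  Fin.append (fun j => s j + (d : R)) (stair R d)

/-- The set of all `s ∈ ℂ^n` with `Re (s_j - s_{j+1}) ≥ 1` for `j = 1, …, n`, where
`s_{n+1} = -1`. -/
def domain (n : ℕ) : Set (Fin n → ℂ) := {s | ∀ j, 0 ≤ (gap s j).re}

theorem continuous_gap {n : ℕ} (j : Fin n) : Continuous fun s : Fin n → ℂ => gap s j := by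
  unfold gap
  split_ifs <;> fun_prop

theorem interior_domain_nonempty (n : ℕ) : (interior (domain n)).Nonempty := by
  refine ⟨fun j => 2 * ((n : ℂ) - (j : ℕ)) - 1, mem_interior.mpr
    ⟨{s | ∀ j, 0 < (gap s j).re}, fun s hs j => (hs j).le, ?_, fun j => ?_⟩⟩
  · simp only [Set.ofPred_forall]
    exact isOpen_iInter_of_finite fun j =>
      isOpen_lt continuous_const (Complex.continuous_re.comp (continuous_gap j))
  · have hj := j.2
    unfold gap
    split_ifs with h
    · simp
      linarith
    · have : (n : ℂ) = (j : ℕ) + 1 := by exact_mod_cast (by omega : n = (j : ℕ) + 1)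
      rw [this]
      simp

/-- `sign(t)^ε` for `ε ∈ ℤ/2`. -/
def signPow (ε : ZMod 2) (t : ℝ) : ℝ := if ε = 0 then 1 else Real.sign t

/-! ## Analytic continuation in several complex variables -/

/-- The meromorphic continuation to `ℂ^n` of the function `f` on `D` is regular at `s` with
value `v`: there is a quotient `P / Q` of entire functions that equals `f` on `D`, has
`Q s ≠ 0`, and has the value `v` at `s`. -/
def ContinuesTo {n : ℕ} (D : Set (Fin n → ℂ)) (f : (Fin n → ℂ) → ℂ) (s : Fin n → ℂ) (v : ℂ) :
    Prop :=
  ∃ P Q : (Fin n → ℂ) → ℂ, AnalyticOnNhd ℂ P Set.univ ∧ AnalyticOnNhd ℂ Q Set.univ ∧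
    (∀ z ∈ D, P z = Q z * f z) ∧ Q s ≠ 0 ∧ P s = Q s * v

/-- The value of the continuation is unique. -/
theorem ContinuesTo.unique {n : ℕ} {D : Set (Fin n → ℂ)} {f : (Fin n → ℂ) → ℂ} {s : Fin n → ℂ}
    {v w : ℂ} (hD : (interior D).Nonempty) (hv : ContinuesTo D f s v)
    (hw : ContinuesTo D f s w) : v = w := by
  obtain ⟨P, Q, hP, hQ, hf, hs, hPs⟩ := hv
  obtain ⟨P', Q', hP', hQ', hf', hs', hPs'⟩ := hw
  obtain ⟨z₀, hz₀⟩ := hD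
  have h : P * Q' = P' * Q := by
    refine AnalyticOnNhd.eq_of_eventuallyEq (𝕜 := ℂ) (z₀ := z₀) (hP.mul hQ') (hP'.mul hQ) ?_
    filter_upwards [isOpen_interior.mem_nhds hz₀] with z hz
    have hz' := interior_subset hz
    simp only [Pi.mul_apply, hf z hz', hf' z hz']
    ring
  have h2 := congrFun h s
  simp only [Pi.mul_apply, hPs, hPs'] at h2
  have h3 : Q s * Q' s * v = Q s * Q' s * w := by linear_combination h2
  exact mul_left_cancel₀ (mul_ne_zero hs hs') h3

open Classical in
/-- The function `f` on `D`, continued meromorphically to `ℂ^n` (with value `0` where the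
continuation is not regular). -/
def continuation {n : ℕ} (D : Set (Fin n → ℂ)) (f : (Fin n → ℂ) → ℂ) (s : Fin n → ℂ) : ℂ :=
  if s ∈ D then f s else if h : ∃ v, ContinuesTo D f s v then h.choose else 0

/-! ## Spherical functions -/

/-- The numerator of the spherical function. -/
def numerator {l n : ℕ} (s : Fin n → ℂ) (L : Fin n → ZMod 2) (x : Matrix (Fin l) (Fin l) ℂ) : ℂ :=
  ∫ k : K l, ∏ j : Fin n,
    (signPow (gap L j) (minor (j + 1) (k.1 * x * k.1ᴴ)) : ℂ)
      * ((|minor (j + 1) (k.1 * x * k.1ᴴ)| : ℝ) : ℂ)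
        ^ gap s j
    ∂haarK l

/-- The normalizing integral. -/
def normalization (l : ℕ) {n : ℕ} (s : Fin n → ℂ) : ℂ :=
  ∫ k : K l, ∏ j : Fin n,
    ((|minor (j + 1) (k.1 * (proj l n * proj n l)
      * k.1ᴴ)| : ℝ) : ℂ) ^ gap s j
    ∂haarK l

/-- `C_{l,n}(s)`. -/
def C (l n : ℕ) (s : Fin n → ℂ) : ℂ := continuation (domain n) (normalization l) s

/-- The spherical function `Φ(s, L; x)` for Hermitian `l × l` matrices `x` of rank `n`. -/
def Φ {l n : ℕ} (s : Fin n → ℂ) (L : Fin n → ZMod 2) (x : Matrix (Fin l) (Fin l) ℂ) : ℂ :=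
  continuation (domain n) (fun z => numerator z L x / normalization l z) s

/-- The spherical function `Ψ(s; g)` for complex `l × m` matrices `g` of rank `n`. -/
def Ψ {l m n : ℕ} (s : Fin n → ℂ) (g : Matrix (Fin l) (Fin m) ℂ) : ℂ :=
  Φ s (stair (ZMod 2) n) (g * gᴴ)

/-! ## Singular hyperplanes and integral identities -/

open scoped ComplexOrder in
/-- The point `s` avoids the hyperplanes on which `Φ(·, L; x)` can be singular. These are
`s_b = s_c` with `L_b ≠ L_c`, and there are none if `x` is semidefinite. -/
def PhiRegular {l n : ℕ} (s : Fin n → ℂ) (L : Fin n → ZMod 2) (x : Matrix (Fin l) (Fin l) ℂ) :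
    Prop :=
  x.PosSemidef ∨ (-x).PosSemidef ∨ ∀ b c, s b = s c → L b = L c

/-- The point `s` avoids the singular hyperplanes of `C_{m,r+d}(s̃)`, which are
`s_j = -i` for `d < i ≤ m - r`. -/
def NormRegular (m d : ℕ) {r : ℕ} (s : Fin r → ℂ) : Prop :=
  ∀ (j : Fin r) (i : ℕ), d < i → r + i ≤ m → s j ≠ -(i : ℂ)

/-- The formula `∫_{U(m)} F(s; k) d^*k = v` at the point `s ∈ ℂ^r`. For `s` in the domain of the
defining integrals it includes the convergence of the integral. For any other `s` it says that
the integral has the value `v` whenever it converges, and that in any case the function of `s`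
given by the integral is continued analytically to the point `s` with the value `v`. -/
def HaarIntegralEq (m : ℕ) {r : ℕ} (F : (Fin r → ℂ) → K m → ℂ) (s : Fin r → ℂ) (v : ℂ) : Prop :=
  (s ∈ domain r → Integrable (F s) (haarK m)) ∧
  (Integrable (F s) (haarK m) → ∫ k, F s k ∂haarK m = v) ∧
  ContinuesTo (domain r) (fun z => ∫ k, F z k ∂haarK m) s v

end SphericalFactorization

end

/-!
# Averages of spherical functions over the unitary group

On the domain where all exponents have nonnegative real part the formula is multiplicativity of
leading minors. Writing the first `r` rows of `B` as a lower triangular matrix times a unitary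
matrix `u` gives `minor j (B X Bᴴ) = minor j (B Bᴴ) * minor j (u X uᴴ)` for `j ≤ r`
(`exists_minor_conj_eq`), and invariance of Haar measure turns this into the product formula
`integral_numerator` for the unnormalized spherical functions. The constants are compared by
`numerator_ext` and `normalization_chain`, which express that the last `d` factors belonging to
`ext d s` are trivial. What remains is the passage to parameters outside the domain, where nothing
is known but the continued values; it needs explicit formulas.

**Determinant formula.** For distinct real `lam`, `numerator z L (realDiag lam) * vdm z * vdm lam =
vdm (stair ℂ n) * chiDet z L lam`, where `chiDet z L lam` is the determinant of the matrix
`sign(lam_i)^{L_j} |lam_i|^{z_j}` (`detFormula`), by induction on `n`: the last factor of the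
numerator is a power of the determinant, and the others depend only on the upper left corner of `k
diag(lam) k⁻¹`. The eigenvalues `μ` of that corner interlace with `lam`, and they are determined by
the squared moduli of the last row of `k`, which are uniformly distributed on a simplex
(`exists_map_rowWeights`). In the coordinates `μ` this distribution has the density `vdm μ / vdm
lam` on a box, up to a constant, so that the induction hypothesis leaves the integral of a
determinant over a box, which is computed row by row (`exists_integral_eq_integral_box`,
`DetFormula.corner`, `CornerFormula.succ`). Applied to projections the same formulas show that
`normalization l z` is a constant divided by the product of the `z_j + i` with `1 ≤ i ≤ l - n`
(`normalization_mul_normDen`).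

**Continuation.** The determinant is that of a matrix `φ(c_i, L_j) e^{u_i z_j}`, where `lam` has
the signs `c` and the logarithms `u`. It is divisible by the Vandermonde products of `u` and of `z`
inside the classes of `c` and of `L`. The quotient is a confluent determinant formed from the
entries of a matrix exponential in Newton bases of both variables (`det_exp_eq`). It is continuous
in `u` and entire in `z`, so for arbitrary nonzero eigenvalues the numerator times the product
`mixedVdm L z` of the `z_p - z_a` with `L_p ≠ L_a` extends to an entire function `entireNumerator`.
Therefore `Φ` is regular where this product does not vanish. On semidefinite matrices the signs may
be removed (`exists_numerator_eq_mul`), and there are no poles (`continuesTo_Φ`).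

**Convergent integrals outside the domain.** Here it has to be shown that the integral of the
continued function is the continued value of the integral (`integral_identity`). If all `z_j` have
large real part, the entire numerators are bounded uniformly in the eigenvalues, however close
these are to each other or to zero, because the functions `sign(t)^ε |t|^z` have bounded divided
differences (`exists_norm_entireNumerator_le`); so the integral is holomorphic along a line that
leads into the domain. In general `τ` is added to all parameters. This multiplies the entire
numerators by the `τ`-th power of the absolute value of the product of the eigenvalues, which is a
bounded function of `k`. So the integral stays convergent, it is holomorphic in `τ` for positive
real part, and `τ → 0` is a limit by dominated convergence.
-/

noncomputable section

namespace SphericalFactorization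

/-! ### Projections and leading principal minors -/

theorem proj_mul_proj {j n l : ℕ} (h : j ≤ n) : proj j n * proj n l = proj j l := by
  ext a b
  simp only [proj, Matrix.mul_apply, Matrix.of_apply, ite_mul, one_mul, zero_mul]
  rw [Finset.sum_eq_single (⟨a, a.2.trans_le h⟩ : Fin n)]
  · simp
  · intro c _ hc
    rw [if_neg]
    exact fun e => hc (Fin.ext e.symm)
  · simp

theorem proj_mul_proj' {j n l : ℕ} (h : l ≤ n) : proj j n * proj n l = proj j l := by
  ext a b
  simp only [proj, Matrix.mul_apply, Matrix.of_apply, mul_ite, mul_one, mul_zero]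
  rw [Finset.sum_eq_single (⟨b, b.2.trans_le h⟩ : Fin n)]
  · simp
  · intro c _ hc
    rw [if_neg]
    exact fun e => hc (Fin.ext e)
  · simp

theorem proj_self (n : ℕ) : proj n n = 1 := by
  ext a b
  simp [proj, Matrix.one_apply, Fin.ext_iff]

theorem conjTranspose_proj (n l : ℕ) : (proj n l)ᴴ = proj l n := by
  ext a b
  simp only [proj, Matrix.conjTranspose_apply, Matrix.of_apply]
  simp only [eq_comm (a := (b : ℕ))]
  split_ifs <;> simp

theorem minor_corner {l r j : ℕ} (h : j ≤ r) (x : Matrix (Fin l) (Fin l) ℂ) :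
    minor j (proj r l * x * proj l r) = minor j x := by
  unfold minor
  rw [← proj_mul_proj (l := l) h, ← proj_mul_proj' (j := l) h]
  simp only [Matrix.mul_assoc]

/-! ### Triangular factorization -/

/-- Every square matrix is a lower triangular matrix times a unitary matrix. -/
theorem exists_lower_mul_unitary {m : ℕ} (A : Matrix (Fin m) (Fin m) ℂ) :
    ∃ (T : Matrix (Fin m) (Fin m) ℂ) (u : K m), (∀ i j, i < j → T i j = 0) ∧ A = T * u.1 := by
  have hc : Module.finrank ℂ (EuclideanSpace ℂ (Fin m)) = Fintype.card (Fin m) := by simp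
  let f : Fin m → EuclideanSpace ℂ (Fin m) := fun i => WithLp.toLp 2 (A i)
  let b := InnerProductSpace.gramSchmidtOrthonormalBasis hc f
  refine ⟨Matrix.of fun i j => inner ℂ (b j) (f i), ⟨Matrix.of fun i j => b i j, ?_⟩, ?_, ?_⟩
  · rw [Matrix.mem_unitaryGroup_iff]
    ext i j
    have h := orthonormal_iff_ite.1 b.orthonormal j i
    simp only [PiLp.inner_apply, RCLike.inner_apply] at h
    simp only [Matrix.mul_apply, Matrix.of_apply, Matrix.star_apply, Matrix.one_apply]
    simpa [eq_comm] using h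
  · intro i j hij
    exact InnerProductSpace.gramSchmidtOrthonormalBasis_inv_triangular hc f hij
  · ext i j
    have h := congrArg (fun v : EuclideanSpace ℂ (Fin m) => v j) (b.sum_repr' (f i))
    simp only [Matrix.mul_apply, Matrix.of_apply]
    rw [show A i j = f i j from rfl, ← h]
    simp

/-- The first `j` rows of a lower triangular matrix are supported in the first `j` columns. -/
theorem proj_mul_lower {m j : ℕ} {T : Matrix (Fin m) (Fin m) ℂ}
    (hT : ∀ a b, a < b → T a b = 0) : proj j m * T = (proj j m * T * proj m j) * proj j m := by
  ext a b
  have key : ∀ (M : Matrix (Fin j) (Fin m) ℂ) (c : Fin m),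
      (M * proj m j * proj j m) a c = if (c : ℕ) < j then M a c else 0 := by
    intro M c
    simp only [Matrix.mul_apply, proj, Matrix.of_apply, mul_ite, mul_one, mul_zero]
    split_ifs with h
    · rw [Finset.sum_eq_single (⟨c, h⟩ : Fin j)]
      · simp [← Fin.ext_iff]
      · intro d _ hd
        rw [if_neg (fun e => hd (Fin.ext e))]
      · simp
    · refine Finset.sum_eq_zero fun d _ => if_neg fun e => h ?_
      rw [← e]; exact d.2
  rw [key]
  split_ifs with h
  · rfl
  · simp only [Matrix.mul_apply, proj, Matrix.of_apply, ite_mul, one_mul, zero_mul]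
    refine Finset.sum_eq_zero fun d _ => ?_
    split_ifs with hd
    · refine hT d b ?_
      rw [Fin.lt_def]; omega
    · rfl

/-- Conjugation by a lower triangular matrix multiplies each leading minor by a constant. -/
theorem minor_lower_conj {m j : ℕ} {T : Matrix (Fin m) (Fin m) ℂ}
    (hT : ∀ a b, a < b → T a b = 0) (X : Matrix (Fin m) (Fin m) ℂ) :
    minor j (T * X * Tᴴ) = Complex.normSq (proj j m * T * proj m j).det * minor j X := by
  unfold minor
  have h1 := proj_mul_lower (j := j) hT
  have h2 : Tᴴ * proj m j = proj m j * (proj j m * T * proj m j)ᴴ := by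
    have := congrArg Matrix.conjTranspose h1
    rw [Matrix.conjTranspose_mul, conjTranspose_proj, Matrix.conjTranspose_mul,
      conjTranspose_proj] at this
    exact this
  have h3 : proj j m * (T * X * Tᴴ) * proj m j
      = (proj j m * T * proj m j) * (proj j m * X * proj m j) * (proj j m * T * proj m j)ᴴ := by
    calc proj j m * (T * X * Tᴴ) * proj m j = (proj j m * T) * X * (Tᴴ * proj m j) := by
          simp only [Matrix.mul_assoc]
      _ = _ := by rw [h2]; nth_rw 1 [h1]; simp only [Matrix.mul_assoc]
  rw [h3, Matrix.det_mul, Matrix.det_mul, Matrix.det_conjTranspose, mul_right_comm,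
    show (proj j m * T * proj m j).det * star (proj j m * T * proj m j).det
      = (Complex.normSq (proj j m * T * proj m j).det : ℂ) from Complex.mul_conj _,
    Complex.re_ofReal_mul]

theorem minor_one {m j : ℕ} (hj : j ≤ m) : minor j (1 : Matrix (Fin m) (Fin m) ℂ) = 1 := by
  simp [minor, proj_mul_proj hj, proj_self]

/-- Leading minors of `B X B^*` are, up to a fixed unitary rotation of `X`, products of the minors
of `B B^*` and of `X`. -/
theorem exists_minor_conj_eq {l m r : ℕ} (hm : r ≤ m) (B : Matrix (Fin l) (Fin m) ℂ) :
    ∃ u : K m, ∀ (X : Matrix (Fin m) (Fin m) ℂ) (j : ℕ), j ≤ r →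
      minor j (B * X * Bᴴ) = minor j (B * Bᴴ) * minor j (u.1 * X * u.1ᴴ) := by
  obtain ⟨T, u, hT, hA⟩ := exists_lower_mul_unitary (proj m r * proj r l * B)
  have hu : u.1 * u.1ᴴ = 1 := Matrix.mem_unitaryGroup_iff.1 u.2
  have key : ∀ (X : Matrix (Fin m) (Fin m) ℂ) (j : ℕ), j ≤ r →
      minor j (B * X * Bᴴ)
        = Complex.normSq (proj j m * T * proj m j).det * minor j (u.1 * X * u.1ᴴ) := by
    intro X j hj
    rw [← minor_lower_conj hT, ← minor_corner (l := m) hj,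
      ← minor_corner (l := l) hj]
    congr 1
    have h1 : T * (u.1 * X * u.1ᴴ) * Tᴴ = (T * u.1) * X * (T * u.1)ᴴ := by
      rw [Matrix.conjTranspose_mul]; simp only [Matrix.mul_assoc]
    have h2 : proj r m * proj m r = 1 := by rw [proj_mul_proj hm, proj_self]
    rw [h1, ← hA, Matrix.conjTranspose_mul, Matrix.conjTranspose_mul, conjTranspose_proj,
      conjTranspose_proj]
    calc _ = proj r l * (B * X * Bᴴ) * proj l r := rfl
      _ = (proj r m * proj m r) * (proj r l * B * X * (Bᴴ * proj l r)) * (proj r m * proj m r) := by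
        rw [h2, Matrix.one_mul, Matrix.mul_one]; simp only [Matrix.mul_assoc]
      _ = _ := by simp only [Matrix.mul_assoc]
  refine ⟨u, fun X j hj => ?_⟩
  have h0 := key 1 j hj
  rw [Matrix.mul_one, Matrix.mul_one, hu, minor_one (hj.trans hm), mul_one] at h0
  rw [key X j hj, h0]

/-! ### Signed complex powers -/

/-- The signed power `sign(t)^ε |t|^w`. -/
def chi (ε : ZMod 2) (w : ℂ) (t : ℝ) : ℂ := (signPow ε t : ℂ) * ((|t| : ℝ) : ℂ) ^ w

theorem measurable_signPow (ε : ZMod 2) : Measurable (signPow ε) := by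
  unfold signPow
  split_ifs
  · exact measurable_const
  · unfold Real.sign
    exact Measurable.ite measurableSet_Iio measurable_const
      (Measurable.ite measurableSet_Ioi measurable_const measurable_const)

theorem measurable_chi (ε : ZMod 2) (w : ℂ) : Measurable (chi ε w) := by
  unfold chi
  have h1 : Measurable fun t : ℝ => ((|t| : ℝ) : ℂ) :=
    Complex.measurable_ofReal.comp (continuous_abs.measurable)
  exact (Complex.measurable_ofReal.comp (measurable_signPow ε)).mul (h1.pow_const w)

theorem signPow_mul (ε : ZMod 2) (a b : ℝ) : signPow ε (a * b) = signPow ε a * signPow ε b := by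
  unfold signPow
  split_ifs
  · simp
  · rcases lt_trichotomy a 0 with ha | ha | ha <;> rcases lt_trichotomy b 0 with hb | hb | hb <;>
      simp [ha, hb, Real.sign_of_neg, Real.sign_of_pos, mul_neg_of_neg_of_pos,
        mul_neg_of_pos_of_neg, mul_pos_of_neg_of_neg]

theorem chi_mul (ε : ZMod 2) (w : ℂ) (a b : ℝ) :
    chi ε w (a * b) = chi ε w a * chi ε w b := by
  unfold chi
  rw [signPow_mul, abs_mul]
  push_cast
  rw [Complex.mul_cpow_ofReal_nonneg (abs_nonneg a) (abs_nonneg b)]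
  ring

theorem abs_signPow_le (ε : ZMod 2) (t : ℝ) : |signPow ε t| ≤ 1 := by
  unfold signPow
  split_ifs
  · simp
  · rcases lt_trichotomy t 0 with ha | ha | ha <;> simp [ha, Real.sign_of_neg, Real.sign_of_pos]

theorem signPow_of_pos (ε : ZMod 2) {t : ℝ} (ht : 0 < t) : signPow ε t = 1 := by
  unfold signPow
  split_ifs
  · rfl
  · exact Real.sign_of_pos ht

theorem chi_of_pos (ε : ZMod 2) (w : ℂ) {t : ℝ} (ht : 0 < t) : chi ε w t = (t : ℂ) ^ w := by
  rw [chi, signPow_of_pos ε ht, abs_of_pos ht]; simp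

theorem chi_one (ε : ZMod 2) (w : ℂ) : chi ε w 1 = 1 := by
  rw [chi_of_pos ε w one_pos]; simp

theorem chi_zero_zero (t : ℝ) : chi 0 0 t = 1 := by
  simp [chi, signPow]

theorem norm_ofReal_abs_cpow_le (w : ℂ) (t : ℝ) :
    ‖((|t| : ℝ) : ℂ) ^ w‖ ≤ |t| ^ w.re := by
  by_cases ht : t = 0
  · subst ht
    by_cases h0 : w = 0
    · simp [h0]
    · simp [h0]
      positivity
  · rw [Complex.norm_cpow_eq_rpow_re_of_pos (abs_pos.2 ht)]

theorem norm_chi_le (ε : ZMod 2) (w : ℂ) (t : ℝ) :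
    ‖chi ε w t‖ ≤ |t| ^ w.re := by
  unfold chi
  rw [norm_mul, Complex.norm_real, Real.norm_eq_abs]
  calc _ ≤ 1 * |t| ^ w.re := by
        gcongr
        · exact abs_signPow_le ε t
        · exact norm_ofReal_abs_cpow_le w t
    _ = _ := one_mul _

theorem continuous_chi (ε : ZMod 2) {w : ℂ} (hw : 0 < w.re) : Continuous (chi ε w) := by
  rw [continuous_iff_continuousAt]
  intro t
  rcases eq_or_ne t 0 with rfl | ht
  · have h0 : chi ε w 0 = 0 := by
      have : w ≠ 0 := fun h => by simp [h] at hw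
      simp [chi, this]
    rw [ContinuousAt, h0]
    refine squeeze_zero_norm (norm_chi_le ε w) ?_
    have h1 : Filter.Tendsto (fun t : ℝ => |t| ^ w.re) (nhds 0) (nhds (|0| ^ w.re)) :=
      (continuous_abs.continuousAt.rpow_const (Or.inr hw.le))
    simpa [Real.zero_rpow hw.ne'] using h1
  · have h1 : signPow ε =ᶠ[nhds t] fun _ => signPow ε t := by
      unfold signPow
      split_ifs
      · rfl
      · rcases lt_or_gt_of_ne ht with h | h
        · filter_upwards [gt_mem_nhds h] with y hy
          rw [Real.sign_of_neg hy, Real.sign_of_neg h]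
        · filter_upwards [lt_mem_nhds h] with y hy
          rw [Real.sign_of_pos hy, Real.sign_of_pos h]
    have h2 : ContinuousAt (fun t : ℝ => ((|t| : ℝ) : ℂ) ^ w) t := by
      refine ContinuousAt.cpow (by fun_prop) continuousAt_const (Or.inl ?_)
      simpa using ht
    refine (continuousAt_const.mul h2 (x := t) : ContinuousAt
      (fun y : ℝ => (signPow ε t : ℂ) * ((|y| : ℝ) : ℂ) ^ w) t).congr ?_
    filter_upwards [h1] with y hy
    simp [chi, hy]

/-! ### Haar measure on the unitary group -/

instance instSecondCountableK (n : ℕ) : SecondCountableTopology (K n) := by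
  have : SecondCountableTopology (Matrix (Fin n) (Fin n) ℂ) :=
    inferInstanceAs (SecondCountableTopology (Fin n → Fin n → ℂ))
  exact inferInstanceAs (SecondCountableTopology
    ((Matrix.unitaryGroup (Fin n) ℂ : Set (Matrix (Fin n) (Fin n) ℂ))))

instance instIsHaarK (n : ℕ) : (haarK n).IsHaarMeasure := by unfold haarK; infer_instance

instance instIsProbabilityK (n : ℕ) : IsProbabilityMeasure (haarK n) := by
  refine ⟨?_⟩
  have := Measure.haarMeasure_self (K₀ := (⊤ : TopologicalSpace.PositiveCompacts (K n)))
  simpa [haarK] using this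

instance instRightInvariantK (n : ℕ) : (haarK n).IsMulRightInvariant := by
  refine ⟨fun g => ?_⟩
  have : IsProbabilityMeasure (Measure.map (fun x => x * g) (haarK n)) :=
    Measure.isProbabilityMeasure_map (measurable_mul_const g).aemeasurable
  exact Measure.isHaarMeasure_eq_of_isProbabilityMeasure _ _

theorem continuous_coeK (n : ℕ) : Continuous fun k : K n => k.1 := continuous_subtype_val

theorem continuous_minor {l : ℕ} (j : ℕ) :
    Continuous fun x : Matrix (Fin l) (Fin l) ℂ => minor j x := by
  unfold minor
  exact Complex.continuous_re.comp (Continuous.matrix_det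
    ((continuous_const.matrix_mul continuous_id).matrix_mul continuous_const))

theorem measurable_prod_chi {α : Type*} [MeasurableSpace α] {n : ℕ} (ε : Fin n → ZMod 2)
    (w : Fin n → ℂ) {f : Fin n → α → ℝ} (hf : ∀ j, Measurable (f j)) :
    Measurable fun a => ∏ j, chi (ε j) (w j) (f j a) :=
  Finset.measurable_prod _ fun j _ => (measurable_chi _ _).comp (hf j)

theorem norm_prod_chi_le {n : ℕ} (ε : Fin n → ZMod 2) {w : Fin n → ℂ} (hw : ∀ j, 0 ≤ (w j).re)
    {t : Fin n → ℝ} {b : ℝ} (ht : ∀ j, |t j| ≤ b) :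
    ‖∏ j, chi (ε j) (w j) (t j)‖ ≤ ∏ j, b ^ (w j).re := by
  rw [norm_prod]
  refine Finset.prod_le_prod (fun j _ => norm_nonneg _) fun j _ => (norm_chi_le _ _ _).trans ?_
  exact Real.rpow_le_rpow (abs_nonneg _) (ht j) (hw j)

theorem exists_abs_le {α : Type*} [TopologicalSpace α] [CompactSpace α] {n : ℕ}
    {f : Fin n → α → ℝ} (hf : ∀ j, Continuous (f j)) : ∃ b, ∀ a j, |f j a| ≤ b := by
  have h : ∀ j, ∃ b, ∀ a, |f j a| ≤ b := fun j => by
    obtain ⟨b, hb⟩ := isCompact_univ.exists_bound_of_continuousOn (hf j).continuousOn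
    exact ⟨b, fun a => hb a trivial⟩
  choose b hb using h
  exact ⟨∑ j, |b j|, fun a j => (hb j a).trans ((le_abs_self _).trans
    (Finset.single_le_sum (f := fun j => |b j|) (fun _ _ => abs_nonneg _) (Finset.mem_univ j)))⟩

theorem integrable_prod_chi {α : Type*} [TopologicalSpace α] [CompactSpace α] [MeasurableSpace α]
    [OpensMeasurableSpace α] (μ : Measure α) [IsFiniteMeasure μ] {n : ℕ} (ε : Fin n → ZMod 2)
    {w : Fin n → ℂ} (hw : ∀ j, 0 ≤ (w j).re) {f : Fin n → α → ℝ} (hf : ∀ j, Continuous (f j)) :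
    Integrable (fun a => ∏ j, chi (ε j) (w j) (f j a)) μ := by
  obtain ⟨b, hb⟩ := exists_abs_le hf
  exact Integrable.of_bound
    (measurable_prod_chi ε w fun j => (hf j).measurable).aestronglyMeasurable
    _ (Filter.Eventually.of_forall fun a => norm_prod_chi_le ε hw (hb a))

/-! ### Invariance and multiplicativity of the numerator -/

theorem numerator_eq {l n : ℕ} (s : Fin n → ℂ) (L : Fin n → ZMod 2)
    (x : Matrix (Fin l) (Fin l) ℂ) : numerator s L x =
      ∫ k : K l, ∏ j : Fin n, chi (gap L j) (gap s j) (minor (j + 1) (k.1 * x * k.1ᴴ)) ∂haarK l :=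
  rfl

theorem gap_stair (R : Type*) [Ring R] {n : ℕ} (j : Fin n) : gap (stair R n) j = 0 := by
  have hj := j.2
  unfold gap stair
  simp only [Fin.val_rev]
  split_ifs with h
  · have : n - (j + 1) = (n - (j + 1 + 1)) + 1 := by omega
    rw [this]; push_cast; abel
  · have : n - (j + 1) = 0 := by omega
    rw [this]; simp

theorem normalization_eq (l : ℕ) {n : ℕ} (s : Fin n → ℂ) :
    normalization l s = numerator s (stair (ZMod 2) n) (proj l n * proj n l) := by
  simp [normalization, numerator, gap_stair, signPow]

theorem coe_mul_conjTranspose {n : ℕ} (k : K n) : k.1 * k.1ᴴ = 1 :=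
  Matrix.mem_unitaryGroup_iff.1 k.2

theorem conjTranspose_mul_coe {n : ℕ} (k : K n) : k.1ᴴ * k.1 = 1 :=
  Matrix.mem_unitaryGroup_iff'.1 k.2

theorem numerator_conj {l n : ℕ} (s : Fin n → ℂ) (L : Fin n → ZMod 2)
    (x : Matrix (Fin l) (Fin l) ℂ) (V : K l) :
    numerator s L (V.1 * x * V.1ᴴ) = numerator s L x := by
  rw [numerator_eq, numerator_eq]
  have h := integral_mul_right_eq_self (μ := haarK l) (fun k : K l =>
    ∏ j : Fin n, chi (gap L j) (gap s j) (minor (j + 1) (k.1 * x * k.1ᴴ))) V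
  rw [← h]
  refine integral_congr_ae (Filter.Eventually.of_forall fun k => ?_)
  simp only [Submonoid.coe_mul, Matrix.conjTranspose_mul, Matrix.mul_assoc]

theorem continuous_minor_conj {α : Type*} [TopologicalSpace α] {l m : ℕ} (j : ℕ)
    {A : α → Matrix (Fin l) (Fin m) ℂ} (hA : Continuous A) (x : Matrix (Fin m) (Fin m) ℂ) :
    Continuous fun a => minor j (A a * x * (A a)ᴴ) :=
  (continuous_minor j).comp ((hA.matrix_mul continuous_const).matrix_mul hA.matrix_conjTranspose)

/-- The `K`-average of the numerator of a product is the product of the numerators. If the signs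
are not all trivial, this needs that the minors of `k g g^* k^*` vanish almost nowhere. -/
theorem integral_numerator {l m r : ℕ} (hm : r ≤ m) {s : Fin r → ℂ} (hs : s ∈ domain r)
    (L : Fin r → ZMod 2) (g : Matrix (Fin l) (Fin m) ℂ) (x : Matrix (Fin m) (Fin m) ℂ)
    (h : (∀ j, gap L j = 0) ∨
      ∀ᵐ k ∂haarK l, ∀ j : Fin r, minor (j + 1) (k.1 * (g * gᴴ) * k.1ᴴ) ≠ 0)
    (hg : ∀ k : K l, ∀ j : Fin r, 0 ≤ minor (j + 1) (k.1 * (g * gᴴ) * k.1ᴴ)) :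
    ∫ k : K m, numerator s L (g * k.1 * x * k.1ᴴ * gᴴ) ∂haarK m
      = numerator s (stair (ZMod 2) r) (g * gᴴ) * numerator s L x := by
  simp only [numerator_eq]
  rw [integral_integral_swap, ← integral_mul_const]
  · refine integral_congr_ae ?_
    have h' : ∀ᵐ k ∂haarK l, ∀ j : Fin r, chi (gap L j) (gap s j)
        (minor (j + 1) (k.1 * (g * gᴴ) * k.1ᴴ)) = chi (gap (stair (ZMod 2) r) j) (gap s j)
        (minor (j + 1) (k.1 * (g * gᴴ) * k.1ᴴ)) := by
      rcases h with h | h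
      · exact Filter.Eventually.of_forall fun k j => by rw [h j, gap_stair]
      · filter_upwards [h] with k hk j
        have := lt_of_le_of_ne (hg k j) (hk j).symm
        rw [chi_of_pos _ _ this, chi_of_pos _ _ this]
    filter_upwards [h'] with k' hk'
    obtain ⟨u, hu⟩ := exists_minor_conj_eq hm (k'.1 * g)
    have e1 : ∀ (k : K m) (j : Fin r),
        minor (j + 1) (k'.1 * (g * k.1 * x * k.1ᴴ * gᴴ) * k'.1ᴴ)
        = minor (j + 1) (k'.1 * (g * gᴴ) * k'.1ᴴ)
          * minor (j + 1) ((u * k).1 * x * (u * k).1ᴴ) := by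
      intro k j
      have := hu (k.1 * x * k.1ᴴ) (j + 1) j.2
      simp only [Submonoid.coe_mul, Matrix.conjTranspose_mul, Matrix.mul_assoc] at this ⊢
      exact this
    have h4 := integral_mul_left_eq_self (μ := haarK m)
      (fun k : K m => ∏ j : Fin r, chi (gap L j) (gap s j) (minor (j + 1) (k.1 * x * k.1ᴴ))) u
    rw [← h4, ← integral_const_mul]
    refine integral_congr_ae (Filter.Eventually.of_forall fun k => ?_)
    simp only
    rw [← Finset.prod_mul_distrib]
    refine Finset.prod_congr rfl fun j _ => ?_
    rw [e1, chi_mul, hk']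
  · have h1 : ∀ (p : K m × K l) (j : Fin r),
        minor (j + 1) (p.2.1 * (g * p.1.1 * x * p.1.1ᴴ * gᴴ) * p.2.1ᴴ)
        = minor (j + 1) ((p.2.1 * g * p.1.1) * x * (p.2.1 * g * p.1.1)ᴴ) := by
      intro p j
      simp only [Matrix.conjTranspose_mul, Matrix.mul_assoc]
    simp only [Function.uncurry_def, h1]
    refine integrable_prod_chi _ _ hs fun j => continuous_minor_conj _ ?_ x
    exact (((continuous_coeK l).comp continuous_snd).matrix_mul continuous_const).matrix_mul
      ((continuous_coeK m).comp continuous_fst)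

open scoped ComplexOrder in
theorem minor_nonneg {l j : ℕ} {x : Matrix (Fin l) (Fin l) ℂ} (hx : x.PosSemidef) :
    0 ≤ minor j x := by
  unfold minor
  have h := hx.mul_mul_conjTranspose_same (proj j l)
  rw [conjTranspose_proj] at h
  exact (Complex.le_def.1 h.det_nonneg).1

open scoped ComplexOrder in
theorem minor_conj_gram_nonneg {l m : ℕ} (g : Matrix (Fin l) (Fin m) ℂ) (k : K l) (j : ℕ) :
    0 ≤ minor j (k.1 * (g * gᴴ) * k.1ᴴ) :=
  minor_nonneg ((Matrix.posSemidef_self_mul_conjTranspose g).mul_mul_conjTranspose_same k.1)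

/-- The block matrix with the blocks `v` and `1` is unitary. -/
theorem exists_unitary_extension {l n : ℕ} (h : n ≤ l) (v : K n) :
    ∃ V : K l, V.1 * proj l n = proj l n * v.1 := by
  have h1 : proj n l * proj l n = 1 := by rw [proj_mul_proj h, proj_self]
  have hP : (proj l n * proj n l)ᴴ = proj l n * proj n l := by
    rw [Matrix.conjTranspose_mul, conjTranspose_proj, conjTranspose_proj]
  refine ⟨⟨proj l n * v.1 * proj n l + (1 - proj l n * proj n l), ?_⟩, ?_⟩
  · rw [Matrix.mem_unitaryGroup_iff, Matrix.star_eq_conjTranspose]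
    have hv := coe_mul_conjTranspose v
    have e2 : (1 - proj l n * proj n l) * proj l n = 0 := by
      rw [Matrix.sub_mul, Matrix.mul_assoc, h1]; simp
    have e3 : proj n l * (1 - proj l n * proj n l) = 0 := by
      rw [Matrix.mul_sub, ← Matrix.mul_assoc, h1]; simp
    have e4 : proj l n * v.1 * proj n l * (proj l n * (v.1ᴴ * proj n l)) = proj l n * proj n l := by
      calc _ = proj l n * (v.1 * (proj n l * proj l n) * v.1ᴴ) * proj n l := by
            simp only [Matrix.mul_assoc]
        _ = _ := by rw [h1, Matrix.mul_one, hv, Matrix.mul_one]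
    rw [Matrix.conjTranspose_add, Matrix.conjTranspose_sub, hP, Matrix.conjTranspose_mul,
      Matrix.conjTranspose_mul, conjTranspose_proj, conjTranspose_proj, Matrix.conjTranspose_one,
      Matrix.add_mul, Matrix.mul_add, Matrix.mul_add, e4]
    have e5 : proj l n * v.1 * proj n l * (1 - proj l n * proj n l) = 0 := by
      rw [Matrix.mul_assoc, e3, Matrix.mul_zero]
    have e6 : (1 - proj l n * proj n l) * (proj l n * (v.1ᴴ * proj n l)) = 0 := by
      rw [← Matrix.mul_assoc, e2, Matrix.zero_mul]
    have e7 : (1 - proj l n * proj n l) * (1 - proj l n * proj n l) = 1 - proj l n * proj n l := by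
      rw [Matrix.mul_sub, Matrix.mul_one, ← Matrix.mul_assoc, e2, Matrix.zero_mul, sub_zero]
    rw [e5, e6, e7]
    abel
  · simp only [Matrix.add_mul, Matrix.sub_mul, Matrix.mul_assoc, h1]
    simp

/-- On matrices supported in the upper left corner the numerator factors through the corner. -/
theorem numerator_embed {l n r : ℕ} (hl : n ≤ l) (hr : r ≤ n) {s : Fin r → ℂ} (hs : s ∈ domain r)
    (L : Fin r → ZMod 2) (x : Matrix (Fin n) (Fin n) ℂ)
    (h : (∀ j, gap L j = 0) ∨
      ∀ᵐ k ∂haarK l, ∀ j : Fin r, minor (j + 1) (k.1 * (proj l n * proj n l) * k.1ᴴ) ≠ 0) :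
    numerator s L (proj l n * x * proj n l)
      = numerator s (stair (ZMod 2) r) (proj l n * proj n l) * numerator s L x := by
  have h2 := integral_numerator hr hs L (proj l n) x (by rwa [conjTranspose_proj])
    fun k j => minor_conj_gram_nonneg _ k _
  rw [conjTranspose_proj] at h2
  rw [← h2]
  have h3 : ∀ k : K n, numerator s L (proj l n * k.1 * x * k.1ᴴ * proj n l)
      = numerator s L (proj l n * x * proj n l) := by
    intro k
    obtain ⟨V, hV⟩ := exists_unitary_extension hl k
    have hV' : proj n l * V.1ᴴ = k.1ᴴ * proj n l := by
      have := congrArg Matrix.conjTranspose hV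
      simpa only [Matrix.conjTranspose_mul, conjTranspose_proj] using this
    rw [← numerator_conj s L (proj l n * x * proj n l) V]
    congr 1
    calc proj l n * k.1 * x * k.1ᴴ * proj n l = (proj l n * k.1) * x * (k.1ᴴ * proj n l) := by
          simp only [Matrix.mul_assoc]
      _ = _ := by rw [← hV, ← hV']; simp only [Matrix.mul_assoc]
  simp [h3]

/-! ### Extension of the parameters -/

theorem gap_ext_castAdd {R : Type*} [Ring R] {r : ℕ} (d : ℕ) (s : Fin r → R) (j : Fin r) :
    gap (ext d s) (Fin.castAdd d j) = gap s j := by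
  have hj := j.2
  unfold gap ext
  simp only [Fin.append_left, Fin.val_castAdd]
  by_cases h : (j : ℕ) + 1 < r
  · rw [dif_pos h, dif_pos (by omega : (j : ℕ) + 1 < r + d)]
    have : (⟨(j : ℕ) + 1, by omega⟩ : Fin (r + d)) = Fin.castAdd d ⟨(j : ℕ) + 1, h⟩ := rfl
    rw [this, Fin.append_left]; abel
  · rw [dif_neg h]
    split_ifs with h2
    · have : (⟨(j : ℕ) + 1, h2⟩ : Fin (r + d)) = Fin.natAdd r ⟨0, by omega⟩ :=
        Fin.ext (by simp; omega)
      rw [this, Fin.append_right, stair, Fin.val_rev]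
      have hd : d = (d - (0 + 1)) + 1 := by omega
      simp only
      nth_rw 1 [hd]
      push_cast; abel
    · have : d = 0 := by omega
      subst this; simp

theorem gap_ext_natAdd {R : Type*} [Ring R] {r : ℕ} (d : ℕ) (s : Fin r → R) (j : Fin d) :
    gap (ext d s) (Fin.natAdd r j) = 0 := by
  rw [← gap_stair R j]
  unfold gap ext
  simp only [Fin.append_right, Fin.val_natAdd]
  by_cases h : (j : ℕ) + 1 < d
  · rw [dif_pos h, dif_pos (by omega : r + (j : ℕ) + 1 < r + d)]
    have : (⟨r + (j : ℕ) + 1, by omega⟩ : Fin (r + d)) = Fin.natAdd r ⟨(j : ℕ) + 1, h⟩ := rfl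
    rw [this, Fin.append_right]
  · rw [dif_neg h, dif_neg (by omega)]

theorem ext_mem_domain {r : ℕ} (d : ℕ) {s : Fin r → ℂ} (hs : s ∈ domain r) :
    ext d s ∈ domain (r + d) := by
  intro j
  induction j using Fin.addCases with
  | left j => rw [gap_ext_castAdd]; exact hs j
  | right j => rw [gap_ext_natAdd]; simp

/-- The factors that belong to the last `d` entries of `ext d s` and `ext d L` are trivial. -/
theorem numerator_ext {l r : ℕ} (d : ℕ) (s : Fin r → ℂ) (L : Fin r → ZMod 2)
    (x : Matrix (Fin l) (Fin l) ℂ) : numerator (ext d s) (ext d L) x = numerator s L x := by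
  simp only [numerator_eq, Fin.prod_univ_add, gap_ext_castAdd, gap_ext_natAdd, chi_zero_zero,
    Finset.prod_const_one, mul_one, Fin.val_castAdd]

theorem ext_stair (R : Type*) [Ring R] (r d : ℕ) : ext d (stair R r) = stair R (r + d) := by
  funext j
  induction j using Fin.addCases with
  | left j =>
    rw [ext, Fin.append_left, stair, stair, Fin.val_rev, Fin.val_rev, Fin.val_castAdd,
      ← Nat.cast_add]
    congr 1
    omega
  | right j =>
    rw [ext, Fin.append_right, stair, stair, Fin.val_rev, Fin.val_rev, Fin.val_natAdd]
    congr 1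
    omega

theorem normalization_ext {r : ℕ} (l d : ℕ) (s : Fin r → ℂ) : normalization l (ext d s)
    = numerator s (stair (ZMod 2) r) (proj l (r + d) * proj (r + d) l) := by
  rw [normalization_eq, ← ext_stair, numerator_ext]

/-- The compatibility of the normalizing integrals of `s` and of `ext d s`. -/
theorem normalization_chain {r l d : ℕ} (hl : r + d ≤ l) {s : Fin r → ℂ} (hs : s ∈ domain r) :
    normalization l s = normalization l (ext d s) * normalization (r + d) s := by
  rw [normalization_ext, normalization_eq, normalization_eq,
    ← numerator_embed hl (Nat.le_add_right r d) hs _ _ (Or.inl fun j => gap_stair _ j)]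
  congr 1
  rw [← Matrix.mul_assoc, proj_mul_proj' (Nat.le_add_right r d), Matrix.mul_assoc,
    proj_mul_proj (Nat.le_add_right r d)]

open scoped ENNReal

/-! ### The squared moduli of a row of a random unitary matrix -/

/-- The open simplex `{u | u_i > 0, ∑ u_i < 1}`. -/
def simplex (n : ℕ) : Set (Fin n → ℝ) := {u | (∀ i, 0 < u i) ∧ ∑ i, u i < 1}

theorem isOpen_simplex (n : ℕ) : IsOpen (simplex n) := by
  have h : simplex n = (⋂ i, {u : Fin n → ℝ | 0 < u i}) ∩ {u | ∑ i, u i < 1} := by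
    ext u; simp [simplex]
  rw [h]
  exact (isOpen_iInter_of_finite fun i => isOpen_lt continuous_const (continuous_apply i)).inter
    (isOpen_lt (by fun_prop) continuous_const)

theorem measurableSet_simplex (n : ℕ) : MeasurableSet (simplex n) :=
  (isOpen_simplex n).measurableSet

theorem measurableSet_forall_pos {α : Type*} [MeasurableSpace α] {n : ℕ} {g : α → Fin n → ℝ}
    (hg : Measurable g) : MeasurableSet {a | ∀ i, 0 < g a i} := by
  simp only [Set.ofPred_forall]
  exact MeasurableSet.iInter fun i =>
    measurableSet_lt measurable_const ((measurable_pi_apply i).comp hg)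

/-- Integration over the simplex, scaled: the ray through a point of the cone is parametrized by
the sum of the coordinates. -/
theorem lintegral_simplex_scaled {n : ℕ} {f : (Fin n → ℝ) → ℝ≥0∞} (hf : Measurable f) (S : ℝ) :
    ∫⁻ v : Fin n → ℝ, (if (∀ i, 0 < v i) ∧ ∑ i, v i < S ∧ S < 1 then f (fun i => v i / S) else 0)
      = (Set.Ioo (0 : ℝ) 1).indicator (fun S => ENNReal.ofReal (S ^ n)) S
        * ∫⁻ u in simplex n, f u := by
  by_cases hS : S ∈ Set.Ioo (0 : ℝ) 1
  · rw [Set.indicator_of_mem hS, ← lintegral_indicator (measurableSet_simplex n)]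
    have h1 := Measure.map_addHaar_smul (volume : Measure (Fin n → ℝ)) (inv_ne_zero hS.1.ne')
    have h2 : ∫⁻ v, (simplex n).indicator f v
        ∂(Measure.map (fun v : Fin n → ℝ => S⁻¹ • v) volume)
        = ENNReal.ofReal (S ^ n) * ∫⁻ v, (simplex n).indicator f v := by
      rw [h1, lintegral_smul_measure, smul_eq_mul]
      congr 2
      have : (0 : ℝ) < S ^ n := pow_pos hS.1 n
      simp [abs_of_pos this]
    rw [← h2, lintegral_map (hf.indicator (measurableSet_simplex n)) (measurable_const_smul _)]
    refine lintegral_congr fun v => ?_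
    have h3 : (S⁻¹ • v ∈ simplex n) ↔ ((∀ i, 0 < v i) ∧ ∑ i, v i < S ∧ S < 1) := by
      have hi : 0 < S⁻¹ := inv_pos.2 hS.1
      simp only [simplex, Set.mem_ofPred_eq, Pi.smul_apply, smul_eq_mul, ← Finset.mul_sum, hS.2,
        and_true]
      rw [inv_mul_lt_iff₀ hS.1, mul_one]
      simp [hi]
    by_cases hv : (∀ i, 0 < v i) ∧ ∑ i, v i < S ∧ S < 1
    · rw [if_pos hv, Set.indicator_of_mem (h3.2 hv)]
      congr 1
      funext i
      simp [div_eq_inv_mul]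
    · rw [if_neg hv, Set.indicator_of_notMem (fun h => hv (h3.1 h))]
  · rw [Set.indicator_of_notMem hS, zero_mul]
    refine (lintegral_congr fun v => if_neg ?_).trans lintegral_zero
    rintro ⟨h1, h2, h3⟩
    exact hS ⟨(Finset.sum_nonneg fun i _ => (h1 i).le).trans_lt h2, h3⟩

/-- The cone over the simplex in one more dimension, truncated at height one. -/
theorem lintegral_cone {n : ℕ} {f : (Fin n → ℝ) → ℝ≥0∞} (hf : Measurable f) :
    ∫⁻ e : Fin (n + 1) → ℝ, (if (∀ i, 0 < e i) ∧ ∑ i, e i < 1 then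
        f (fun i => e (Fin.castSucc i) / ∑ i, e i) else 0)
      = (∫⁻ S in Set.Ioo (0 : ℝ) 1, ENNReal.ofReal (S ^ n)) * ∫⁻ u in simplex n, f u := by
  let F : ℝ × (Fin n → ℝ) → ℝ≥0∞ := fun p =>
    if (∀ i, 0 < p.2 i) ∧ 0 < p.1 ∧ p.1 + ∑ i, p.2 i < 1 then
      f (fun i => p.2 i / (p.1 + ∑ i, p.2 i)) else 0
  have hset : MeasurableSet {p : ℝ × (Fin n → ℝ) |
      (∀ i, 0 < p.2 i) ∧ 0 < p.1 ∧ p.1 + ∑ i, p.2 i < 1} := by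
    refine MeasurableSet.inter ?_ (MeasurableSet.inter ?_ ?_)
    · exact measurableSet_forall_pos measurable_snd
    · exact measurableSet_lt measurable_const measurable_fst
    · have h : Measurable fun p : ℝ × (Fin n → ℝ) => p.1 + ∑ i, p.2 i := by fun_prop
      exact measurableSet_lt h measurable_const
  have hF : Measurable F := by
    have h : Measurable fun p : ℝ × (Fin n → ℝ) => fun i => p.2 i / (p.1 + ∑ i, p.2 i) := by
      fun_prop
    exact Measurable.ite hset (hf.comp h) measurable_const
  have h1 := (volume_preserving_piFinSuccAbove (fun _ : Fin (n + 1) => ℝ)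
    (Fin.last n)).lintegral_comp hF
  have h2 : ∀ e : Fin (n + 1) → ℝ,
      F (MeasurableEquiv.piFinSuccAbove (fun _ : Fin (n + 1) => ℝ) (Fin.last n) e)
      = if (∀ i, 0 < e i) ∧ ∑ i, e i < 1 then
        f (fun i => e (Fin.castSucc i) / ∑ i, e i) else 0 := by
    intro e
    have hp : MeasurableEquiv.piFinSuccAbove (fun _ : Fin (n + 1) => ℝ) (Fin.last n) e
        = (e (Fin.last n), fun i => e (Fin.castSucc i)) := by
      refine Prod.ext rfl ?_
      funext i
      simp [MeasurableEquiv.piFinSuccAbove, Fin.insertNthEquiv, Fin.init]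
    rw [hp]
    simp only [F]
    simp only [Fin.sum_univ_castSucc, Fin.forall_fin_succ', add_comm (e (Fin.last n)), and_assoc]
  simp only [h2] at h1
  rw [h1, Measure.volume_eq_prod, lintegral_prod_symm _ hF.aemeasurable]
  have h3 : ∀ v : Fin n → ℝ, ∫⁻ t : ℝ, F (t, v) = ∫⁻ S : ℝ,
      (if (∀ i, 0 < v i) ∧ ∑ i, v i < S ∧ S < 1 then f (fun i => v i / S) else 0) := by
    intro v
    rw [← lintegral_sub_right_eq_self _ (∑ i, v i)]
    refine lintegral_congr fun S => ?_
    simp [F]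
  simp only [h3]
  rw [lintegral_lintegral_swap]
  · simp only [lintegral_simplex_scaled hf]
    rw [lintegral_mul_const _ (Measurable.indicator (by fun_prop) measurableSet_Ioo),
      lintegral_indicator measurableSet_Ioo]
  · refine (Measurable.ite ?_ (hf.comp (measurable_pi_lambda _ fun i => ?_))
      measurable_const).aemeasurable
    · refine MeasurableSet.inter ?_ (MeasurableSet.inter ?_ ?_)
      · exact measurableSet_forall_pos measurable_fst
      · exact measurableSet_lt (by fun_prop) measurable_snd
      · exact measurableSet_lt measurable_snd measurable_const
    · fun_prop

/-- The area `π |z|²` of the disc through `z`. -/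
def discArea (z : ℂ) : ℝ := Real.pi * Complex.normSq z

theorem continuous_discArea : Continuous discArea := continuous_const.mul Complex.continuous_normSq

/-- The map `z ↦ π |z|²` carries the area of the plane to the length on the positive half-line. -/
theorem measurePreserving_discArea :
    MeasurePreserving discArea volume (volume.restrict (Set.Ioi 0)) := by
  refine ⟨continuous_discArea.measurable, Eq.symm ?_⟩
  refine Measure.ext_of_Ico _ _ fun a b hab => ?_
  have hball : ∀ t : ℝ, volume (discArea ⁻¹' Set.Iio t) = ENNReal.ofReal t := by
    intro t
    have hs : discArea ⁻¹' Set.Iio t = Metric.ball 0 (Real.sqrt (t / Real.pi)) := by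
      ext z
      simp only [discArea, Set.mem_preimage, Set.mem_Iio, mem_ball_zero_iff,
        Complex.normSq_eq_norm_sq]
      rw [Real.lt_sqrt (norm_nonneg z), lt_div_iff₀ Real.pi_pos, mul_comm]
    rw [hs, Complex.volume_ball, ← ENNReal.ofReal_pow (Real.sqrt_nonneg _)]
    rcases le_total 0 t with ht | ht
    · rw [Real.sq_sqrt (div_nonneg ht Real.pi_pos.le), ← ENNReal.ofReal_coe_nnreal,
        ← ENNReal.ofReal_mul (div_nonneg ht Real.pi_pos.le), NNReal.coe_real_pi,
        div_mul_cancel₀ _ Real.pi_pos.ne']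
    · rw [Real.sqrt_eq_zero_of_nonpos (div_nonpos_of_nonpos_of_nonneg ht Real.pi_pos.le),
        ENNReal.ofReal_of_nonpos ht]
      simp
  have hd : discArea ⁻¹' Set.Ico a b = discArea ⁻¹' Set.Iio b \ discArea ⁻¹' Set.Iio a := by
    ext z; simp [and_comm]
  rw [Measure.map_apply continuous_discArea.measurable measurableSet_Ico, hd,
    measure_sdiff (Set.preimage_mono (Set.Iio_subset_Iio hab.le))
      (continuous_discArea.measurable measurableSet_Iio).nullMeasurableSet
      (by rw [hball]; exact ENNReal.ofReal_ne_top), hball, hball,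
    Measure.restrict_apply measurableSet_Ico]
  rcases le_or_gt a 0 with ha | ha
  · rw [ENNReal.ofReal_of_nonpos ha, tsub_zero]
    have h1 : Set.Ioo 0 b ⊆ Set.Ico a b ∩ Set.Ioi 0 := fun x hx => ⟨⟨ha.trans hx.1.le, hx.2⟩, hx.1⟩
    have h2 : Set.Ico a b ∩ Set.Ioi 0 ⊆ Set.Ioo 0 b := fun x hx => ⟨hx.2, hx.1.2⟩
    rw [Set.Subset.antisymm h2 h1, Real.volume_Ioo, sub_zero]
  · have h1 : Set.Ico a b ∩ Set.Ioi 0 = Set.Ico a b :=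
      Set.inter_eq_left.2 fun x hx => lt_of_lt_of_le ha hx.1
    rw [h1, Real.volume_Ico, ENNReal.ofReal_sub _ ha.le]

theorem lintegral_complex_ball {n : ℕ} {f : (Fin n → ℝ) → ℝ≥0∞} (hf : Measurable f) :
    ∫⁻ Z : Fin (n + 1) → ℂ, (if ∑ i, discArea (Z i) < 1 then
        f (fun i => discArea (Z (Fin.castSucc i)) / ∑ i, discArea (Z i)) else 0)
      = (∫⁻ S in Set.Ioo (0 : ℝ) 1, ENNReal.ofReal (S ^ n)) * ∫⁻ u in simplex n, f u := by
  rw [← lintegral_cone hf]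
  have h1 : MeasurePreserving (fun (Z : Fin (n + 1) → ℂ) i => discArea (Z i)) volume
      (volume.restrict (Set.univ.pi fun _ => Set.Ioi 0)) := by
    have := measurePreserving_pi (fun _ : Fin (n + 1) => (volume : Measure ℂ))
      (fun _ => volume.restrict (Set.Ioi (0 : ℝ))) (fun _ => measurePreserving_discArea)
    rwa [← Measure.restrict_pi_pi] at this
  have hm : Measurable fun e : Fin (n + 1) → ℝ => (if ∑ i, e i < 1 then
        f (fun i => e (Fin.castSucc i) / ∑ i, e i) else 0) := by
    have h : Measurable fun e : Fin (n + 1) → ℝ => fun i => e (Fin.castSucc i) / ∑ i, e i := by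
      fun_prop
    exact Measurable.ite (measurableSet_lt (by fun_prop) measurable_const) (hf.comp h)
      measurable_const
  rw [h1.lintegral_comp hm,
    ← lintegral_indicator (MeasurableSet.univ_pi fun _ => measurableSet_Ioi)]
  refine lintegral_congr fun e => ?_
  have he : e ∈ Set.univ.pi (fun _ : Fin (n + 1) => Set.Ioi (0 : ℝ)) ↔ ∀ i, 0 < e i := by simp
  by_cases h : ∀ i, 0 < e i
  · rw [Set.indicator_of_mem (he.2 h)]
    simp [h]
  · rw [Set.indicator_of_notMem (fun h' => h (he.1 h'))]
    simp [h]

theorem sum_discArea_vecMul {n : ℕ} (u : K n) (Z : Fin n → ℂ) :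
    ∑ i, discArea ((Z ᵥ* u.1) i) = ∑ i, discArea (Z i) := by
  have h : ∀ Y : Fin n → ℂ, ((∑ i, discArea (Y i) : ℝ) : ℂ) = Real.pi * (Y ⬝ᵥ star Y) := by
    intro Y
    simp only [discArea, dotProduct, Pi.star_apply, Complex.ofReal_sum, Complex.ofReal_mul,
      Finset.mul_sum]
    refine Finset.sum_congr rfl fun i _ => ?_
    rw [show star (Y i) = (starRingEnd ℂ) (Y i) from rfl, Complex.mul_conj]
  have h2 : (Z ᵥ* u.1) ⬝ᵥ star (Z ᵥ* u.1) = Z ⬝ᵥ star Z := by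
    rw [Matrix.star_vecMul, Matrix.dotProduct_mulVec, Matrix.vecMul_vecMul,
      coe_mul_conjTranspose, Matrix.vecMul_one]
  exact_mod_cast (h _).trans ((congrArg _ h2).trans (h Z).symm)

theorem measurePreserving_vecMul {n : ℕ} (u : K n) :
    MeasurePreserving (fun Z : Fin n → ℂ => Z ᵥ* u.1) volume volume := by
  have hdet : LinearMap.det ((Matrix.vecMulLinear u.1).restrictScalars ℝ) = 1 := by
    rw [LinearMap.det_restrictScalars, Algebra.norm_complex_apply]
    have h1 : LinearMap.det (Matrix.vecMulLinear u.1) = u.1.det := by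
      rw [← Matrix.det_transpose, ← LinearMap.det_toLin']
      congr 1
      refine LinearMap.ext fun v => ?_
      simp [Matrix.mulVec_transpose]
    have h2 := Matrix.det_of_mem_unitary u.2
    have h3 : Complex.normSq u.1.det = 1 := by
      have := (Unitary.mem_iff.1 h2).2
      rw [show star u.1.det = (starRingEnd ℂ) u.1.det from rfl, Complex.mul_conj] at this
      exact_mod_cast this
    rw [h1, h3]
  have h := Measure.map_linearMap_addHaar_eq_smul_addHaar
    (volume : Measure (Fin n → ℂ)) (f := (Matrix.vecMulLinear u.1).restrictScalars ℝ)
    (by rw [hdet]; exact one_ne_zero)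
  rw [hdet] at h
  refine ⟨(Continuous.matrix_vecMul continuous_id continuous_const).measurable, ?_⟩
  rw [show (fun Z : Fin n → ℂ => Z ᵥ* u.1) = ((Matrix.vecMulLinear u.1).restrictScalars ℝ) from rfl,
    h]
  simp

/-- The squared moduli of all but the last entry in the last row of `k`. The last one is determined
by these, as the row is a unit vector. -/
def rowWeights {n : ℕ} (k : K (n + 1)) (i : Fin n) : ℝ :=
  Complex.normSq (k.1 (Fin.last n) (Fin.castSucc i))

theorem continuous_rowWeights (n : ℕ) : Continuous (rowWeights (n := n)) := by
  refine continuous_pi fun i => Complex.continuous_normSq.comp ?_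
  exact (continuous_apply_apply (Fin.last n) (Fin.castSucc i)).comp (continuous_coeK (n + 1))

/-- Every vector is a multiple of the last row of a unitary matrix. -/
theorem exists_unitary_row {n : ℕ} {Z : Fin (n + 1) → ℂ} :
    ∃ (c : ℂ) (u : K (n + 1)), Z = c • u.1 (Fin.last n) := by
  obtain ⟨T, u, hT, hA⟩ := exists_lower_mul_unitary (Matrix.of fun _ : Fin (n + 1) => Z)
  let P : K (n + 1) := ⟨(Equiv.swap (0 : Fin (n + 1)) (Fin.last n)).toPEquiv.toMatrix, by
    rw [Matrix.mem_unitaryGroup_iff]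
    ext i j
    simp [Matrix.mul_apply, PEquiv.toMatrix_apply, Matrix.star_apply, Matrix.one_apply]⟩
  refine ⟨T 0 0, P * u, ?_⟩
  funext j
  have h0 : Z j = (T * u.1) 0 j := by rw [← hA]; rfl
  have h1 : (P * u).1 (Fin.last n) j = u.1 0 j := by
    simp [P, Matrix.mul_apply, PEquiv.toMatrix_apply]
  rw [h0, Pi.smul_apply, h1, Matrix.mul_apply, Finset.sum_eq_single 0]
  · rfl
  · intro i _ hi
    rw [hT 0 i (Fin.pos_of_ne_zero hi), zero_mul]
  · simp

/-- The squared moduli of a row of a Haar distributed unitary matrix are uniformly distributed on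
the simplex. -/
theorem exists_map_rowWeights (n : ℕ) :
    ∃ c : ℝ≥0∞, c ≠ ∞ ∧
      Measure.map rowWeights (haarK (n + 1)) = c • volume.restrict (simplex n) := by
  set I : ℝ≥0∞ := volume {Z : Fin (n + 1) → ℂ | ∑ i, discArea (Z i) < 1} with hI
  set A : ℝ≥0∞ := ∫⁻ S in Set.Ioo (0 : ℝ) 1, ENNReal.ofReal (S ^ n) with hA
  have hcont : Continuous fun Z : Fin (n + 1) → ℂ => ∑ i, discArea (Z i) :=
    continuous_finsetSum _ fun i _ => continuous_discArea.comp (continuous_apply i)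
  have hopen : IsOpen {Z : Fin (n + 1) → ℂ | ∑ i, discArea (Z i) < 1} :=
    isOpen_lt hcont continuous_const
  have hI0 : I ≠ 0 := (hopen.measure_pos _ ⟨0, by simp [discArea]⟩).ne'
  have hItop : I ≠ ∞ := by
    refine ((measure_mono ?_).trans_lt (measure_closedBall_lt_top (x := 0) (r := 1))).ne
    intro Z hZ
    rw [mem_closedBall_zero_iff, pi_norm_le_iff_of_nonneg zero_le_one]
    intro i
    have h1 : discArea (Z i) ≤ ∑ i, discArea (Z i) :=
      Finset.single_le_sum (f := fun i => discArea (Z i))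
        (fun i _ => mul_nonneg Real.pi_pos.le (Complex.normSq_nonneg _)) (Finset.mem_univ i)
    have h2 : discArea (Z i) < 1 := h1.trans_lt hZ
    rw [discArea, Complex.normSq_eq_norm_sq] at h2
    have h3 := Real.pi_gt_three
    nlinarith [norm_nonneg (Z i), sq_nonneg (‖Z i‖)]
  have hAtop : A ≠ ∞ := by
    refine ((setLIntegral_mono' (g := fun _ => 1) measurableSet_Ioo fun S hS => ?_).trans_lt ?_).ne
    · rw [← ENNReal.ofReal_one]
      exact ENNReal.ofReal_le_ofReal (pow_le_one₀ hS.1.le hS.2.le)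
    · simp
  refine ⟨A / I, ENNReal.div_ne_top hAtop hI0, ?_⟩
  refine Measure.ext_of_lintegral _ fun f hf => ?_
  rw [lintegral_map hf (continuous_rowWeights n).measurable, lintegral_smul_measure, smul_eq_mul]
  let h : (Fin (n + 1) → ℂ) → ℝ≥0∞ := fun Z =>
    f (fun i => discArea (Z (Fin.castSucc i)) / ∑ i, discArea (Z i))
  have hhm : Measurable h := by
    refine hf.comp (measurable_pi_lambda _ fun i => ?_)
    exact (continuous_discArea.measurable.comp (measurable_pi_apply _)).div hcont.measurable
  let G : (Fin (n + 1) → ℂ) → ℝ≥0∞ := fun Z => if ∑ i, discArea (Z i) < 1 then h Z else 0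
  have hGm : Measurable G := Measurable.ite hopen.measurableSet hhm measurable_const
  -- the degree zero function `h` has the same average over all spheres
  have hrow : ∀ Z : Fin (n + 1) → ℂ, Z ≠ 0 →
      ∫⁻ k : K (n + 1), h (Z ᵥ* k.1) ∂haarK (n + 1)
        = ∫⁻ k : K (n + 1), f (rowWeights k) ∂haarK (n + 1) := by
    intro Z hZ
    obtain ⟨c, u, rfl⟩ := exists_unitary_row (Z := Z)
    have hc : c ≠ 0 := fun h0 => hZ (by simp [h0])
    rw [← lintegral_mul_left_eq_self (fun k : K (n + 1) => f (rowWeights k)) u]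
    refine lintegral_congr fun k => ?_
    have h1 : ∀ i, discArea (((c • u.1 (Fin.last n)) ᵥ* k.1) i)
        = Complex.normSq c * discArea ((u * k).1 (Fin.last n) i) := by
      intro i
      rw [Matrix.smul_vecMul, Pi.smul_apply, smul_eq_mul, discArea, discArea, Complex.normSq_mul,
        Submonoid.coe_mul, Matrix.mul_apply_eq_vecMul]
      ring
    have h2 : ∑ i, discArea ((u * k).1 (Fin.last n) i) = Real.pi := by
      have := sum_discArea_vecMul (u * k) (Pi.single (Fin.last n) 1)
      rw [Matrix.single_one_vecMul] at this
      rw [show (∑ i, discArea ((u * k).1 (Fin.last n) i))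
        = ∑ i, discArea ((u * k).1.row (Fin.last n) i) from rfl, this,
        Finset.sum_eq_single (Fin.last n)]
      · simp [discArea]
      · intro i _ hi
        simp [discArea, hi]
      · simp
    simp only [h, h1, ← Finset.mul_sum, h2]
    congr 1
    funext i
    have hc' : Complex.normSq c ≠ 0 := by simpa using hc
    rw [rowWeights, discArea]
    field_simp
  -- averaging over `k` first, only the volume of the ball remains
  have key : ∫⁻ Z, G Z = I * ∫⁻ k : K (n + 1), f (rowWeights k) ∂haarK (n + 1) := by
    have h1 : ∫⁻ Z, G Z = ∫⁻ k : K (n + 1), ∫⁻ Z, G (Z ᵥ* k.1) ∂volume ∂haarK (n + 1) := by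
      simp [(measurePreserving_vecMul _).lintegral_comp hGm]
    rw [h1, lintegral_lintegral_swap]
    · have h2 : ∀ᵐ Z : Fin (n + 1) → ℂ, ∫⁻ k : K (n + 1), G (Z ᵥ* k.1) ∂haarK (n + 1)
          = {Z : Fin (n + 1) → ℂ | ∑ i, discArea (Z i) < 1}.indicator
            (fun _ => ∫⁻ k : K (n + 1), f (rowWeights k) ∂haarK (n + 1)) Z := by
        have h0 : ∀ᵐ Z : Fin (n + 1) → ℂ, Z ≠ 0 := by
          rw [ae_iff]; simp
        filter_upwards [h0] with Z hZ
        simp only [G, sum_discArea_vecMul]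
        by_cases h3 : ∑ i, discArea (Z i) < 1
        · rw [Set.indicator_of_mem (by exact h3), ← hrow Z hZ]
          simp [h3]
        · rw [Set.indicator_of_notMem (by exact h3)]
          simp [h3]
      rw [lintegral_congr_ae h2, lintegral_indicator hopen.measurableSet, lintegral_const,
        Measure.restrict_apply_univ, mul_comm]
    · refine (hGm.comp ?_).aemeasurable
      exact (Continuous.matrix_vecMul continuous_snd
        ((continuous_coeK (n + 1)).comp continuous_fst)).measurable
  have key2 := lintegral_complex_ball hf
  change ∫⁻ Z, G Z = A * _ at key2
  rw [key2] at key
  rw [ENNReal.div_eq_inv_mul, mul_assoc, key, ← mul_assoc,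
    ENNReal.inv_mul_cancel hI0 hItop, one_mul]

/-! ### Interlacing coordinates on the simplex -/

/-- The product `∏_{i<j} (x_i - x_j)`. -/
def vdm {R : Type*} [CommRing R] {n : ℕ} (x : Fin n → R) : R :=
  ∏ i, ∏ j, if i < j then x i - x j else 1

theorem vdm_castSucc {R : Type*} [CommRing R] {n : ℕ} (x : Fin (n + 1) → R) :
    vdm x = vdm (fun i : Fin n => x i.castSucc) * ∏ i : Fin n, (x i.castSucc - x (Fin.last n)) := by
  have h : ∀ i : Fin n, ¬ Fin.last n < i.castSucc := fun i => (Fin.castSucc_lt_last i).not_gt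
  simp [vdm, Fin.prod_univ_castSucc, Finset.prod_mul_distrib, Fin.castSucc_lt_last, h]

theorem vdm_eq_prod_Ioi {R : Type*} [CommRing R] {n : ℕ} (x : Fin n → R) :
    vdm x = ∏ i, ∏ j ∈ Finset.Ioi i, (x i - x j) := by
  unfold vdm
  refine Finset.prod_congr rfl fun i _ => ?_
  rw [← Finset.prod_filter]
  congr 1
  ext j; simp

theorem det_eq_vdm {R : Type*} [CommRing R] {n : ℕ} (x : Fin n → R) :
    (Matrix.of fun i j : Fin n => x i ^ ((Fin.rev j : Fin n) : ℕ)).det = vdm x := by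
  have h := Matrix.det_projVandermonde (fun _ : Fin n => (1 : R)) x
  simp only [one_mul] at h
  rw [vdm_eq_prod_Ioi]
  simp only [projVandermonde, rectVandermonde, one_pow, one_mul] at h
  exact h

theorem vdm_pos {n : ℕ} {x : Fin n → ℝ} (hx : StrictAnti x) : 0 < vdm x := by
  refine Finset.prod_pos fun i _ => Finset.prod_pos fun j _ => ?_
  split_ifs with h
  · exact sub_pos.2 (hx h)
  · exact one_pos

theorem abs_vdm_sq {n : ℕ} (x : Fin n → ℝ) :
    ∏ i, ∏ j ∈ Finset.univ.erase i, |x i - x j| = |vdm x| ^ 2 := by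
  have h := Finset.prod_prod_Ioi_mul_eq_prod_prod_off_diag fun i j : Fin n => |x j - x i|
  have h2 : ∀ i : Fin n, Finset.univ.erase i = ({i}ᶜ : Finset (Fin n)) := fun i => by ext; simp
  simp only [h2]
  rw [← h, vdm_eq_prod_Ioi, Finset.abs_prod, ← Finset.prod_pow]
  refine Finset.prod_congr rfl fun i _ => ?_
  rw [Finset.abs_prod, ← Finset.prod_pow]
  refine Finset.prod_congr rfl fun j _ => ?_
  rw [abs_sub_comm (x j), sq]

/-- The box of points interlacing with the decreasing sequence `lam`. -/
def box {n : ℕ} (lam : Fin (n + 1) → ℝ) : Set (Fin n → ℝ) :=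
  Set.univ.pi fun i => Set.Ioo (lam i.succ) (lam i.castSucc)

/-- The residues of `∏_j (z - μ_j) / ∏_i (z - lam_i)` at the points `lam_i`. -/
def residue {n : ℕ} (lam : Fin (n + 1) → ℝ) (μ : Fin n → ℝ) (i : Fin (n + 1)) : ℝ :=
  ∏ j, (lam i - μ j) / (lam i - lam (i.succAbove j))

theorem strictAnti_of_mem_box {n : ℕ} {lam : Fin (n + 1) → ℝ} (hl : StrictAnti lam) {μ : Fin n → ℝ}
    (hμ : μ ∈ box lam) : StrictAnti μ := by
  intro i j hij
  have h1 := (hμ i trivial).1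
  have h2 := (hμ j trivial).2
  have h3 : lam j.castSucc ≤ lam i.succ := hl.antitone (by rwa [Fin.succ_le_castSucc_iff])
  linarith

theorem residue_pos {n : ℕ} {lam : Fin (n + 1) → ℝ} (hl : StrictAnti lam) {μ : Fin n → ℝ}
    (hμ : μ ∈ box lam) (i : Fin (n + 1)) : 0 < residue lam μ i := by
  refine Finset.prod_pos fun j _ => ?_
  have h := hμ j trivial
  rcases lt_or_ge j.castSucc i with hj | hj
  · rw [Fin.succAbove_of_castSucc_lt _ _ hj]
    refine div_pos_of_neg_of_neg ?_ (sub_neg.2 (hl hj))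
    have := hl.antitone (Fin.castSucc_lt_iff_succ_le.1 hj)
    linarith [h.1]
  · rw [Fin.succAbove_of_le_castSucc _ _ hj]
    refine div_pos ?_ (sub_pos.2 (hl (hj.trans_lt (Fin.castSucc_lt_succ))))
    have := hl.antitone hj
    linarith [h.2]

theorem sub_succAbove_ne_zero {n : ℕ} {lam : Fin (n + 1) → ℝ} (hl : StrictAnti lam)
    (i : Fin (n + 1)) (j : Fin n) : lam i - lam (i.succAbove j) ≠ 0 :=
  sub_ne_zero.2 fun h => Fin.succAbove_ne i j (hl.injective h).symm

theorem residue_mul_prod {n : ℕ} {lam : Fin (n + 1) → ℝ} (hl : StrictAnti lam) (μ : Fin n → ℝ)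
    (i : Fin (n + 1)) :
    residue lam μ i * ∏ j, (lam i - lam (i.succAbove j)) = ∏ j, (lam i - μ j) := by
  rw [residue, ← Finset.prod_mul_distrib]
  exact Finset.prod_congr rfl fun j _ => div_mul_cancel₀ _ (sub_succAbove_ne_zero hl i j)

theorem prod_erase_eq_prod_succAbove {n : ℕ} (f : Fin (n + 1) → ℝ) (i : Fin (n + 1)) :
    ∏ q ∈ Finset.univ.erase i, f q = ∏ j, f (i.succAbove j) := by
  have h : (Finset.univ.erase i : Finset (Fin (n + 1))) = Finset.univ.map i.succAboveEmb := by
    ext q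
    simp only [Finset.mem_erase, Finset.mem_univ, and_true, Finset.mem_map, true_and]
    exact ⟨fun h => Fin.exists_succAbove_eq h, fun ⟨j, hj⟩ => hj ▸ Fin.succAbove_ne i j⟩
  rw [h, Finset.prod_map]; rfl

theorem sum_residue {n : ℕ} {lam : Fin (n + 1) → ℝ} (hl : StrictAnti lam) (μ : Fin n → ℝ) :
    ∑ i, residue lam μ i = 1 := by
  have hm := Polynomial.monic_prod_X_sub_C μ Finset.univ
  have hd : (∏ j, (Polynomial.X - Polynomial.C (μ j))).degree = (n : WithBot ℕ) := by
    rw [Polynomial.degree_prod]; simp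
  have h := Lagrange.leadingCoeff_eq_sum (s := Finset.univ) (v := lam) hl.injective.injOn
    (P := ∏ j, (Polynomial.X - Polynomial.C (μ j))) (by rw [hd]; simp)
  rw [hm.leadingCoeff] at h
  rw [h]
  refine Finset.sum_congr rfl fun i _ => ?_
  rw [prod_erase_eq_prod_succAbove fun q => lam i - lam q, residue, Finset.prod_div_distrib,
    Polynomial.eval_prod]
  simp

theorem residue_mem_simplex {n : ℕ} {lam : Fin (n + 1) → ℝ} (hl : StrictAnti lam) {μ : Fin n → ℝ}
    (hμ : μ ∈ box lam) : (fun i : Fin n => residue lam μ i.castSucc) ∈ simplex n := by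
  refine ⟨fun i => residue_pos hl hμ _, ?_⟩
  have h := sum_residue hl μ
  rw [Fin.sum_univ_castSucc] at h
  have := residue_pos hl hμ (Fin.last n)
  linarith

/-- Two monic polynomials of degree `n` with given roots that agree at `n + 1` points agree. -/
theorem prod_sub_eq_of_eval {n : ℕ} {lam : Fin (n + 1) → ℝ} (hl : StrictAnti lam)
    {μ ν : Fin n → ℝ} (h : ∀ i, ∏ j, (lam i - μ j) = ∏ j, (lam i - ν j)) (t : ℝ) :
    ∏ j, (t - μ j) = ∏ j, (t - ν j) := by
  have hp : ∏ j, (Polynomial.X - Polynomial.C (μ j))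
      = ∏ j, (Polynomial.X - Polynomial.C (ν j)) := by
    refine Polynomial.eq_of_degree_sub_lt_of_eval_index_eq Finset.univ hl.injective.injOn ?_ ?_
    · refine (Polynomial.degree_sub_le _ _).trans_lt (max_lt ?_ ?_) <;>
      · simp only [Polynomial.degree_prod, Polynomial.degree_X_sub_C, Finset.sum_const,
          Finset.card_univ, Fintype.card_fin, nsmul_eq_mul, mul_one]
        exact_mod_cast Nat.lt_succ_self n
    · intro i _
      simpa [Polynomial.eval_prod] using h i
  simpa [Polynomial.eval_prod] using congrArg (Polynomial.eval t) hp

theorem eq_of_mem_box {n : ℕ} {lam : Fin (n + 1) → ℝ} (hl : StrictAnti lam) {μ ν : Fin n → ℝ}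
    (hμ : μ ∈ box lam) (hν : ν ∈ box lam) (h : ∀ i, ∏ j, (lam i - μ j) = ∏ j, (lam i - ν j)) :
    μ = ν := by
  funext j
  have h1 := prod_sub_eq_of_eval hl h (μ j)
  rw [Finset.prod_eq_zero (Finset.mem_univ j) (sub_self _)] at h1
  obtain ⟨p, -, hp⟩ := Finset.prod_eq_zero_iff.1 h1.symm
  have hp' : μ j = ν p := sub_eq_zero.1 hp
  rcases lt_trichotomy j p with hjp | hjp | hjp
  · have h3 : lam p.castSucc ≤ lam j.succ := hl.antitone (by rwa [Fin.succ_le_castSucc_iff])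
    linarith [(hμ j trivial).1, (hν p trivial).2]
  · rw [hp', hjp]
  · have h3 : lam j.castSucc ≤ lam p.succ := hl.antitone (by rwa [Fin.succ_le_castSucc_iff])
    linarith [(hμ j trivial).2, (hν p trivial).1]

theorem residue_eq_of_castSucc {n : ℕ} {lam : Fin (n + 1) → ℝ} (hl : StrictAnti lam)
    {w : Fin (n + 1) → ℝ} (hw : ∑ i, w i = 1) {μ : Fin n → ℝ}
    (h : ∀ i : Fin n, w i.castSucc = residue lam μ i.castSucc) : w = residue lam μ := by
  funext i
  induction i using Fin.lastCases with
  | cast i => exact h i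
  | last =>
    have h1 := sum_residue hl μ
    rw [Fin.sum_univ_castSucc] at h1 hw
    simp only [h] at hw
    linarith

theorem injOn_residue {n : ℕ} {lam : Fin (n + 1) → ℝ} (hl : StrictAnti lam) :
    Set.InjOn (fun μ (i : Fin n) => residue lam μ i.castSucc) (box lam) := by
  intro μ hμ ν hν h
  have h1 : residue lam μ = residue lam ν :=
    residue_eq_of_castSucc hl (sum_residue hl μ) fun i => congrFun h i
  refine eq_of_mem_box hl hμ hν fun i => ?_
  rw [← residue_mul_prod hl μ, ← residue_mul_prod hl ν, h1]

/-- Every point of the simplex is a vector of residues: the partial fractions with positive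
coefficients have a zero between any two consecutive poles. -/
theorem exists_residue_eq {n : ℕ} {lam : Fin (n + 1) → ℝ} (hl : StrictAnti lam)
    {w : Fin (n + 1) → ℝ} (hw : ∀ i, 0 < w i) (hw1 : ∑ i, w i = 1) :
    ∃ μ ∈ box lam, residue lam μ = w := by
  let q : Fin (n + 1) → Polynomial ℝ := fun i =>
    ∏ j, (Polynomial.X - Polynomial.C (lam (i.succAbove j)))
  let p : Polynomial ℝ := ∑ i, w i • q i
  have hpe : ∀ i, p.eval (lam i) = w i * ∏ j, (lam i - lam (i.succAbove j)) := by
    intro i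
    simp only [p, q, Polynomial.eval_finsetSum, Polynomial.eval_smul, Polynomial.eval_prod,
      smul_eq_mul, Polynomial.eval_sub, Polynomial.eval_X, Polynomial.eval_C]
    rw [Finset.sum_eq_single i]
    · intro i' _ hi'
      obtain ⟨j, hj⟩ := Fin.exists_succAbove_eq hi'.symm
      rw [Finset.prod_eq_zero (Finset.mem_univ j), mul_zero]
      rw [hj, sub_self]
    · simp
  have hsign : ∀ i : Fin n, p.eval (lam i.succ) * p.eval (lam i.castSucc) < 0 := by
    intro i
    rw [hpe, hpe]
    have h1 : ∀ a : Fin (n + 1), ∏ j, (lam a - lam (a.succAbove j))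
        = ∏ b ∈ Finset.univ.erase a, (lam a - lam b) :=
      fun a => (prod_erase_eq_prod_succAbove (fun b => lam a - lam b) a).symm
    have hne : i.castSucc ≠ i.succ := (Fin.castSucc_lt_succ).ne
    rw [h1, h1, ← Finset.mul_prod_erase _ _ (Finset.mem_erase.2 ⟨hne, Finset.mem_univ _⟩),
      ← Finset.mul_prod_erase (Finset.univ.erase i.castSucc) _
        (Finset.mem_erase.2 ⟨hne.symm, Finset.mem_univ _⟩), Finset.erase_right_comm]
    have h2 : 0 < (∏ b ∈ (Finset.univ.erase i.castSucc).erase i.succ, (lam i.succ - lam b))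
        * ∏ b ∈ (Finset.univ.erase i.castSucc).erase i.succ, (lam i.castSucc - lam b) := by
      rw [← Finset.prod_mul_distrib]
      refine Finset.prod_pos fun b hb => ?_
      simp only [Finset.mem_erase, Finset.mem_univ, and_true] at hb
      rcases lt_or_ge b i.castSucc with hb' | hb'
      · exact mul_pos_of_neg_of_neg (sub_neg.2 (hl (hb'.trans Fin.castSucc_lt_succ)))
          (sub_neg.2 (hl hb'))
      · have h3 : i.succ < b :=
          lt_of_le_of_ne (Fin.castSucc_lt_iff_succ_le.1 (lt_of_le_of_ne hb' (Ne.symm hb.2)))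
            (Ne.symm hb.1)
        exact mul_pos (sub_pos.2 (hl h3)) (sub_pos.2 (hl (Fin.castSucc_lt_succ.trans h3)))
    have h4 : lam i.succ < lam i.castSucc := hl Fin.castSucc_lt_succ
    have h5 := mul_pos (mul_pos (hw i.succ) (hw i.castSucc)) h2
    have h6 : 0 < (lam i.castSucc - lam i.succ) ^ 2 := by
      have := sub_pos.2 h4
      positivity
    nlinarith [mul_pos h5 h6]
  have hroot : ∀ i : Fin n, ∃ t ∈ Set.Ioo (lam i.succ) (lam i.castSucc), p.eval t = 0 := by
    intro i
    have hc : ContinuousOn (fun t => p.eval t) (Set.Icc (lam i.succ) (lam i.castSucc)) :=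
      p.continuous.continuousOn
    have hlt : lam i.succ ≤ lam i.castSucc := (hl Fin.castSucc_lt_succ).le
    rcases mul_neg_iff.1 (hsign i) with h | h
    · exact intermediate_value_Ioo' hlt hc ⟨h.2, h.1⟩
    · exact intermediate_value_Ioo hlt hc ⟨h.1, h.2⟩
  choose μ hμ hμ0 using hroot
  have hbox : μ ∈ box lam := fun i _ => hμ i
  refine ⟨μ, hbox, ?_⟩
  have hdeg : ∀ r : Fin n → ℝ,
      (∏ j, (Polynomial.X - Polynomial.C (r j))).degree = (n : WithBot ℕ) :=
    fun r => by rw [Polynomial.degree_prod]; simp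
  have hp : p = ∏ j, (Polynomial.X - Polynomial.C (μ j)) := by
    refine Polynomial.eq_of_degree_sub_lt_of_eval_index_eq Finset.univ
      (strictAnti_of_mem_box hl hbox).injective.injOn ?_ ?_
    · have h1 : p - ∏ j, (Polynomial.X - Polynomial.C (μ j))
          = ∑ i, w i • (q i - ∏ j, (Polynomial.X - Polynomial.C (μ j))) := by
        simp only [smul_sub, Finset.sum_sub_distrib, ← Finset.sum_smul, hw1, one_smul, p]
      rw [h1, Finset.card_univ, Fintype.card_fin, ← Polynomial.mem_degreeLT]
      refine Submodule.sum_mem _ fun i _ => Submodule.smul_mem _ _ ?_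
      rw [Polynomial.mem_degreeLT, ← hdeg fun j => lam (i.succAbove j)]
      have hmon := Polynomial.monic_prod_X_sub_C (fun j => lam (i.succAbove j)) Finset.univ
      refine Polynomial.degree_sub_lt_left ?_ hmon.ne_zero ?_
      · rw [hdeg μ, hdeg]
      · rw [hmon.leadingCoeff, (Polynomial.monic_prod_X_sub_C μ Finset.univ).leadingCoeff]
    · intro i _
      rw [hμ0, Polynomial.eval_prod, Finset.prod_eq_zero (Finset.mem_univ i)]
      simp
  funext i
  have h1 := hpe i
  rw [hp, Polynomial.eval_prod] at h1
  simp only [Polynomial.eval_sub, Polynomial.eval_X, Polynomial.eval_C] at h1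
  rw [← residue_mul_prod hl] at h1
  exact mul_right_cancel₀ (Finset.prod_ne_zero_iff.2 fun j _ => sub_succAbove_ne_zero hl i j) h1

theorem image_residue {n : ℕ} {lam : Fin (n + 1) → ℝ} (hl : StrictAnti lam) :
    (fun μ (i : Fin n) => residue lam μ i.castSucc) '' box lam = simplex n := by
  refine Set.Subset.antisymm ?_ fun u hu => ?_
  · rintro _ ⟨μ, hμ, rfl⟩
    exact residue_mem_simplex hl hμ
  · obtain ⟨μ, hμ, h⟩ := exists_residue_eq hl (w := Fin.snoc (α := fun _ => ℝ) u (1 - ∑ i, u i))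
      (fun i => by
        induction i using Fin.lastCases with
        | cast i => rw [Fin.snoc_castSucc]; exact hu.1 i
        | last => rw [Fin.snoc_last]; linarith [hu.2])
      (by rw [Fin.sum_univ_castSucc]; simp)
    refine ⟨μ, hμ, ?_⟩
    funext i
    have h1 := congrFun h i.castSucc
    rwa [Fin.snoc_castSucc] at h1

/-- The Jacobian matrix of the residues. -/
def residueJac {n : ℕ} (lam : Fin (n + 1) → ℝ) (μ : Fin n → ℝ) : Matrix (Fin n) (Fin n) ℝ :=
  Matrix.of fun i j => -(∏ p ∈ Finset.univ.erase j, (lam i.castSucc - μ p))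
    / ∏ p, (lam i.castSucc - lam (i.castSucc.succAbove p))

theorem hasFDerivAt_residue {n : ℕ} (lam : Fin (n + 1) → ℝ) (μ : Fin n → ℝ) :
    HasFDerivAt (fun μ (i : Fin n) => residue lam μ i.castSucc)
      (LinearMap.toContinuousLinearMap (Matrix.toLin' (residueJac lam μ))) μ := by
  rw [hasFDerivAt_pi']
  intro i
  have h1 : ∀ p ∈ (Finset.univ : Finset (Fin n)), HasFDerivAt
      (fun μ : Fin n → ℝ => lam i.castSucc - μ p) (-ContinuousLinearMap.proj (R := ℝ) p) μ :=
    fun p _ => (hasFDerivAt_apply p μ).const_sub _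
  have h2 := (HasFDerivAt.finsetProd h1).mul_const
    (∏ p, (lam i.castSucc - lam (i.castSucc.succAbove p)))⁻¹
  have h3 : (fun μ => residue lam μ i.castSucc) = fun μ : Fin n → ℝ =>
      (∏ p, (lam i.castSucc - μ p)) * (∏ p, (lam i.castSucc - lam (i.castSucc.succAbove p)))⁻¹ := by
    funext μ
    rw [residue, Finset.prod_div_distrib, div_eq_mul_inv]
  rw [h3]
  refine h2.congr_fderiv ?_
  ext v
  simp [residueJac, Matrix.mulVec, dotProduct, Finset.mul_sum, div_eq_mul_inv]
  refine Finset.sum_congr rfl fun j _ => ?_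
  ring

/-- The determinant of the values at `x_i` of the Lagrange polynomials `∏_{p ≠ j} (t - μ_p)`: their
matrix is the Vandermonde matrix of `x` times the inverse of the Vandermonde matrix of `μ`, up to
scaling of the columns. -/
theorem det_prod_erase {n : ℕ} (x μ : Fin n → ℝ) :
    (Matrix.of fun i j : Fin n => ∏ p ∈ Finset.univ.erase j, (x i - μ p)).det * vdm μ
      = vdm x * ∏ j, ∏ p ∈ Finset.univ.erase j, (μ j - μ p) := by
  let q : Fin n → Polynomial ℝ := fun j =>
    ∏ p ∈ Finset.univ.erase j, (Polynomial.X - Polynomial.C (μ p))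
  let Cf : Matrix (Fin n) (Fin n) ℝ := Matrix.of fun k j => (q j).coeff (Fin.rev k : Fin n)
  have hq : ∀ j, (q j).natDegree < n := fun j => by
    have hn : 0 < n := j.pos
    simp [q, Polynomial.natDegree_finsetProd_X_sub_C_eq_card]
    omega
  have key : ∀ y : Fin n → ℝ, (Matrix.of fun i j : Fin n =>
      ∏ p ∈ Finset.univ.erase j, (y i - μ p)).det = vdm y * Cf.det := by
    intro y
    rw [← det_eq_vdm, ← Matrix.det_mul]
    congr 1
    ext i j
    have h1 : ∏ p ∈ Finset.univ.erase j, (y i - μ p) = (q j).eval (y i) := by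
      simp [q, Polynomial.eval_prod]
    rw [Matrix.of_apply, h1, Polynomial.eval_eq_sum_range' (hq j), Matrix.mul_apply,
      ← Fin.sum_univ_eq_sum_range (fun k => (q j).coeff k * y i ^ k) n,
      ← Equiv.sum_comp Fin.revPerm]
    refine Finset.sum_congr rfl fun k _ => ?_
    simp [Cf, mul_comm]
  have hdiag : (Matrix.of fun i j : Fin n => ∏ p ∈ Finset.univ.erase j, (μ i - μ p)).det
      = ∏ j, ∏ p ∈ Finset.univ.erase j, (μ j - μ p) := by
    rw [← Matrix.det_diagonal]
    congr 1
    ext i j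
    rw [Matrix.of_apply, Matrix.diagonal_apply]
    split_ifs with h
    · rw [h]
    · exact Finset.prod_eq_zero (Finset.mem_erase.2 ⟨h, Finset.mem_univ i⟩) (sub_self _)
  rw [key x, ← hdiag, key μ]
  ring

/-- The Jacobian determinant of the residues, from a Cauchy determinant. -/
theorem abs_det_residueJac {n : ℕ} {lam : Fin (n + 1) → ℝ} (hl : StrictAnti lam) {μ : Fin n → ℝ}
    (hμ : StrictAnti μ) : |(residueJac lam μ).det| = vdm μ / vdm lam := by
  let x : Fin n → ℝ := fun i => lam i.castSucc
  have hx : StrictAnti x := fun i j h => hl (Fin.castSucc_lt_castSucc_iff.2 h)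
  have h1 : residueJac lam μ = Matrix.diagonal
      (fun i : Fin n => -(∏ p, (lam i.castSucc - lam (i.castSucc.succAbove p)))⁻¹)
      * Matrix.of fun i j : Fin n => ∏ p ∈ Finset.univ.erase j, (x i - μ p) := by
    ext i j
    rw [Matrix.diagonal_mul]
    simp [residueJac, x, div_eq_mul_inv, mul_comm]
  have h2 : |(Matrix.of fun i j : Fin n => ∏ p ∈ Finset.univ.erase j, (x i - μ p)).det|
      = vdm x * vdm μ := by
    have h := congrArg abs (det_prod_erase x μ)
    rw [abs_mul, abs_mul, Finset.abs_prod] at h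
    simp only [Finset.abs_prod, abs_vdm_sq] at h
    rw [abs_of_pos (vdm_pos hμ), abs_of_pos (vdm_pos hx)] at h
    have := (vdm_pos hμ).ne'
    field_simp at h
    linarith
  have h3 : ∏ i : Fin n, |-(∏ p, (lam i.castSucc - lam (i.castSucc.succAbove p)))⁻¹|
      = (vdm x * vdm lam)⁻¹ := by
    have h4 : ∀ i : Fin n, |∏ p, (lam i.castSucc - lam (i.castSucc.succAbove p))|
        = (∏ p ∈ Finset.univ.erase i, |x i - x p|) * (x i - lam (Fin.last n)) := by
      intro i
      rw [Finset.abs_prod,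
        ← prod_erase_eq_prod_succAbove (fun q => |lam i.castSucc - lam q|)]
      have h5 : (Finset.univ.erase i.castSucc : Finset (Fin (n + 1)))
          = insert (Fin.last n) ((Finset.univ.erase i).map Fin.castSuccEmb) := by
        ext q
        induction q using Fin.lastCases with
        | cast q => simp [(Fin.castSucc_lt_last q).ne]
        | last => simp [(Fin.castSucc_lt_last i).ne']
      rw [h5, Finset.prod_insert (by simp), Finset.prod_map, mul_comm]
      congr 1
      exact abs_of_pos (sub_pos.2 (hl (Fin.castSucc_lt_last i)))
    simp only [abs_neg, abs_inv, h4, Finset.prod_inv_distrib, Finset.prod_mul_distrib, abs_vdm_sq]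
    rw [vdm_castSucc lam, abs_of_pos (vdm_pos hx)]
    congr 1
    change vdm x ^ 2 * ∏ i, (x i - lam (Fin.last n))
      = vdm x * (vdm x * ∏ i, (x i - lam (Fin.last n)))
    ring
  rw [h1, Matrix.det_mul, Matrix.det_diagonal, abs_mul, h2, Finset.abs_prod, h3]
  have := (vdm_pos hx).ne'
  field_simp

theorem measurableSet_box {n : ℕ} (lam : Fin (n + 1) → ℝ) : MeasurableSet (box lam) :=
  MeasurableSet.univ_pi fun _ => measurableSet_Ioo

/-- The average of a function of the row weights of `k`, in interlacing coordinates. -/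
theorem exists_integral_eq_integral_box (n : ℕ) : ∃ c : ℝ, ∀ lam : Fin (n + 1) → ℝ, StrictAnti lam →
    ∀ (F : K (n + 1) → ℂ) (G : (Fin n → ℝ) → ℂ), Measurable G →
    (∀ k, ∀ μ ∈ box lam, (∀ i : Fin n, rowWeights k i = residue lam μ i.castSucc) → F k = G μ) →
    ∫ k, F k ∂haarK (n + 1) = c / (vdm lam : ℝ) * ∫ μ in box lam, ((vdm μ : ℝ) : ℂ) * G μ := by
  obtain ⟨c, hc, hlaw⟩ := exists_map_rowWeights n
  refine ⟨c.toReal, fun lam hl F G hG hFG => ?_⟩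
  let R : (Fin n → ℝ) → Fin n → ℝ := fun μ i => residue lam μ i.castSucc
  have hderiv : ∀ μ ∈ box lam, HasFDerivWithinAt R
      (LinearMap.toContinuousLinearMap (Matrix.toLin' (residueJac lam μ))) (box lam) μ :=
    fun μ _ => (hasFDerivAt_residue lam μ).hasFDerivWithinAt
  have hemb := measurableEmbedding_of_fderivWithin (measurableSet_box lam) hderiv (injOn_residue hl)
  let g : (Fin n → ℝ) → ℂ := Function.extend ((box lam).domRestrict R) (fun μ => G μ.1) 0
  have hg : Measurable g := hemb.measurable_extend (hG.comp measurable_subtype_coe) measurable_zero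
  have hgR : ∀ μ ∈ box lam, g (R μ) = G μ := fun μ hμ =>
    hemb.injective.extend_apply (fun μ : box lam => G μ.1) 0 ⟨μ, hμ⟩
  have hmeas := (continuous_rowWeights n).measurable
  have h1 : ∀ᵐ k ∂haarK (n + 1), rowWeights k ∈ simplex n := by
    have h2 : ∀ᵐ u ∂(Measure.map rowWeights (haarK (n + 1))), u ∈ simplex n := by
      rw [hlaw]
      exact Measure.ae_smul_measure (ae_restrict_mem (measurableSet_simplex n)) c
    exact ae_of_ae_map hmeas.aemeasurable h2
  have h3 : ∫ k, F k ∂haarK (n + 1) = ∫ k, g (rowWeights k) ∂haarK (n + 1) := by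
    refine integral_congr_ae ?_
    filter_upwards [h1] with k hk
    rw [← image_residue hl] at hk
    obtain ⟨μ, hμ, hk⟩ := hk
    rw [hFG k μ hμ fun i => (congrFun hk i).symm, ← hgR μ hμ]
    exact congrArg g hk
  rw [h3, ← integral_map hmeas.aemeasurable hg.aestronglyMeasurable, hlaw, integral_smul_measure,
    ← image_residue hl, integral_image_eq_integral_abs_det_fderiv_smul volume
      (measurableSet_box lam) hderiv (injOn_residue hl)]
  have h4 : ∀ μ ∈ box lam, |(LinearMap.toContinuousLinearMap
      (Matrix.toLin' (residueJac lam μ))).det| • g (R μ)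
      = ((vdm lam : ℝ) : ℂ)⁻¹ * (((vdm μ : ℝ) : ℂ) * G μ) := by
    intro μ hμ
    rw [hgR μ hμ]
    have : (LinearMap.toContinuousLinearMap (Matrix.toLin' (residueJac lam μ))).det
        = (residueJac lam μ).det := by
      rw [LinearMap.det_toContinuousLinearMap, LinearMap.det_toLin']
    rw [this, abs_det_residueJac hl (strictAnti_of_mem_box hl hμ), Complex.real_smul]
    push_cast
    ring
  rw [setIntegral_congr_fun (measurableSet_box lam) h4, integral_const_mul, Complex.real_smul]
  ring

/-! ### The corner of a rotated Hermitian matrix -/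

theorem adjugate_unitary_conj {n : ℕ} (k : K n) (D : Matrix (Fin n) (Fin n) ℂ) :
    (k.1 * D * k.1ᴴ).adjugate = k.1 * D.adjugate * k.1ᴴ := by
  have h1 := coe_mul_conjTranspose k
  have h2 := conjTranspose_mul_coe k
  have e1 : (k.1ᴴ).adjugate = (k.1ᴴ).det • k.1 := by
    calc (k.1ᴴ).adjugate = (k.1ᴴ).adjugate * (k.1ᴴ * k.1) := by rw [h2, Matrix.mul_one]
      _ = _ := by rw [← Matrix.mul_assoc, Matrix.adjugate_mul, Matrix.smul_mul, Matrix.one_mul]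
  have e2 : k.1.adjugate = k.1.det • k.1ᴴ := by
    calc k.1.adjugate = (k.1ᴴ * k.1) * k.1.adjugate := by rw [h2, Matrix.one_mul]
      _ = _ := by rw [Matrix.mul_assoc, Matrix.mul_adjugate, Matrix.mul_smul, Matrix.mul_one]
  have e3 : (k.1ᴴ).det * k.1.det = 1 := by rw [← Matrix.det_mul, h2, Matrix.det_one]
  rw [Matrix.adjugate_mul_distrib, Matrix.adjugate_mul_distrib, e1, e2, Matrix.smul_mul,
    Matrix.mul_smul, Matrix.mul_smul, smul_smul, e3, one_smul, Matrix.mul_assoc]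

theorem proj_mul_mul_proj {n : ℕ} (M : Matrix (Fin (n + 1)) (Fin (n + 1)) ℂ) :
    proj n (n + 1) * M * proj (n + 1) n = M.submatrix Fin.castSucc Fin.castSucc := by
  ext a b
  simp only [Matrix.mul_apply, proj, Matrix.of_apply, Matrix.submatrix_apply, ite_mul, one_mul,
    zero_mul, mul_ite, mul_one, mul_zero]
  rw [Finset.sum_eq_single b.castSucc, if_pos (by simp), Finset.sum_eq_single a.castSucc,
    if_pos (by simp)]
  · intro c _ hc
    exact if_neg fun h => hc (Fin.ext (by simpa using h.symm))
  · simp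
  · intro c _ hc
    exact if_neg fun h => hc (Fin.ext (by simpa using h))
  · simp

/-- The diagonal matrix with real entries `lam`. -/
def realDiag {n : ℕ} (lam : Fin n → ℝ) : Matrix (Fin n) (Fin n) ℂ :=
  Matrix.diagonal fun i => (lam i : ℂ)

theorem isHermitian_realDiag {n : ℕ} (lam : Fin n → ℝ) : (realDiag lam).IsHermitian := by
  rw [realDiag, Matrix.isHermitian_diagonal_iff]
  intro i
  simp [IsSelfAdjoint]

/-- Hermitian matrices with the same characteristic polynomial are unitarily equivalent. -/
theorem exists_eq_conj_of_charpoly_eq {n : ℕ} {A B : Matrix (Fin n) (Fin n) ℂ}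
    (hA : A.IsHermitian) (hB : B.IsHermitian) (h : A.charpoly = B.charpoly) :
    ∃ v : K n, A = v.1 * B * v.1ᴴ := by
  have he := (Matrix.IsHermitian.eigenvalues_eq_eigenvalues_iff hA hB).2 h
  have h1 := hA.spectral_theorem
  have h2 := hB.spectral_theorem
  rw [he] at h1
  set D : Matrix (Fin n) (Fin n) ℂ := diagonal (RCLike.ofReal ∘ hB.eigenvalues)
  let U : K n := hA.eigenvectorUnitary
  let W : K n := hB.eigenvectorUnitary
  have h1' : A = U.1 * D * U.1ᴴ := by rw [h1]; rfl
  have h2' : B = W.1 * D * W.1ᴴ := by rw [h2]; rfl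
  refine ⟨U * W⁻¹, ?_⟩
  have hW := conjTranspose_mul_coe W
  have e : (U * W⁻¹).1 = U.1 * W.1ᴴ := rfl
  rw [e, h2', Matrix.conjTranspose_mul, Matrix.conjTranspose_conjTranspose]
  calc A = U.1 * D * U.1ᴴ := h1'
    _ = U.1 * (W.1ᴴ * W.1) * D * (W.1ᴴ * W.1) * U.1ᴴ := by rw [hW, Matrix.mul_one, Matrix.mul_one]
    _ = _ := by simp only [Matrix.mul_assoc]

/-- The characteristic polynomial of the corner of `k diag(lam) k^*` at `lam_i`. It is an entry of
the adjugate of `lam_i - k diag(lam) k^*`, which is conjugate to a multiple of the matrix unit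
`E_{ii}`. -/
theorem det_sub_corner {n : ℕ} (k : K (n + 1)) (lam : Fin (n + 1) → ℝ) (i : Fin (n + 1)) :
    ((Matrix.scalar (Fin n) (lam i : ℂ)) -
        proj n (n + 1) * (k.1 * realDiag lam * k.1ᴴ) * proj (n + 1) n).det
      = ((Complex.normSq (k.1 (Fin.last n) i) * ∏ j, (lam i - lam (i.succAbove j)) : ℝ) : ℂ) := by
  have h1 : (Matrix.scalar (Fin n) (lam i : ℂ)) -
        proj n (n + 1) * (k.1 * realDiag lam * k.1ᴴ) * proj (n + 1) n
      = (k.1 * (Matrix.diagonal fun q => ((lam i - lam q : ℝ) : ℂ)) * k.1ᴴ).submatrix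
        Fin.castSucc Fin.castSucc := by
    have h2 : (Matrix.diagonal fun q => ((lam i - lam q : ℝ) : ℂ))
        = (lam i : ℂ) • (1 : Matrix (Fin (n + 1)) (Fin (n + 1)) ℂ) - realDiag lam := by
      ext a b
      simp only [realDiag, Matrix.diagonal_apply, Matrix.sub_apply, Matrix.smul_apply,
        Matrix.one_apply]
      split_ifs <;> simp
    rw [proj_mul_mul_proj, h2, Matrix.mul_sub, Matrix.sub_mul, Matrix.mul_smul, Matrix.smul_mul,
      Matrix.mul_one, coe_mul_conjTranspose]
    ext a b
    simp [Matrix.scalar_apply, Matrix.diagonal_apply, Matrix.one_apply]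
  have h3 := Matrix.adjugate_fin_succ_eq_det_submatrix
    (k.1 * (Matrix.diagonal fun q => ((lam i - lam q : ℝ) : ℂ)) * k.1ᴴ) (Fin.last n) (Fin.last n)
  have h4 : (Fin.last n).succAbove = Fin.castSucc := Fin.succAbove_last
  rw [h4, ← two_mul, pow_mul, neg_one_sq, one_pow, one_mul] at h3
  rw [h1, ← h3, adjugate_unitary_conj, Matrix.adjugate_diagonal, Matrix.mul_apply,
    Finset.sum_eq_single i]
  · rw [Matrix.mul_diagonal, Matrix.conjTranspose_apply, mul_right_comm,
      show k.1 (Fin.last n) i * star (k.1 (Fin.last n) i) = _ from Complex.mul_conj _,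
      ← prod_erase_eq_prod_succAbove fun q => lam i - lam q]
    push_cast
    rfl
  · intro q _ hq
    rw [Matrix.mul_diagonal, Finset.prod_eq_zero (Finset.mem_erase.2 ⟨hq.symm, Finset.mem_univ i⟩)]
    · simp
    · simp
  · simp

theorem sum_normSq_row {n : ℕ} (k : K n) (i : Fin n) : ∑ j, Complex.normSq (k.1 i j) = 1 := by
  have h := congrFun (congrFun (coe_mul_conjTranspose k) i) i
  simp only [Matrix.mul_apply, Matrix.conjTranspose_apply, Matrix.one_apply_eq] at h
  have h2 : ∀ j, k.1 i j * star (k.1 i j) = (Complex.normSq (k.1 i j) : ℂ) :=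
    fun j => Complex.mul_conj _
  simp only [h2] at h
  exact_mod_cast h

/-- The row weights of `k` determine the spectrum of the corner of `k diag(lam) k^*`. -/
theorem exists_corner_eq {n : ℕ} {lam : Fin (n + 1) → ℝ} (hl : StrictAnti lam) (k : K (n + 1))
    {μ : Fin n → ℝ} (hμ : ∀ i : Fin n, rowWeights k i = residue lam μ i.castSucc) :
    ∃ v : K n, proj n (n + 1) * (k.1 * realDiag lam * k.1ᴴ) * proj (n + 1) n
      = v.1 * realDiag μ * v.1ᴴ := by
  have hw := residue_eq_of_castSucc hl (w := fun i => Complex.normSq (k.1 (Fin.last n) i))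
    (sum_normSq_row k _) hμ
  refine exists_eq_conj_of_charpoly_eq ?_ (isHermitian_realDiag μ) ?_
  · have h1 : (k.1 * realDiag lam * k.1ᴴ).IsHermitian :=
      isHermitian_mul_mul_conjTranspose _ (isHermitian_realDiag lam)
    have := isHermitian_mul_mul_conjTranspose (proj n (n + 1)) h1
    rwa [conjTranspose_proj] at this
  · have hinj : Set.InjOn (fun i => (lam i : ℂ)) (Finset.univ : Finset (Fin (n + 1))) :=
      fun a _ b _ h => hl.injective (Complex.ofReal_injective h)
    refine Polynomial.eq_of_degree_sub_lt_of_eval_index_eq Finset.univ hinj ?_ ?_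
    · refine (Polynomial.degree_sub_le _ _).trans_lt (max_lt ?_ ?_) <;>
      · rw [Matrix.charpoly_degree_eq_dim]
        simp only [Finset.card_univ, Fintype.card_fin]
        exact_mod_cast Nat.lt_succ_self n
    · intro i _
      rw [Matrix.eval_charpoly, Matrix.eval_charpoly, det_sub_corner, congrFun hw i,
        residue_mul_prod hl]
      have : Matrix.scalar (Fin n) (lam i : ℂ) - realDiag μ
          = Matrix.diagonal fun j => ((lam i - μ j : ℝ) : ℂ) := by
        ext a b
        simp only [realDiag, Matrix.scalar_apply, Matrix.sub_apply, Matrix.diagonal_apply]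
        split_ifs <;> simp
      rw [this, Matrix.det_diagonal]
      push_cast
      rfl

/-- The numerator with `n` parameters is an average over corners of size `n`. -/
theorem numerator_eq_integral_corner {l n : ℕ} (h : n ≤ l) {s : Fin n → ℂ} (hs : s ∈ domain n)
    (L : Fin n → ZMod 2) (x : Matrix (Fin l) (Fin l) ℂ) :
    numerator s L x
      = ∫ k : K l, numerator s L (proj n l * (k.1 * x * k.1ᴴ) * proj l n) ∂haarK l := by
  have h1 : ∀ v : K n, numerator s L x = ∫ k : K l, ∏ j : Fin n, chi (gap L j) (gap s j)
      (minor (j + 1) (v.1 * (proj n l * (k.1 * x * k.1ᴴ) * proj l n) * v.1ᴴ)) ∂haarK l := by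
    intro v
    obtain ⟨V, hV⟩ := exists_unitary_extension h v⁻¹
    have hV1 : V.1ᴴ.conjTranspose * proj l n = proj l n * v.1ᴴ := by
      rw [Matrix.conjTranspose_conjTranspose]; exact hV
    have hV2 : proj n l * V.1ᴴ = v.1 * proj n l := by
      have := congrArg Matrix.conjTranspose hV1
      rw [Matrix.conjTranspose_mul, Matrix.conjTranspose_mul, conjTranspose_proj,
        Matrix.conjTranspose_conjTranspose, Matrix.conjTranspose_conjTranspose] at this
      exact this
    have h2 := integral_mul_left_eq_self (μ := haarK l) (fun k : K l =>
      ∏ j : Fin n, chi (gap L j) (gap s j) (minor (j + 1) (k.1 * x * k.1ᴴ))) V⁻¹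
    rw [numerator_eq, ← h2]
    refine integral_congr_ae (Filter.Eventually.of_forall fun k => ?_)
    refine Finset.prod_congr rfl fun j _ => ?_
    congr 1
    rw [← minor_corner (r := n) (l := l) j.2]
    congr 1
    have e : (V⁻¹ * k).1 = V.1ᴴ * k.1 := rfl
    rw [e, Matrix.conjTranspose_mul]
    calc _ = (proj n l * V.1ᴴ) * (k.1 * x * k.1ᴴ) * (V.1ᴴ.conjTranspose * proj l n) := by
          simp only [Matrix.mul_assoc]
      _ = _ := by rw [hV1, hV2]; simp only [Matrix.mul_assoc]
  have h3 : numerator s L x = ∫ v : K n, ∫ k : K l, ∏ j : Fin n, chi (gap L j) (gap s j)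
      (minor (j + 1) (v.1 * (proj n l * (k.1 * x * k.1ᴴ) * proj l n) * v.1ᴴ))
        ∂haarK l ∂haarK n := by
    simp [← h1]
  rw [h3, integral_integral_swap]
  · rfl
  · have e : ∀ (p : K n × K l) (j : Fin n),
        minor (j + 1) (p.1.1 * (proj n l * (p.2.1 * x * p.2.1ᴴ) * proj l n) * p.1.1ᴴ)
        = minor (j + 1) ((p.1.1 * proj n l * p.2.1) * x * (p.1.1 * proj n l * p.2.1)ᴴ) := by
      intro p j
      simp only [Matrix.conjTranspose_mul, conjTranspose_proj, Matrix.mul_assoc]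
    simp only [Function.uncurry_def, e]
    refine integrable_prod_chi _ _ hs fun j => continuous_minor_conj _ ?_ x
    exact (((continuous_coeK n).comp continuous_fst).matrix_mul continuous_const).matrix_mul
      ((continuous_coeK l).comp continuous_snd)

theorem minor_self_conj {n : ℕ} (k : K n) (x : Matrix (Fin n) (Fin n) ℂ) :
    minor n (k.1 * x * k.1ᴴ) = x.det.re := by
  have h : k.1.det * (k.1ᴴ).det = 1 := by
    rw [← Matrix.det_mul, coe_mul_conjTranspose, Matrix.det_one]
  rw [minor, proj_self, Matrix.one_mul, Matrix.mul_one, Matrix.det_mul, Matrix.det_mul,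
    mul_right_comm, h, one_mul]

/-- The parameters of the first `n` factors of the numerator with `n + 1` parameters. -/
def reduce {R : Type*} [Ring R] {n : ℕ} (s : Fin (n + 1) → R) (j : Fin n) : R :=
  s j.castSucc - s (Fin.last n) - 1

theorem gap_castSucc {R : Type*} [Ring R] {n : ℕ} (s : Fin (n + 1) → R) (j : Fin n) :
    gap s j.castSucc = gap (reduce s) j := by
  have hj := j.2
  unfold gap reduce
  simp only [Fin.val_castSucc]
  rw [dif_pos (by omega : (j : ℕ) + 1 < n + 1)]
  by_cases h : (j : ℕ) + 1 < n
  · rw [dif_pos h]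
    have : (⟨(j : ℕ) + 1, by omega⟩ : Fin (n + 1)) = Fin.castSucc ⟨(j : ℕ) + 1, h⟩ := rfl
    rw [this]
    abel
  · rw [dif_neg h]
    have : (⟨(j : ℕ) + 1, by omega⟩ : Fin (n + 1)) = Fin.last n := Fin.ext (by simp; omega)
    rw [this]
    abel

theorem gap_last {R : Type*} [Ring R] {n : ℕ} (s : Fin (n + 1) → R) :
    gap s (Fin.last n) = s (Fin.last n) := by
  unfold gap
  rw [dif_neg (by simp)]
  abel

/-- The last factor of a numerator with as many parameters as rows is a power of the determinant. -/
theorem numerator_succ {n : ℕ} (s : Fin (n + 1) → ℂ) (L : Fin (n + 1) → ZMod 2)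
    (x : Matrix (Fin (n + 1)) (Fin (n + 1)) ℂ) :
    numerator s L x
      = chi (L (Fin.last n)) (s (Fin.last n)) x.det.re * numerator (reduce s) (reduce L) x := by
  rw [numerator_eq, numerator_eq, ← integral_const_mul]
  refine integral_congr_ae (Filter.Eventually.of_forall fun k => ?_)
  simp only [Fin.prod_univ_castSucc, gap_castSucc, gap_last, Fin.val_castSucc, Fin.val_last,
    minor_self_conj]
  rw [mul_comm]

/-! ### The determinant formula for distinct eigenvalues -/

/-- The parameters for which all exponents have positive real part. -/
def openDomain (n : ℕ) : Set (Fin n → ℂ) := {s | ∀ j, 0 < (gap s j).re}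

theorem openDomain_subset (n : ℕ) : openDomain n ⊆ domain n := fun _ hs j => (hs j).le

/-- The sequence `s_1, …, s_n` continued by `-1`. -/
def padded {n : ℕ} (s : Fin n → ℂ) (k : ℕ) : ℂ := if h : k < n then s ⟨k, h⟩ else -1

theorem padded_sub_ge {n : ℕ} {s : Fin n → ℂ} (hs : s ∈ domain n) {i j : ℕ} (hij : i ≤ j)
    (hj : j ≤ n) : ((j : ℝ) - i) ≤ (padded s i).re - (padded s j).re := by
  induction j, hij using Nat.le_induction with
  | base => simp
  | succ j hij ih =>
    have h1 := hs ⟨j, hj⟩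
    have h2 : gap s ⟨j, hj⟩ = padded s j - padded s (j + 1) - 1 := by
      unfold gap padded
      rw [dif_pos (show j < n from hj)]
    rw [h2] at h1
    simp only [Complex.sub_re, Complex.one_re] at h1
    have := ih (by omega)
    push_cast
    linarith

theorem re_nonneg_of_mem_domain {n : ℕ} {s : Fin n → ℂ} (hs : s ∈ domain n) (j : Fin n) :
    0 ≤ (s j).re := by
  have h := padded_sub_ge hs j.2.le le_rfl
  have h2 : (j : ℝ) + 1 ≤ n := by exact_mod_cast j.2
  simp only [padded, j.2, dif_pos, lt_irrefl, dif_neg, not_false_eq_true, Fin.eta, Complex.neg_re,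
    Complex.one_re] at h
  linarith

theorem re_sub_ge_one {n : ℕ} {s : Fin n → ℂ} (hs : s ∈ domain n) {i j : Fin n} (hij : i < j) :
    1 ≤ (s i - s j).re := by
  have h := padded_sub_ge hs (Fin.le_def.1 hij.le) j.2.le
  have h2 : (i : ℝ) + 1 ≤ j := by exact_mod_cast (Fin.lt_def.1 hij)
  simp only [padded, j.2, i.2, dif_pos, Fin.eta] at h
  rw [Complex.sub_re]
  linarith

theorem re_pos_of_mem_openDomain {n : ℕ} {s : Fin n → ℂ} (hs : s ∈ openDomain n) (j : Fin n) :
    0 < (s j).re := by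
  cases n with
  | zero => exact j.elim0
  | succ n =>
    have h1 := hs (Fin.last n)
    rw [gap_last] at h1
    rcases (Fin.le_last j).lt_or_eq with h | h
    · have := re_sub_ge_one (openDomain_subset _ hs) h
      rw [Complex.sub_re] at this
      linarith
    · rwa [h]

theorem vdm_ne_zero_of_mem_domain {n : ℕ} {s : Fin n → ℂ} (hs : s ∈ domain n) : vdm s ≠ 0 := by
  refine Finset.prod_ne_zero_iff.2 fun i _ => Finset.prod_ne_zero_iff.2 fun j _ => ?_
  split_ifs with h
  · intro h0
    have := re_sub_ge_one hs h
    rw [h0] at this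
    norm_num at this
  · exact one_ne_zero

theorem reduce_mem_openDomain {n : ℕ} {s : Fin (n + 1) → ℂ} (hs : s ∈ openDomain (n + 1)) :
    reduce s ∈ openDomain n := fun j => by
  rw [← gap_castSucc]
  exact hs _

theorem signPow_add (ε ε' : ZMod 2) {t : ℝ} (ht : t ≠ 0) :
    signPow (ε + ε') t = signPow ε t * signPow ε' t := by
  rcases lt_or_gt_of_ne ht with h | h
  · have h2 : ∀ ε : ZMod 2, ε = 0 ∨ ε = 1 := by decide
    have h3 : (1 + 1 : ZMod 2) = 0 := rfl
    rcases h2 ε with rfl | rfl <;> rcases h2 ε' with rfl | rfl <;>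
      simp [signPow, Real.sign_of_neg h, h3]
  · simp [signPow_of_pos _ h]

theorem chi_zero {ε : ZMod 2} {w : ℂ} (hw : w ≠ 0) : chi ε w 0 = 0 := by simp [chi, hw]

theorem chi_add_of_ne_zero (ε ε' : ZMod 2) (w w' : ℂ) {t : ℝ} (ht : t ≠ 0) :
    chi (ε + ε') (w + w') t = chi ε w t * chi ε' w' t := by
  unfold chi
  rw [signPow_add _ _ ht, Complex.cpow_add _ _ (by simpa using ht)]
  push_cast
  ring

theorem chi_add (ε ε' : ZMod 2) {w w' : ℂ} (hw : 0 < w.re) (hw' : 0 < w'.re) (t : ℝ) :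
    chi (ε + ε') (w + w') t = chi ε w t * chi ε' w' t := by
  have h0 : ∀ {w : ℂ}, 0 < w.re → w ≠ 0 := fun h h0 => by simp [h0] at h
  rcases eq_or_ne t 0 with rfl | ht
  · rw [chi_zero (h0 hw), chi_zero (h0 (by rw [Complex.add_re]; positivity)), zero_mul]
  · exact chi_add_of_ne_zero _ _ _ _ ht

theorem chi_prod {ι : Type*} (s : Finset ι) (ε : ZMod 2) (w : ℂ) (t : ι → ℝ) :
    chi ε w (∏ i ∈ s, t i) = ∏ i ∈ s, chi ε w (t i) := by
  classical
  induction s using Finset.induction_on with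
  | empty => simp [chi_one]
  | insert a s ha ih => rw [Finset.prod_insert ha, Finset.prod_insert ha, chi_mul, ih]

theorem hasDerivAt_chi (ε : ZMod 2) (w : ℂ) {t : ℝ} (ht : t ≠ 0) :
    HasDerivAt (chi (ε + 1) (w + 1)) ((w + 1) * chi ε w t) t := by
  rcases lt_or_gt_of_ne ht with h | h
  · have h2 := (((hasDerivAt_id (t : ℂ)).fun_neg).cpow_const (c := w + 1)
      (Or.inl (by simpa using h))).comp_ofReal
    have h3 := h2.const_mul ((signPow (ε + 1) t : ℝ) : ℂ)
    refine (h3.congr_of_eventuallyEq ?_).congr_deriv ?_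
    · filter_upwards [gt_mem_nhds h] with y hy
      have : signPow (ε + 1) y = signPow (ε + 1) t := by
        unfold signPow
        rw [Real.sign_of_neg hy, Real.sign_of_neg h]
      rw [chi, this, abs_of_neg hy]
      simp
    · rw [signPow_add _ _ ht, chi, abs_of_neg h]
      have : signPow 1 t = -1 := by simp [signPow, Real.sign_of_neg h]
      rw [this, add_sub_cancel_right]
      simp only [id]
      push_cast
      ring
  · have h2 := ((hasDerivAt_id (t : ℂ)).cpow_const (c := w + 1)
      (Or.inl (by simpa using h))).comp_ofReal
    refine (h2.congr_of_eventuallyEq ?_).congr_deriv ?_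
    · filter_upwards [lt_mem_nhds h] with y hy
      rw [chi_of_pos _ _ hy]
      rfl
    · rw [chi_of_pos _ _ h, add_sub_cancel_right]
      simp only [id]
      ring

theorem integral_chi (ε : ZMod 2) {w : ℂ} (hw : 0 < w.re) (a b : ℝ) :
    (∫ t in a..b, chi ε w t) * (w + 1) = chi (ε + 1) (w + 1) b - chi (ε + 1) (w + 1) a := by
  rw [mul_comm, ← intervalIntegral.integral_const_mul]
  refine integral_eq_of_hasDerivAt_off_countable (chi (ε + 1) (w + 1)) _
    (Set.countable_singleton 0) ?_ ?_ ?_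
  · exact (continuous_chi _ (by simp; linarith)).continuousOn
  · exact fun t ht => hasDerivAt_chi ε w (by simpa using ht.2)
  · exact ((continuous_chi ε hw).const_smul (w + 1)).intervalIntegrable a b

/-- The determinant `det (sign(lam_i)^{L_j} |lam_i|^{z_j})`. -/
def chiDet {n : ℕ} (z : Fin n → ℂ) (L : Fin n → ZMod 2) (lam : Fin n → ℝ) : ℂ :=
  (Matrix.of fun i j => chi (L j) (z j) (lam i)).det

/-- A determinant with a last column of ones, after subtracting neighbouring rows. -/
theorem det_snoc_one {n : ℕ} (r : Fin (n + 1) → Fin n → ℂ) :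
    (Matrix.of fun i j : Fin (n + 1) => Fin.snoc (α := fun _ => ℂ) (r i) 1 j).det
      = (Matrix.of fun i j : Fin n => r i.castSucc j - r i.succ j).det := by
  let B : Matrix (Fin (n + 1)) (Fin (n + 1)) ℂ := Matrix.of fun i j =>
    Fin.cases (motive := fun _ => ℂ) (Fin.snoc (α := fun _ => ℂ) (r 0) 1 j)
      (fun i => Fin.snoc (α := fun _ => ℂ) (fun j => r i.succ j - r i.castSucc j) 0 j) i
  rw [Matrix.det_eq_of_forall_row_eq_smul_add_pred (B := B) (fun _ => 1)]
  · rw [Matrix.det_succ_column B (Fin.last n), Fin.sum_univ_succ, Finset.sum_eq_zero, add_zero]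
    · have h1 : B.submatrix (Fin.succAbove 0) (Fin.last n).succAbove
          = -(Matrix.of fun i j : Fin n => r i.castSucc j - r i.succ j) := by
        ext i j
        simp [B]
      rw [h1, Matrix.det_neg, ← mul_assoc]
      have h2 : B 0 (Fin.last n) = 1 := by simp [B]
      rw [h2, mul_one, Fintype.card_fin, ← pow_add, Fin.val_zero, Fin.val_last, zero_add, ← two_mul,
        pow_mul]
      simp
    · intro i _
      have : B i.succ (Fin.last n) = 0 := by simp [B]
      rw [this]; ring
  · intro j
    rfl
  · intro i j
    induction j using Fin.lastCases with
    | cast j => simp [B]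
    | last => simp [B]

/-- A determinant of functions of one variable is integrated over a box row by row. -/
theorem integral_box_det {n : ℕ} (lam : Fin (n + 1) → ℝ) {f : Fin n → ℝ → ℂ}
    (hf : ∀ j, Continuous (f j)) :
    ∫ μ in box lam, (Matrix.of fun i j => f j (μ i)).det
      = (Matrix.of fun i j => ∫ t in Set.Ioo (lam i.succ) (lam i.castSucc), f j t).det := by
  have hint : ∀ j a b, Integrable (f j) (volume.restrict (Set.Ioo a b)) := fun j a b =>
    ((hf j).integrableOn_Icc (a := a) (b := b)).mono_set Set.Ioo_subset_Icc_self
  rw [← Matrix.det_transpose, Matrix.det_apply']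
  have h1 : ∀ μ : Fin n → ℝ, (Matrix.of fun i j => f j (μ i)).det
      = ∑ σ : Equiv.Perm (Fin n), ((Equiv.Perm.sign σ : ℤ) : ℂ) * ∏ i, f (σ i) (μ i) := by
    intro μ
    rw [← Matrix.det_transpose, Matrix.det_apply']
    rfl
  simp only [h1]
  rw [box, volume_pi, Measure.restrict_pi_pi, integral_finsetSum]
  · refine Finset.sum_congr rfl fun σ _ => ?_
    rw [integral_const_mul, integral_fintype_prod_eq_prod fun i t => f (σ i) t]
    rfl
  · intro σ _
    exact (Integrable.fintype_prod fun i => hint (σ i) _ _).const_mul _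

theorem measurable_chiDet {n : ℕ} (z : Fin n → ℂ) (L : Fin n → ZMod 2) :
    Measurable (chiDet z L) := by
  unfold chiDet
  simp only [Matrix.det_apply']
  refine Finset.measurable_sum _ fun σ _ => Measurable.const_mul ?_ _
  exact Finset.measurable_prod _ fun i _ => (measurable_chi _ _).comp (measurable_pi_apply _)

theorem measurable_vdm (n : ℕ) : Measurable (vdm : (Fin n → ℝ) → ℝ) := by
  unfold vdm
  refine Finset.measurable_prod _ fun i _ => Finset.measurable_prod _ fun j _ => ?_
  split_ifs
  · exact (measurable_pi_apply i).sub (measurable_pi_apply j)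
  · exact measurable_const

/-- The determinant formula with an undetermined constant `κ`. -/
def DetFormula (n : ℕ) (κ : ℂ) : Prop :=
  ∀ lam : Fin n → ℝ, StrictAnti lam → ∀ z ∈ openDomain n, ∀ L : Fin n → ZMod 2,
    numerator z L (realDiag lam) * vdm z * (vdm lam : ℝ) = κ * chiDet z L lam

/-- The analogue of the determinant formula for one parameter fewer than the size of the matrix. -/
def CornerFormula (n : ℕ) (κ : ℂ) : Prop :=
  ∀ lam : Fin (n + 1) → ℝ, StrictAnti lam → ∀ z ∈ openDomain n, ∀ L : Fin n → ZMod 2,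
    numerator z L (realDiag lam) * (vdm z * ∏ j, (z j + 1)) * (vdm lam : ℝ)
      = κ * (Matrix.of fun i j : Fin (n + 1) => Fin.snoc (α := fun _ => ℂ)
        (fun j => chi (L j + 1) (z j + 1) (lam i)) 1 j).det

/-- The corner of `k diag(lam) k^*` has interlacing eigenvalues `μ`; the factor `vdm μ` in
their density cancels the denominator in the formula for the corner. -/
theorem DetFormula.corner {n : ℕ} {κ : ℂ} (h : DetFormula n κ) : ∃ κ', CornerFormula n κ' := by
  obtain ⟨c, hc⟩ := exists_integral_eq_integral_box n
  refine ⟨c * κ, fun lam hl z hz L => ?_⟩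
  have hz' := openDomain_subset n hz
  have hv := vdm_ne_zero_of_mem_domain hz'
  rw [numerator_eq_integral_corner (Nat.le_succ n) hz' L,
    hc lam hl _ (fun μ => κ * chiDet z L μ / (vdm z * (vdm μ : ℝ)))
      (((measurable_chiDet z L).const_mul κ).div
        ((Complex.measurable_ofReal.comp (measurable_vdm n)).const_mul _))]
  -- the two factors `vdm μ` cancel, and the determinant is integrated row by row
  · have h1 : ∀ μ ∈ box lam, ((vdm μ : ℝ) : ℂ) * (κ * chiDet z L μ / (vdm z * (vdm μ : ℝ)))
        = κ / vdm z * chiDet z L μ := by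
      intro μ hμ
      have : ((vdm μ : ℝ) : ℂ) ≠ 0 :=
        Complex.ofReal_ne_zero.2 (vdm_pos (strictAnti_of_mem_box hl hμ)).ne'
      field_simp
    have h2 : ∀ i j : Fin n, (∫ t in Set.Ioo (lam i.succ) (lam i.castSucc), chi (L j) (z j) t)
        * (z j + 1) = chi (L j + 1) (z j + 1) (lam i.castSucc)
          - chi (L j + 1) (z j + 1) (lam i.succ) := by
      intro i j
      rw [← integral_chi (L j) (re_pos_of_mem_openDomain hz j), ← integral_Ioc_eq_integral_Ioo,
        intervalIntegral.integral_of_le (hl Fin.castSucc_lt_succ).le]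
    have h3 : ((vdm lam : ℝ) : ℂ) ≠ 0 := Complex.ofReal_ne_zero.2 (vdm_pos hl).ne'
    have h4 := Matrix.det_mul_row (fun j => z j + 1)
      (Matrix.of fun i j => ∫ t in Set.Ioo (lam i.succ) (lam i.castSucc), chi (L j) (z j) t)
    rw [setIntegral_congr_fun (measurableSet_box lam) h1, integral_const_mul]
    unfold chiDet
    rw [integral_box_det lam fun j => continuous_chi (L j) (re_pos_of_mem_openDomain hz j),
      det_snoc_one]
    simp only [← h2]
    simp only [Matrix.of_apply, mul_comm (_ + (1 : ℂ))] at h4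
    rw [h4]
    field_simp
  · intro k μ hμ hk
    obtain ⟨v, hv'⟩ := exists_corner_eq hl k hk
    have h1 := h μ (strictAnti_of_mem_box hl hμ) z hz L
    have h3 : ((vdm μ : ℝ) : ℂ) ≠ 0 :=
      Complex.ofReal_ne_zero.2 (vdm_pos (strictAnti_of_mem_box hl hμ)).ne'
    rw [hv', numerator_conj, eq_div_iff (mul_ne_zero hv h3), ← h1]
    ring

theorem CornerFormula.succ {n : ℕ} {κ : ℂ} (h : CornerFormula n κ) : DetFormula (n + 1) κ := by
  intro lam hl z hz L
  have hz' := openDomain_subset _ hz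
  have h1 := h lam hl (reduce z) (reduce_mem_openDomain hz) (reduce L)
  have h2 : vdm z = vdm (reduce z) * ∏ j, (reduce z j + 1) := by
    rw [vdm_castSucc]
    congr 1
    · unfold vdm reduce
      simp
    · simp [reduce]
  have h3 : (realDiag lam).det.re = ∏ i, lam i := by
    rw [realDiag, Matrix.det_diagonal, ← Complex.ofReal_prod, Complex.ofReal_re]
  have hlast : 0 < (z (Fin.last n)).re := re_pos_of_mem_openDomain hz _
  have h4 := Matrix.det_mul_column (fun i => chi (L (Fin.last n)) (z (Fin.last n)) (lam i))
    (Matrix.of fun i j : Fin (n + 1) => Fin.snoc (α := fun _ => ℂ)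
        (fun j => chi (reduce L j + 1) (reduce z j + 1) (lam i)) 1 j)
  have h5 : (Matrix.of fun i j => chi (L (Fin.last n)) (z (Fin.last n)) (lam i)
      * (Matrix.of fun i j : Fin (n + 1) => Fin.snoc (α := fun _ => ℂ)
        (fun j => chi (reduce L j + 1) (reduce z j + 1) (lam i)) 1 j) i j)
      = Matrix.of fun i j => chi (L j) (z j) (lam i) := by
    ext i j
    simp only [Matrix.of_apply]
    induction j using Fin.lastCases with
    | cast j =>
      have h6 := re_sub_ge_one hz' (Fin.castSucc_lt_last j)
      rw [Fin.snoc_castSucc, ← chi_add _ _ hlast]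
      · congr 1 <;> simp [reduce]
      · simp only [reduce, sub_add_cancel]; linarith
    | last => rw [Fin.snoc_last, mul_one]
  rw [h5] at h4
  rw [numerator_succ, h2, h3, chi_prod, chiDet, h4, mul_assoc (∏ i, _), mul_assoc (∏ i, _), h1]
  ring

theorem exists_detFormula (n : ℕ) : ∃ κ, DetFormula n κ := by
  induction n with
  | zero =>
    refine ⟨1, fun lam _ z _ L => ?_⟩
    simp [numerator_eq, vdm, chiDet]
  | succ n ih =>
    obtain ⟨κ, hκ⟩ := ih
    obtain ⟨κ', hκ'⟩ := hκ.corner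
    exact ⟨κ', hκ'.succ⟩

open Filter Topology
open scoped ComplexOrder

/-! ### The constants, and the minors that vanish -/

/-- The parameters `s + δ (s^{(n)} + 1)`, for which all exponents are increased by `δ`. -/
def shift {n : ℕ} (δ : ℂ) (s : Fin n → ℂ) : Fin n → ℂ := fun j => s j + δ * (stair ℂ n j + 1)

theorem gap_shift {n : ℕ} (δ : ℂ) (s : Fin n → ℂ) (j : Fin n) :
    gap (shift δ s) j = gap s j + δ := by
  have h := gap_stair ℂ j
  unfold shift
  unfold gap at h ⊢
  split_ifs at h ⊢ with hj
  · linear_combination δ * h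
  · linear_combination δ * h

theorem shift_mem_openDomain {n : ℕ} {δ : ℝ} (hδ : 0 < δ) {s : Fin n → ℂ} (hs : s ∈ domain n) :
    shift δ s ∈ openDomain n := fun j => by
  rw [gap_shift, Complex.add_re, Complex.ofReal_re]
  have := hs j
  positivity

theorem continuous_shift {n : ℕ} (s : Fin n → ℂ) : Continuous fun δ : ℝ => shift δ s := by
  unfold shift
  fun_prop

theorem tendsto_shift {n : ℕ} (s : Fin n → ℂ) :
    Tendsto (fun δ : ℝ => shift δ s) (𝓝[>] 0) (𝓝 s) := by
  have h := (continuous_shift s).tendsto 0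
  have h0 : shift (0 : ℝ) s = s := by funext j; simp [shift]
  rw [h0] at h
  exact h.mono_left nhdsWithin_le_nhds

theorem stair_mem_domain (n : ℕ) : stair ℂ n ∈ domain n := fun j => by
  rw [gap_stair]; simp

/-- The leading minors of `k x k^*` of size up to `n` do not vanish. -/
def NonvanishingMinors {l : ℕ} (n : ℕ) (x : Matrix (Fin l) (Fin l) ℂ) (k : K l) : Prop :=
  ∀ j : Fin n, minor (j + 1) (k.1 * x * k.1ᴴ) ≠ 0

theorem measurableSet_nonvanishingMinors {l : ℕ} (n : ℕ) (x : Matrix (Fin l) (Fin l) ℂ) :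
    MeasurableSet {k : K l | NonvanishingMinors n x k} := by
  unfold NonvanishingMinors
  rw [Set.ofPred_forall]
  refine MeasurableSet.iInter fun j => ?_
  exact (continuous_minor_conj _ (continuous_coeK l) x).measurable
    (measurableSet_singleton 0).compl

open Classical in
/-- As `0 ^ 0 = 1` but `0 ^ δ = 0`, the limit differs from the value where a minor vanishes. -/
theorem tendsto_prod_chi_shift {n : ℕ} {s : Fin n → ℂ} (hs : s ∈ domain n) (ε : Fin n → ZMod 2)
    (t : Fin n → ℝ) :
    Tendsto (fun δ : ℝ => ∏ j, chi (ε j) (gap (shift δ s) j) (t j)) (𝓝[>] 0)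
      (𝓝 (if ∀ j, t j ≠ 0 then ∏ j, chi (ε j) (gap s j) (t j) else 0)) := by
  split_ifs with hk
  · refine tendsto_finsetProd _ fun j _ => ?_
    unfold chi
    refine Tendsto.const_mul _ ?_
    refine Tendsto.const_cpow ?_ (Or.inl (by simpa using hk j))
    exact (((continuous_gap j).tendsto s).comp (tendsto_shift s))
  · refine tendsto_const_nhds.congr' ?_
    filter_upwards [self_mem_nhdsWithin] with δ hδ
    push Not at hk
    obtain ⟨j, hj⟩ := hk
    refine (Finset.prod_eq_zero (Finset.mem_univ j) ?_).symm
    rw [hj, chi_zero]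
    have := shift_mem_openDomain hδ hs j
    intro h0
    simp [h0] at this

/-- Increasing all exponents by `δ > 0` removes the contribution of the vanishing minors. -/
theorem tendsto_numerator_shift_indicator {l n : ℕ} (x : Matrix (Fin l) (Fin l) ℂ)
    {s : Fin n → ℂ} (hs : s ∈ domain n) (L : Fin n → ZMod 2) :
    Tendsto (fun δ : ℝ => numerator (shift δ s) L x) (𝓝[>] 0)
      (𝓝 (∫ k : K l, (∏ j : Fin n, chi (gap L j) (gap s j) (minor (j + 1) (k.1 * x * k.1ᴴ)))
        ∂(haarK l).restrict {k : K l | NonvanishingMinors n x k})) := by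
  have hc : ∀ j : Fin n, Continuous fun k : K l => minor (j + 1) (k.1 * x * k.1ᴴ) := fun j =>
    continuous_minor_conj _ (continuous_coeK l) x
  obtain ⟨b, hb⟩ := exists_abs_le hc
  have hb' : ∀ (k : K l) (j : Fin n), |minor (j + 1) (k.1 * x * k.1ᴴ)| ≤ max b 1 := fun k j =>
    (hb k j).trans (le_max_left _ _)
  have h1 : (1 : ℝ) ≤ max b 1 := le_max_right _ _
  rw [← integral_indicator (measurableSet_nonvanishingMinors n x)]
  simp only [numerator_eq]
  refine tendsto_integral_filter_of_dominated_convergence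
    (fun _ => ∏ j : Fin n, (max b 1) ^ ((gap s j).re + 1)) ?_ ?_ ?_ ?_
  · exact Eventually.of_forall fun δ =>
      (measurable_prod_chi _ _ fun j => (hc j).measurable).aestronglyMeasurable
  · filter_upwards [Ioo_mem_nhdsGT (show (0 : ℝ) < 1 from one_pos)] with δ hδ
    refine Eventually.of_forall fun k => ?_
    refine (norm_prod_chi_le _ (fun j => ?_) (hb' k)).trans ?_
    · exact openDomain_subset _ (shift_mem_openDomain hδ.1 hs) j
    · refine Finset.prod_le_prod (fun j _ => by positivity) fun j _ => ?_
      refine Real.rpow_le_rpow_of_exponent_le h1 ?_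
      rw [gap_shift, Complex.add_re, Complex.ofReal_re]
      linarith [hδ.2]
  · exact integrable_const _
  · refine Eventually.of_forall fun k => ?_
    have h := tendsto_prod_chi_shift hs (gap L) fun j : Fin n => minor (j + 1) (k.1 * x * k.1ᴴ)
    by_cases hk : NonvanishingMinors n x k
    · rw [if_pos (show ∀ j : Fin n, minor (j + 1) (k.1 * x * k.1ᴴ) ≠ 0 from hk)] at h
      rw [Set.indicator_of_mem (show k ∈ {k : K l | NonvanishingMinors n x k} from hk)]
      exact h
    · rw [if_neg (show ¬ ∀ j : Fin n, minor (j + 1) (k.1 * x * k.1ᴴ) ≠ 0 from hk)] at h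
      rw [Set.indicator_of_notMem (show k ∉ {k : K l | NonvanishingMinors n x k} from hk)]
      exact h

theorem tendsto_numerator_shift {l n : ℕ} {x : Matrix (Fin l) (Fin l) ℂ}
    (hx : ∀ᵐ k ∂haarK l, NonvanishingMinors n x k)
    {s : Fin n → ℂ} (hs : s ∈ domain n) (L : Fin n → ZMod 2) :
    Tendsto (fun δ : ℝ => numerator (shift δ s) L x) (𝓝[>] 0) (𝓝 (numerator s L x)) := by
  have h := tendsto_numerator_shift_indicator x hs L
  have h2 : (haarK l).restrict {k : K l | NonvanishingMinors n x k} = haarK l :=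
    Measure.restrict_eq_self_of_ae_mem hx
  rwa [h2] at h

/-- In the limit `δ → 0` the numerator at `s^{(n)}`, which is `1`, loses the mass of the set where a
minor vanishes. -/
theorem ae_nonvanishingMinors_of_tendsto {l n : ℕ} {x : Matrix (Fin l) (Fin l) ℂ}
    (h : Tendsto (fun δ : ℝ => numerator (shift δ (stair ℂ n)) (stair (ZMod 2) n) x) (𝓝[>] 0)
      (𝓝 1)) : ∀ᵐ k ∂haarK l, NonvanishingMinors n x k := by
  have h2 := tendsto_nhds_unique h
    (tendsto_numerator_shift_indicator x (stair_mem_domain n) (stair (ZMod 2) n))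
  simp only [gap_stair, chi_zero_zero, Finset.prod_const_one, integral_const,
    measureReal_restrict_apply_univ,
    Complex.real_smul, mul_one] at h2
  have h3 : (haarK l).real {k : K l | NonvanishingMinors n x k} = 1 := by exact_mod_cast h2.symm
  have h4 : haarK l {k : K l | NonvanishingMinors n x k} = 1 := by
    rw [← ENNReal.toReal_eq_one_iff]; exact h3
  exact (prob_compl_eq_zero_iff (measurableSet_nonvanishingMinors n x)).2 h4

theorem minor_pos_of_posDef {n j : ℕ} (hj : j ≤ n) {x : Matrix (Fin n) (Fin n) ℂ}
    (hx : x.PosDef) : 0 < minor j x := by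
  have h := hx.conjTranspose_mul_mul_same (B := proj n j) (by
    refine Function.LeftInverse.injective (g := (proj j n).mulVec) fun v => ?_
    simp [Matrix.mulVec_mulVec, proj_mul_proj hj, proj_self])
  rw [conjTranspose_proj] at h
  exact (Complex.lt_def.1 h.det_pos).1

theorem posDef_realDiag {n : ℕ} {lam : Fin n → ℝ} (h : ∀ i, 0 < lam i) :
    (realDiag lam).PosDef := by
  refine Matrix.PosDef.diagonal fun i => ?_
  exact_mod_cast h i

theorem PosDef.ae_nonvanishingMinors {n : ℕ} {x : Matrix (Fin n) (Fin n) ℂ} (hx : x.PosDef) :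
    ∀ᵐ k ∂haarK n, NonvanishingMinors n x k := by
  refine Eventually.of_forall fun k j => (minor_pos_of_posDef (by omega) ?_).ne'
  refine hx.mul_mul_conjTranspose_same ?_
  refine Function.LeftInverse.injective (g := fun v => Matrix.vecMul v k.1ᴴ) fun v => ?_
  simp [Matrix.vecMul_vecMul, coe_mul_conjTranspose]

theorem numerator_stair {l n : ℕ} (x : Matrix (Fin l) (Fin l) ℂ) :
    numerator (stair ℂ n) (stair (ZMod 2) n) x = 1 := by
  simp [numerator_eq, gap_stair, chi_zero_zero]

theorem continuous_vdm (R : Type*) [CommRing R] [TopologicalSpace R] [IsTopologicalRing R]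
    (n : ℕ) : Continuous (vdm : (Fin n → R) → R) := by
  unfold vdm
  refine continuous_finsetProd _ fun i _ => continuous_finsetProd _ fun j _ => ?_
  split_ifs
  · exact (continuous_apply i).sub (continuous_apply j)
  · exact continuous_const

theorem vdm_ofReal {n : ℕ} (lam : Fin n → ℝ) : vdm (fun i => (lam i : ℂ)) = (vdm lam : ℝ) := by
  unfold vdm
  push_cast
  refine Finset.prod_congr rfl fun i _ => Finset.prod_congr rfl fun j _ => ?_
  split_ifs <;> simp

theorem exists_strictAnti_pos (n : ℕ) : ∃ lam : Fin n → ℝ, StrictAnti lam ∧ ∀ i, 0 < lam i :=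
  ⟨fun i => (n : ℝ) - i, fun i j h => by
    have : (i : ℝ) < j := by exact_mod_cast h
    dsimp only; linarith, fun i => by
    have : (i : ℝ) < n := by exact_mod_cast i.2
    linarith⟩

theorem continuous_chiDet {n : ℕ} (L : Fin n → ZMod 2) {lam : Fin n → ℝ} (h : ∀ i, lam i ≠ 0) :
    Continuous fun z : Fin n → ℂ => chiDet z L lam := by
  unfold chiDet
  refine Continuous.matrix_det (continuous_matrix fun i j => ?_)
  simp only [Matrix.of_apply, chi]
  refine continuous_const.mul (Continuous.const_cpow (continuous_apply j) (Or.inl ?_))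
  simpa using h i

theorem chi_natCast (m : ℕ) {t : ℝ} (ht : t ≠ 0) : chi (m : ZMod 2) (m : ℂ) t = (t : ℂ) ^ m := by
  induction m with
  | zero => simp [chi_zero_zero]
  | succ m ih =>
    push_cast
    rw [chi_add_of_ne_zero _ _ _ _ ht, ih, pow_succ]
    congr 1
    rcases lt_or_gt_of_ne ht with h | h
    · simp [chi, signPow, Real.sign_of_neg h, abs_of_neg h]
    · simp [chi_of_pos _ _ h]

theorem chiDet_stair {n : ℕ} {lam : Fin n → ℝ} (h : ∀ i, lam i ≠ 0) :
    chiDet (stair ℂ n) (stair (ZMod 2) n) lam = (vdm lam : ℝ) := by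
  rw [← vdm_ofReal, ← det_eq_vdm, chiDet]
  congr 1
  ext i j
  simp only [Matrix.of_apply, stair]
  exact chi_natCast _ (h i)

/-- The constant in the determinant formula. -/
theorem DetFormula.eq_vdm {n : ℕ} {κ : ℂ} (h : DetFormula n κ) : κ = vdm (stair ℂ n) := by
  obtain ⟨lam, hl, hpos⟩ := exists_strictAnti_pos n
  have h1 := tendsto_numerator_shift (PosDef.ae_nonvanishingMinors (posDef_realDiag hpos))
    (stair_mem_domain n) (stair (ZMod 2) n)
  have h2 := (h1.mul (((continuous_vdm ℂ n).tendsto _).comp (tendsto_shift (stair ℂ n)))).mul_const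
    ((vdm lam : ℝ) : ℂ)
  have h3 := (((continuous_chiDet (stair (ZMod 2) n) fun i => (hpos i).ne').tendsto _).comp
    (tendsto_shift (stair ℂ n))).const_mul κ
  have h4 := tendsto_nhds_unique (h2.congr' ?_) h3
  · rw [numerator_stair, chiDet_stair fun i => (hpos i).ne'] at h4
    have h5 : ((vdm lam : ℝ) : ℂ) ≠ 0 := Complex.ofReal_ne_zero.2 (vdm_pos hl).ne'
    exact (mul_right_cancel₀ h5 (by rw [← h4]; ring)).symm
  · filter_upwards [self_mem_nhdsWithin] with δ hδ
    exact h lam hl _ (shift_mem_openDomain hδ (stair_mem_domain n)) _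

theorem detFormula (n : ℕ) : DetFormula n (vdm (stair ℂ n)) := by
  obtain ⟨κ, h⟩ := exists_detFormula n
  rwa [← h.eq_vdm]

theorem cornerFormula (n : ℕ) : CornerFormula n (vdm (stair ℂ (n + 1))) := by
  obtain ⟨κ, h⟩ := (detFormula n).corner
  rwa [← h.succ.eq_vdm]

/-- For a geometric progression of eigenvalues the determinant is a Vandermonde determinant in the
numbers `e^{t z_j}`. -/
theorem exists_chiDet_ne_zero {n : ℕ} {z : Fin n → ℂ} (hz : vdm z ≠ 0) (L : Fin n → ZMod 2) :
    ∃ lam : Fin n → ℝ, StrictAnti lam ∧ (∀ i, 0 < lam i) ∧ chiDet z L lam ≠ 0 := by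
  have h1 : ∀ i j : Fin n, i < j →
      ∀ᶠ t : ℝ in 𝓝[>] 0, Complex.exp (t * (z i)) - Complex.exp (t * z j) ≠ 0 := by
    intro i j hij
    have hne : z i - z j ≠ 0 := by
      have := Finset.prod_ne_zero_iff.1 (Finset.prod_ne_zero_iff.1 hz i (Finset.mem_univ _)) j
        (Finset.mem_univ _)
      rwa [if_pos hij] at this
    have hd : HasDerivAt (fun t : ℝ => Complex.exp (t * (z i)) - Complex.exp (t * z j))
        (z i - z j) 0 := by
      have hd1 : ∀ w : ℂ, HasDerivAt (fun t : ℝ => Complex.exp (t * w)) w 0 := fun w => by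
        have := (((hasDerivAt_id ((0 : ℝ) : ℂ)).mul_const w).cexp).comp_ofReal
        simpa using this
      exact (hd1 _).sub (hd1 _)
    have := hd.eventually_ne hne (c := 0)
    exact this.filter_mono (nhdsWithin_mono _ fun t ht => ne_of_gt ht)
  have h2 : ∀ᶠ t : ℝ in 𝓝[>] 0, ∀ i j : Fin n, i < j →
      Complex.exp (t * (z i)) - Complex.exp (t * z j) ≠ 0 := by
    simp only [eventually_all]
    exact fun i j hij => h1 i j hij
  obtain ⟨t, ht, ht0⟩ := (h2.and self_mem_nhdsWithin).exists
  have ht0 : 0 < t := ht0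
  refine ⟨fun i => Real.exp (t * (Fin.rev i : Fin n)), fun i j hij => ?_,
    fun i => Real.exp_pos _, ?_⟩
  · refine Real.exp_lt_exp.2 (mul_lt_mul_of_pos_left ?_ ht0)
    exact_mod_cast Fin.rev_lt_rev.2 hij
  · have h3 : chiDet z L (fun i => Real.exp (t * (Fin.rev i : Fin n)))
        = vdm fun i => Complex.exp (t * z i) := by
      rw [← det_eq_vdm, ← Matrix.det_transpose, chiDet]
      have h4 : ∀ i j : Fin n, chi (L j) (z j) (Real.exp (t * (Fin.rev i : Fin n)))
          = Complex.exp (t * z j) ^ ((Fin.rev i : Fin n) : ℕ) := fun i j => by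
        rw [chi_of_pos _ _ (Real.exp_pos _), Complex.ofReal_exp, Complex.cpow_def_of_ne_zero
          (Complex.exp_ne_zero _), ← Complex.ofReal_exp, ← Complex.ofReal_log (Real.exp_pos _).le,
          Real.log_exp, ← Complex.exp_nat_mul]
        congr 1
        push_cast
        ring
      simp only [h4]
      rfl
    rw [h3]
    refine Finset.prod_ne_zero_iff.2 fun i _ => Finset.prod_ne_zero_iff.2 fun j _ => ?_
    split_ifs with h
    · exact ht i j h
    · exact one_ne_zero

/-! ### The normalizing integral -/

theorem vdm_add_const {R : Type*} [CommRing R] {n : ℕ} (x : Fin n → R) (a : R) :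
    vdm (fun j => x j + a) = vdm x := by
  simp [vdm]

theorem vdm_stair_succ (n : ℕ) :
    vdm (stair ℂ (n + 1)) = vdm (stair ℂ n) * ∏ j, (stair ℂ n j + 1) := by
  have h : ∀ j : Fin n, stair ℂ (n + 1) j.castSucc = stair ℂ n j + 1 := fun j => by
    have hj := j.2
    simp only [stair, Fin.val_rev, Fin.val_castSucc]
    rw [← Nat.cast_succ]
    congr 1
    omega
  rw [vdm_castSucc]
  simp only [h]
  rw [vdm_add_const]
  simp [stair]

theorem realDiag_snoc_zero {n : ℕ} (lam : Fin n → ℝ) :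
    realDiag (Fin.snoc (α := fun _ => ℝ) lam 0)
      = proj (n + 1) n * realDiag lam * proj n (n + 1) := by
  ext a b
  simp only [realDiag, Matrix.mul_apply, proj, Matrix.of_apply,
    Matrix.diagonal_apply]
  induction a using Fin.lastCases with
  | cast a =>
    rw [Finset.sum_eq_single a]
    · induction b using Fin.lastCases with
      | cast b =>
        by_cases hab : a = b
        · simp [hab]
        · have : (a : ℕ) ≠ b := fun h => hab (Fin.ext h)
          simp [hab, this]
      | last =>
        have : (a : ℕ) ≠ n := a.2.ne
        have h2 : a.castSucc ≠ Fin.last n := (Fin.castSucc_lt_last a).ne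
        simp [this, h2]
    · intro c _ hc
      have : (a : ℕ) ≠ c := fun h => hc (Fin.ext h.symm)
      simp [this]
    · simp
  | last =>
    rw [Finset.sum_eq_zero]
    · by_cases hb : Fin.last n = b
      · simp [← hb]
      · simp [hb]
    · intro c _
      have : n ≠ (c : ℕ) := c.2.ne'
      simp [this]

theorem strictAnti_snoc_zero {n : ℕ} {lam : Fin n → ℝ} (hl : StrictAnti lam)
    (hpos : ∀ i, 0 < lam i) : StrictAnti (Fin.snoc (α := fun _ => ℝ) lam 0) := by
  intro a b hab
  induction a using Fin.lastCases with
  | cast a =>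
    induction b using Fin.lastCases with
    | cast b => simpa using hl (by simpa using hab)
    | last => simpa using hpos a
  | last => exact absurd (Fin.le_last b) hab.not_ge

/-- The normalizing integral for rank `n` in size `n + 1`, from the corner formula with the last
eigenvalue `0`. -/
theorem normalization_succ_of_mem_openDomain {n : ℕ} {z : Fin n → ℂ} (hz : z ∈ openDomain n) :
    normalization (n + 1) z * ∏ j, (z j + 1) = ∏ j, (stair ℂ n j + 1) := by
  have hz' := openDomain_subset n hz
  -- the corner formula at the eigenvalues `lam, 0` and the determinant formula at `lam`
  obtain ⟨lam, hl, hpos, hne⟩ := exists_chiDet_ne_zero (vdm_ne_zero_of_mem_domain hz')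
    (stair (ZMod 2) n)
  have h1 := cornerFormula n _ (strictAnti_snoc_zero hl hpos) z hz (stair (ZMod 2) n)
  have h2 := detFormula n lam hl z hz (stair (ZMod 2) n)
  rw [realDiag_snoc_zero, numerator_embed (Nat.le_add_right n 1) le_rfl hz' _ _
    (Or.inl fun j => gap_stair _ j), ← normalization_eq, vdm_stair_succ, vdm_castSucc] at h1
  have h3 : (Matrix.of fun i j : Fin (n + 1) => Fin.snoc (α := fun _ => ℂ)
        (fun j => chi (stair (ZMod 2) n j + 1) (z j + 1)
          (Fin.snoc (α := fun _ => ℝ) lam 0 i)) 1 j).det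
      = (∏ i, (lam i : ℂ)) * chiDet z (stair (ZMod 2) n) lam := by
    rw [Matrix.det_succ_row _ (Fin.last n), Fin.sum_univ_castSucc, Finset.sum_eq_zero, zero_add]
    · have h4 : (Matrix.of fun i j : Fin (n + 1) => Fin.snoc (α := fun _ => ℂ)
        (fun j => chi (stair (ZMod 2) n j + 1) (z j + 1)
          (Fin.snoc (α := fun _ => ℝ) lam 0 i)) 1 j).submatrix (Fin.last n).succAbove
            (Fin.last n).succAbove
          = Matrix.of fun i j => (lam i : ℂ) * (Matrix.of fun i j : Fin n =>
            chi (stair (ZMod 2) n j) (z j) (lam i)) i j := by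
        ext i j
        simp only [Matrix.submatrix_apply, Fin.succAbove_last, Matrix.of_apply, Fin.snoc_castSucc]
        rw [chi_add_of_ne_zero _ _ _ _ (hpos i).ne', mul_comm]
        congr 1
        rw [chi_of_pos _ _ (hpos i), Complex.cpow_one]
      rw [h4, Matrix.det_mul_column]
      simp [chiDet, ← two_mul]
    · intro j _
      have : z j + 1 ≠ 0 := fun h => by
        have h5 := congrArg Complex.re h
        have := re_pos_of_mem_openDomain hz j
        simp at h5
        linarith
      simp [chi_zero this]
  rw [h3] at h1
  simp only [Fin.snoc_castSucc, Fin.snoc_last, sub_zero] at h1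
  push_cast at h1
  have h6 : (∏ i, (lam i : ℂ)) ≠ 0 :=
    Finset.prod_ne_zero_iff.2 fun i _ => Complex.ofReal_ne_zero.2 (hpos i).ne'
  have h7 : vdm (stair ℂ n) ≠ 0 := vdm_ne_zero_of_mem_domain (stair_mem_domain n)
  have h8 : vdm (stair ℂ n) * chiDet z (stair (ZMod 2) n) lam * ∏ i, (lam i : ℂ) ≠ 0 :=
    mul_ne_zero (mul_ne_zero h7 hne) h6
  refine mul_right_cancel₀ h8 ?_
  calc _ = normalization (n + 1) z * (∏ j, (z j + 1)) * (vdm (stair ℂ n) *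
        chiDet z (stair (ZMod 2) n) lam) * ∏ i, (lam i : ℂ) := by ring
    _ = _ := by
      linear_combination h1 - (normalization (n + 1) z * (∏ j, (z j + 1))
        * ∏ i, (lam i : ℂ)) * h2

theorem prod_stair_add_ne_zero (n i : ℕ) : ∏ j, (stair ℂ n j + 1 + i) ≠ 0 := by
  refine Finset.prod_ne_zero_iff.2 fun j _ => ?_
  unfold stair
  exact_mod_cast (by omega : ((Fin.rev j : Fin n) : ℕ) + 1 + i ≠ 0)

theorem prod_add_ne_zero {n : ℕ} {z : Fin n → ℂ} (hz : z ∈ domain n) (i : ℕ) :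
    ∏ j, (z j + 1 + i) ≠ 0 := by
  refine Finset.prod_ne_zero_iff.2 fun j _ h => ?_
  have h1 := congrArg Complex.re h
  have h2 := re_nonneg_of_mem_domain hz j
  have h3 : (0 : ℝ) ≤ i := i.cast_nonneg
  simp at h1
  linarith

theorem tendsto_prod_shift {n : ℕ} (z : Fin n → ℂ) (i : ℕ) :
    Tendsto (fun δ : ℝ => ∏ j, (shift δ z j + 1 + i)) (𝓝[>] 0) (𝓝 (∏ j, (z j + 1 + i))) := by
  refine tendsto_finsetProd _ fun j _ => ?_
  exact ((((continuous_apply j).tendsto z).comp (tendsto_shift z)).add_const 1).add_const _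

theorem ae_nonvanishingMinors_proj_succ (n : ℕ) :
    ∀ᵐ k ∂haarK (n + 1), NonvanishingMinors n (proj (n + 1) n * proj n (n + 1)) k := by
  refine ae_nonvanishingMinors_of_tendsto ?_
  have h1 := tendsto_prod_shift (stair ℂ n) 0
  have h0 := prod_stair_add_ne_zero n 0
  simp only [Nat.cast_zero, add_zero] at h1 h0
  have h2 := (tendsto_const_nhds (x := ∏ j, (stair ℂ n j + 1))).div h1 h0
  rw [div_self h0] at h2
  refine h2.congr' ?_
  filter_upwards [self_mem_nhdsWithin] with δ hδ
  have h3 := shift_mem_openDomain hδ (stair_mem_domain n)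
  have h4 := prod_add_ne_zero (openDomain_subset _ h3) 0
  simp only [Nat.cast_zero, add_zero] at h4
  simp only [Pi.div_apply]
  rw [← normalization_eq, div_eq_iff h4, normalization_succ_of_mem_openDomain h3]

theorem normalization_succ {n : ℕ} {z : Fin n → ℂ} (hz : z ∈ domain n) :
    normalization (n + 1) z * ∏ j, (z j + 1) = ∏ j, (stair ℂ n j + 1) := by
  have h1 := tendsto_numerator_shift (ae_nonvanishingMinors_proj_succ n) hz (stair (ZMod 2) n)
  have h2 := tendsto_prod_shift z 0
  simp only [Nat.cast_zero, add_zero] at h2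
  rw [normalization_eq]
  refine tendsto_nhds_unique ((h1.mul h2).congr' ?_) tendsto_const_nhds
  filter_upwards [self_mem_nhdsWithin] with δ hδ
  rw [← normalization_eq, normalization_succ_of_mem_openDomain (shift_mem_openDomain hδ hz)]

/-- The denominator of the normalizing integral as a rational function of the parameters. -/
def normDen (l : ℕ) {n : ℕ} (z : Fin n → ℂ) : ℂ :=
  ∏ i ∈ Finset.range (l - n), ∏ j, (z j + 1 + i)

theorem normDen_stair_ne_zero (l n : ℕ) : normDen l (stair ℂ n) ≠ 0 :=
  Finset.prod_ne_zero_iff.2 fun i _ => prod_stair_add_ne_zero n i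

theorem normDen_ne_zero {l n : ℕ} {z : Fin n → ℂ} (hz : z ∈ domain n) : normDen l z ≠ 0 :=
  Finset.prod_ne_zero_iff.2 fun i _ => prod_add_ne_zero hz i

/-- The normalizing integral is the inverse of a product of linear forms. -/
theorem normalization_mul_normDen {l n : ℕ} (h : n ≤ l) {z : Fin n → ℂ} (hz : z ∈ domain n) :
    normalization l z * normDen l z = normDen l (stair ℂ n) := by
  obtain ⟨D, rfl⟩ := Nat.exists_eq_add_of_le h
  unfold normDen
  simp only [Nat.add_sub_cancel_left]
  induction D with
  | zero =>
    have h1 : normalization n z = 1 := by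
      rw [normalization_eq, numerator_eq]
      have h2 : ∀ (k : K n) (j : Fin n),
          minor (j + 1) (k.1 * (proj n n * proj n n) * k.1ᴴ) = 1 := fun k j => by
        rw [proj_self, Matrix.one_mul, Matrix.mul_one, coe_mul_conjTranspose,
          minor_one (by omega)]
      simp only [h2, chi_one]
      simp
    simpa using h1
  | succ D ih =>
    have h1 := normalization_chain (l := n + (D + 1)) (d := D) (by omega) hz
    have h2 := normalization_succ (ext_mem_domain D hz)
    rw [← ext_stair] at h2
    simp only [ext, Fin.prod_univ_add, Fin.append_left, Fin.append_right] at h2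
    have h3 : ∏ j, (stair ℂ D j + 1) ≠ 0 := by
      simpa using prod_stair_add_ne_zero D 0
    rw [← mul_assoc] at h2
    have h4 := mul_right_cancel₀ h3 h2
    simp only [add_right_comm _ (D : ℂ) 1] at h4
    rw [Finset.prod_range_succ, Finset.prod_range_succ, ← ih (by omega), ← h4, h1]
    simp only [ext]
    rw [show n + (D + 1) = n + D + 1 from rfl]
    ring

theorem normalization_eq_div {l n : ℕ} (h : n ≤ l) {z : Fin n → ℂ} (hz : z ∈ domain n) :
    normalization l z = normDen l (stair ℂ n) / normDen l z :=
  eq_div_of_mul_eq (normDen_ne_zero hz) (normalization_mul_normDen h hz)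

theorem normalization_ne_zero {l n : ℕ} (h : n ≤ l) {z : Fin n → ℂ} (hz : z ∈ domain n) :
    normalization l z ≠ 0 := by
  rw [normalization_eq_div h hz]
  exact div_ne_zero (normDen_stair_ne_zero l n) (normDen_ne_zero hz)

theorem continuous_normDen (l n : ℕ) : Continuous fun z : Fin n → ℂ => normDen l z := by
  unfold normDen
  fun_prop

theorem tendsto_normalization_shift {l n : ℕ} (h : n ≤ l) :
    Tendsto (fun δ : ℝ => normalization l (shift δ (stair ℂ n))) (𝓝[>] 0) (𝓝 1) := by
  have h1 := ((continuous_normDen l n).tendsto _).comp (tendsto_shift (stair ℂ n))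
  have h2 := (tendsto_const_nhds (x := normDen l (stair ℂ n))).div h1 (normDen_stair_ne_zero l n)
  rw [div_self (normDen_stair_ne_zero l n)] at h2
  refine h2.congr' ?_
  filter_upwards [self_mem_nhdsWithin] with δ hδ
  exact (normalization_eq_div h (openDomain_subset _
    (shift_mem_openDomain hδ (stair_mem_domain n)))).symm

/-! ### Confluent exponential determinants -/

section Confluence

variable {n : ℕ} {κ κ' : Type*} [DecidableEq κ] [DecidableEq κ']

/-- The product of the differences `x_p - x_a`, `p < a`, inside the classes of `c`. -/
def classVdm (c : Fin n → κ) (x : Fin n → ℂ) : ℂ :=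
  ∏ a, ∏ p, if p < a ∧ c p = c a then x p - x a else 1

/-- The product of the differences `x_p - x_a`, `p < a`, between different classes of `c`. -/
def mixedVdm (c : Fin n → κ) (x : Fin n → ℂ) : ℂ :=
  ∏ a, ∏ p, if p < a ∧ c p ≠ c a then x p - x a else 1

theorem classVdm_mul_mixedVdm (c : Fin n → κ) (x : Fin n → ℂ) :
    classVdm c x * mixedVdm c x = vdm x := by
  unfold classVdm mixedVdm vdm
  rw [Finset.prod_comm (f := fun i j => if i < j then x i - x j else 1),
    ← Finset.prod_mul_distrib]
  refine Finset.prod_congr rfl fun a _ => ?_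
  rw [← Finset.prod_mul_distrib]
  refine Finset.prod_congr rfl fun p _ => ?_
  by_cases h : p < a <;> by_cases h2 : c p = c a <;> simp [h, h2]

/-- The values at the points `x_b` of the Newton polynomials `∏_{p < a} (x_p - t)`, formed inside
the classes of `c`. -/
def newtonMatrix (c : Fin n → κ) (x : Fin n → ℂ) : Matrix (Fin n) (Fin n) ℂ :=
  Matrix.of fun a b => if c a = c b then ∏ p, if p < a ∧ c p = c a then x p - x b else 1 else 0

/-- The bidiagonal matrix, with diagonal `x`, of the multiplication by the variable in the Newton
basis. -/
def bidiagonal (c : Fin n → κ) (x : Fin n → ℂ) : Matrix (Fin n) (Fin n) ℂ :=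
  Matrix.diagonal x - Matrix.of fun a b =>
    if a < b ∧ c a = c b ∧ ∀ p, a < p → p < b → c p ≠ c a then 1 else 0

theorem det_newtonMatrix (c : Fin n → κ) (x : Fin n → ℂ) :
    (newtonMatrix c x).det = classVdm c x := by
  rw [Matrix.det_of_isUpperTriangular]
  · simp [newtonMatrix, classVdm]
  · intro a b hab
    simp only [newtonMatrix, Matrix.of_apply]
    split_ifs with h
    · refine Finset.prod_eq_zero (Finset.mem_univ b) ?_
      rw [if_pos ⟨hab, h.symm⟩, sub_self]
    · rfl

theorem bidiagonal_mul_newtonMatrix (c : Fin n → κ) (x : Fin n → ℂ) :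
    bidiagonal c x * newtonMatrix c x = newtonMatrix c x * Matrix.diagonal x := by
  ext a b
  rw [bidiagonal, Matrix.sub_mul, Matrix.sub_apply, Matrix.diagonal_mul, Matrix.mul_diagonal,
    Matrix.mul_apply]
  by_cases hab : c a = c b
  · by_cases hex : ∃ q, a < q ∧ c a = c q
    · -- `q` is the successor of `a` in its class
      obtain ⟨q, ⟨hq1, hq2⟩, hq3⟩ : ∃ q, (a < q ∧ c a = c q) ∧
          ∀ p, (a < p ∧ c a = c p) → q ≤ p := by
        obtain ⟨q, hq⟩ := (Finset.univ.filter fun q => a < q ∧ c a = c q).exists_minimal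
          (by obtain ⟨q, hq⟩ := hex; exact ⟨q, by simpa using hq⟩)
        have h1 := hq.prop
        simp only [Finset.mem_filter, Finset.mem_univ, true_and] at h1
        refine ⟨q, h1, fun p hp => ?_⟩
        rcases le_total q p with h | h
        · exact h
        · exact hq.le_of_le (by simpa using hp) h
      rw [Finset.sum_eq_single q]
      · have h1 : ∀ p, a < p → p < q → c p ≠ c a := fun p hp hpq h =>
          absurd (hq3 p ⟨hp, h.symm⟩) hpq.not_ge
        simp only [newtonMatrix, Matrix.of_apply]
        rw [if_pos hab, if_pos (hq2.symm.trans hab), if_pos (show a < q ∧ c a = c q ∧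
          ∀ p, a < p → p < q → c p ≠ c a from ⟨hq1, hq2, h1⟩)]
        have h2 : (∏ p, if p < q ∧ c p = c q then x p - x b else 1)
            = (x a - x b) * ∏ p, if p < a ∧ c p = c a then x p - x b else 1 := by
          rw [← Finset.prod_erase_mul _ _ (Finset.mem_univ a),
            ← Finset.prod_erase_mul (f := fun p => if p < a ∧ c p = c a then x p - x b else 1) _
              (Finset.mem_univ a), if_pos ⟨hq1, hq2⟩, if_neg (by simp), mul_one, mul_comm]
          congr 1
          refine Finset.prod_congr rfl fun p hp => ?_
          have hpa : p ≠ a := Finset.ne_of_mem_erase hp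
          congr 1
          rw [hq2, eq_iff_iff]
          refine ⟨fun ⟨h3, h4⟩ => ⟨?_, h4⟩, fun ⟨h3, h4⟩ => ⟨h3.trans hq1, h4⟩⟩
          rcases lt_or_gt_of_ne hpa with h5 | h5
          · exact h5
          · exact absurd (h4.trans hq2.symm) (h1 p h5 h3)
        rw [h2]
        ring
      · intro p _ hp
        simp only [Matrix.of_apply]
        rw [if_neg, zero_mul]
        rintro ⟨h1, h2, h3⟩
        rcases (hq3 p ⟨h1, h2⟩).lt_or_eq with h4 | h4
        · exact h3 q hq1 h4 hq2.symm
        · exact hp h4.symm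
      · simp
    · rw [Finset.sum_eq_zero]
      · simp only [newtonMatrix, Matrix.of_apply, if_pos hab]
        push Not at hex
        have hba : b ≤ a := by
          by_contra h
          exact hex b (not_le.1 h) hab
        rcases hba.lt_or_eq with h | h
        · rw [Finset.prod_eq_zero (Finset.mem_univ b)]
          · ring
          · rw [if_pos ⟨h, hab.symm⟩, sub_self]
        · rw [h]; ring
      · intro p _
        simp only [Matrix.of_apply]
        rw [if_neg, zero_mul]
        rintro ⟨h1, h2, -⟩
        exact hex ⟨p, h1, h2⟩
  · rw [Finset.sum_eq_zero]
    · simp [newtonMatrix, hab]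
    · intro p _
      simp only [newtonMatrix, Matrix.of_apply]
      split_ifs with h1 h2
      · exact absurd (h1.2.1.trans h2) hab
      all_goals simp

open scoped Matrix.Norms.Operator Kronecker

/-- The exponential of `u z` in the Newton bases of both variables. -/
def newtonExp (c : Fin n → κ) (c' : Fin n → κ') (u z : Fin n → ℂ) :
    Matrix (Fin n × Fin n) (Fin n × Fin n) ℂ :=
  NormedSpace.exp (bidiagonal c u ⊗ₖ bidiagonal c' z)

/-- The tensor products of columns of the Newton matrices are eigenvectors of the exponential. -/
theorem newtonExp_mul (c : Fin n → κ) (c' : Fin n → κ') (u z : Fin n → ℂ) :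
    newtonExp c c' u z * (newtonMatrix c u ⊗ₖ newtonMatrix c' z)
      = (newtonMatrix c u ⊗ₖ newtonMatrix c' z)
        * Matrix.diagonal fun p => Complex.exp (u p.1 * z p.2) := by
  have h : SemiconjBy (newtonMatrix c u ⊗ₖ newtonMatrix c' z)
      (Matrix.diagonal fun p : Fin n × Fin n => u p.1 * z p.2)
      (bidiagonal c u ⊗ₖ bidiagonal c' z) := by
    unfold SemiconjBy
    rw [← Matrix.diagonal_kronecker_diagonal, ← Matrix.mul_kronecker_mul,
      ← Matrix.mul_kronecker_mul, bidiagonal_mul_newtonMatrix, bidiagonal_mul_newtonMatrix]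
  have h2 : SemiconjBy (newtonMatrix c u ⊗ₖ newtonMatrix c' z)
      (NormedSpace.exp (Matrix.diagonal fun p : Fin n × Fin n => u p.1 * z p.2))
      (newtonExp c c' u z) := h.exp_right
  have h3 : NormedSpace.exp (Matrix.diagonal fun p : Fin n × Fin n => u p.1 * z p.2)
      = Matrix.diagonal (NormedSpace.exp fun p : Fin n × Fin n => u p.1 * z p.2) :=
    Matrix.exp_diagonal _
  rw [h3] at h2
  rw [← h2.eq]
  congr 2
  funext p
  rw [Pi.coe_exp, Complex.exp_eq_exp_ℂ]

/-- The confluent form of the matrix `φ(c_i, c'_j) e^{u_i z_j}`: the rows of the exponential that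
belong to the first elements of the classes, weighted by `φ`. -/
def confluent (φ : κ → κ' → ℂ) (c : Fin n → κ) (c' : Fin n → κ') (u z : Fin n → ℂ) :
    Matrix (Fin n) (Fin n) ℂ :=
  Matrix.of fun a a' => ∑ f : Fin n × Fin n,
    (if (∀ p, p < f.1 → c p ≠ c f.1) ∧ ∀ p, p < f.2 → c' p ≠ c' f.2
      then φ (c f.1) (c' f.2) else 0) * newtonExp c c' u z f (a, a')

theorem newtonMatrix_of_first {c : Fin n → κ} {f : Fin n} (h : ∀ p, p < f → c p ≠ c f)
    (x : Fin n → ℂ) (b : Fin n) : newtonMatrix c x f b = if c f = c b then 1 else 0 := by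
  simp only [newtonMatrix, Matrix.of_apply]
  congr 1
  refine Finset.prod_eq_one fun p _ => ?_
  rw [if_neg]
  exact fun h2 => h p h2.1 h2.2

/-- Every class of `c` has a unique first element. -/
theorem exists_first (c : Fin n → κ) (b : Fin n) :
    ∃ f, c f = c b ∧ (∀ p, p < f → c p ≠ c f) ∧
      ∀ g, c g = c b → (∀ p, p < g → c p ≠ c g) → g = f := by
  obtain ⟨f, hf⟩ := (Finset.univ.filter fun q => c q = c b).exists_minimal ⟨b, by simp⟩
  have h1 := hf.prop
  simp only [Finset.mem_filter, Finset.mem_univ, true_and] at h1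
  have h2 : ∀ p, c p = c b → f ≤ p := fun p hp => by
    rcases le_total f p with h | h
    · exact h
    · exact hf.le_of_le (by simpa using hp) h
  refine ⟨f, h1, fun p hp h => absurd (h2 p (h.trans h1)) hp.not_ge, fun g hg hg2 => ?_⟩
  rcases (h2 g hg).lt_or_eq with h | h
  · exact absurd (h1.trans hg.symm) (hg2 f h)
  · exact h.symm

/-- The confluent matrix, expressed in the bases of evaluations at the points of `u` and of `z`. -/
theorem transpose_mul_confluent_mul (φ : κ → κ' → ℂ) (c : Fin n → κ) (c' : Fin n → κ')
    (u z : Fin n → ℂ) :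
    (newtonMatrix c u)ᵀ * confluent φ c c' u z * newtonMatrix c' z
      = Matrix.of fun i j => φ (c i) (c' j) * Complex.exp (u i * z j) := by
  ext i j
  have h1 := newtonExp_mul c c' u z
  have h2 : ∀ f : Fin n × Fin n, ∑ a, ∑ a', newtonExp c c' u z f (a, a')
      * (newtonMatrix c u a i * newtonMatrix c' z a' j)
      = newtonMatrix c u f.1 i * newtonMatrix c' z f.2 j * Complex.exp (u i * z j) := by
    intro f
    have h3 := congrFun (congrFun h1 f) (i, j)
    rw [Matrix.mul_diagonal, Matrix.mul_apply, Fintype.sum_prod_type] at h3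
    exact h3
  have h4 : ((newtonMatrix c u)ᵀ * confluent φ c c' u z * newtonMatrix c' z) i j
      = ∑ f : Fin n × Fin n,
    (if (∀ p, p < f.1 → c p ≠ c f.1) ∧ ∀ p, p < f.2 → c' p ≠ c' f.2
      then φ (c f.1) (c' f.2) else 0) * ∑ a, ∑ a', newtonExp c c' u z f (a, a')
      * (newtonMatrix c u a i * newtonMatrix c' z a' j) := by
    simp only [Matrix.mul_apply, Matrix.transpose_apply, confluent, Matrix.of_apply,
      Finset.sum_mul, Finset.mul_sum]
    rw [Finset.sum_comm]
    symm
    rw [Finset.sum_comm]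
    refine Finset.sum_congr rfl fun a _ => ?_
    rw [Finset.sum_comm]
    refine Finset.sum_congr rfl fun a' _ => Finset.sum_congr rfl fun f _ => ?_
    ring
  rw [h4]
  simp only [h2, Matrix.of_apply]
  obtain ⟨f, hf1, hf2, hf3⟩ := exists_first c i
  obtain ⟨f', hf1', hf2', hf3'⟩ := exists_first c' j
  rw [Finset.sum_eq_single (f, f')]
  · rw [if_pos ⟨hf2, hf2'⟩, newtonMatrix_of_first hf2, newtonMatrix_of_first hf2', if_pos hf1,
      if_pos hf1', hf1, hf1']
    ring
  · rintro ⟨g, g'⟩ _ hg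
    by_cases h : (∀ p, p < g → c p ≠ c g) ∧ ∀ p, p < g' → c' p ≠ c' g'
    · rw [if_pos h, newtonMatrix_of_first h.1, newtonMatrix_of_first h.2]
      by_cases h5 : c g = c i
      · by_cases h6 : c' g' = c' j
        · exact absurd (Prod.ext (hf3 g h5 h.1) (hf3' g' h6 h.2)) hg
        · simp [h6]
      · simp [h5]
    · rw [if_neg h, zero_mul]
  · simp

theorem det_exp_eq (φ : κ → κ' → ℂ) (c : Fin n → κ) (c' : Fin n → κ') (u z : Fin n → ℂ) :
    (Matrix.of fun i j => φ (c i) (c' j) * Complex.exp (u i * z j)).det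
      = classVdm c u * (confluent φ c c' u z).det * classVdm c' z := by
  rw [← transpose_mul_confluent_mul, Matrix.det_mul, Matrix.det_mul, Matrix.det_transpose,
    det_newtonMatrix, det_newtonMatrix]

theorem continuous_bidiagonal (c : Fin n → κ) : Continuous fun x : Fin n → ℂ => bidiagonal c x := by
  unfold bidiagonal
  exact (continuous_id.matrix_diagonal).sub continuous_const

theorem continuous_newtonExp (c : Fin n → κ) (c' : Fin n → κ') :
    Continuous fun p : (Fin n → ℂ) × (Fin n → ℂ) => newtonExp c c' p.1 p.2 := by
  unfold newtonExp
  refine (NormedSpace.exp_continuous).comp ?_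
  refine continuous_matrix fun i j => ?_
  simp only [Matrix.kroneckerMap_apply]
  exact (((continuous_bidiagonal c).comp continuous_fst).matrix_elem _ _).mul
    (((continuous_bidiagonal c').comp continuous_snd).matrix_elem _ _)

theorem continuous_det_confluent (φ : κ → κ' → ℂ) (c : Fin n → κ) (c' : Fin n → κ') :
    Continuous fun p : (Fin n → ℂ) × (Fin n → ℂ) => (confluent φ c c' p.1 p.2).det := by
  refine Continuous.matrix_det (continuous_matrix fun a a' => ?_)
  simp only [confluent, Matrix.of_apply]
  exact continuous_finsetSum _ fun f _ =>
    continuous_const.mul ((continuous_newtonExp c c').matrix_elem _ _)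

theorem analyticOnNhd_newtonExp (c : Fin n → κ) (c' : Fin n → κ') (u : Fin n → ℂ)
    (f g : Fin n × Fin n) :
    AnalyticOnNhd ℂ (fun z : Fin n → ℂ => newtonExp c c' u z f g) Set.univ := by
  intro z _
  let M₀ := bidiagonal c u ⊗ₖ bidiagonal c' 0
  let ℓ : (Fin n → ℂ) →ₗ[ℂ] Matrix (Fin n × Fin n) (Fin n × Fin n) ℂ :=
    { toFun := fun z => bidiagonal c u ⊗ₖ Matrix.diagonal z
      map_add' := fun z w => by
        rw [← Matrix.kronecker_add, Matrix.diagonal_add]; rfl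
      map_smul' := fun a z => by
        rw [RingHom.id_apply, ← Matrix.kronecker_smul, Matrix.diagonal_smul] }
  have h1 : (fun z : Fin n → ℂ => bidiagonal c u ⊗ₖ bidiagonal c' z)
      = fun z => M₀ + LinearMap.toContinuousLinearMap ℓ z := by
    funext z
    change _ = bidiagonal c u ⊗ₖ bidiagonal c' 0 + bidiagonal c u ⊗ₖ Matrix.diagonal z
    rw [← Matrix.kronecker_add]
    congr 1
    unfold bidiagonal
    rw [show (Matrix.diagonal (0 : Fin n → ℂ)) = 0 from Matrix.diagonal_zero]
    abel
  let ev : Matrix (Fin n × Fin n) (Fin n × Fin n) ℂ →ₗ[ℂ] ℂ :=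
    { toFun := fun M => M f g
      map_add' := fun _ _ => rfl
      map_smul' := fun _ _ => rfl }
  have h2 : AnalyticAt ℂ (fun z : Fin n → ℂ => bidiagonal c u ⊗ₖ bidiagonal c' z) z := by
    rw [h1]
    exact analyticAt_const.add (ContinuousLinearMap.analyticAt _ _)
  have h3 : AnalyticAt ℂ (fun z : Fin n → ℂ => newtonExp c c' u z) z :=
    AnalyticAt.comp (f := fun z : Fin n → ℂ => bidiagonal c u ⊗ₖ bidiagonal c' z)
      (NormedSpace.exp_analytic (𝕂 := ℂ) _) h2
  exact AnalyticAt.comp (f := fun z : Fin n → ℂ => newtonExp c c' u z)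
    ((LinearMap.toContinuousLinearMap ev).analyticAt _) h3

theorem analyticOnNhd_det_confluent (φ : κ → κ' → ℂ) (c : Fin n → κ) (c' : Fin n → κ')
    (u : Fin n → ℂ) :
    AnalyticOnNhd ℂ (fun z : Fin n → ℂ => (confluent φ c c' u z).det) Set.univ := by
  simp only [Matrix.det_apply']
  refine Finset.analyticOnNhd_fun_sum _ fun σ _ => analyticOnNhd_const.mul ?_
  refine Finset.analyticOnNhd_fun_prod _ fun a _ => ?_
  simp only [confluent, Matrix.of_apply]
  exact Finset.analyticOnNhd_fun_sum _ fun f _ =>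
    analyticOnNhd_const.mul (analyticOnNhd_newtonExp c c' u _ _)

end Confluence

/-! ### The determinant formula for arbitrary nonzero eigenvalues -/

theorem vdm_comp_perm {R : Type*} [CommRing R] {n : ℕ} (x : Fin n → R) (σ : Equiv.Perm (Fin n)) :
    vdm (x ∘ σ) = (Equiv.Perm.sign σ : ℤ) * vdm x := by
  rw [← det_eq_vdm, ← det_eq_vdm, ← Matrix.det_permute]
  rfl

theorem chiDet_comp_perm {n : ℕ} (z : Fin n → ℂ) (L : Fin n → ZMod 2) (lam : Fin n → ℝ)
    (σ : Equiv.Perm (Fin n)) :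
    chiDet z L (lam ∘ σ) = (Equiv.Perm.sign σ : ℤ) * chiDet z L lam := by
  rw [chiDet, chiDet, ← Matrix.det_permute]
  rfl

theorem numerator_comp_perm {l n : ℕ} (z : Fin n → ℂ) (L : Fin n → ZMod 2) (lam : Fin l → ℝ)
    (σ : Equiv.Perm (Fin l)) :
    numerator z L (realDiag (lam ∘ σ)) = numerator z L (realDiag lam) := by
  obtain ⟨v, hv⟩ := exists_eq_conj_of_charpoly_eq (isHermitian_realDiag (lam ∘ σ))
    (isHermitian_realDiag lam) (by
      simp only [realDiag, Matrix.charpoly_diagonal]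
      exact Equiv.prod_comp σ fun i => Polynomial.X - Polynomial.C (lam i : ℂ))
  rw [hv, numerator_conj]

theorem exists_perm_strictAnti {n : ℕ} {lam : Fin n → ℝ} (h : Function.Injective lam) :
    ∃ σ : Equiv.Perm (Fin n), StrictAnti (lam ∘ σ) := by
  refine ⟨Tuple.sort fun i => -lam i, ?_⟩
  have h1 := (Tuple.monotone_sort fun i => -lam i).strictMono_of_injective
    ((neg_injective.comp h).comp (Equiv.injective _))
  intro i j hij
  have := h1 hij
  simp only [Function.comp_apply] at this ⊢
  linarith

theorem det_formula_of_injective {n : ℕ} {lam : Fin n → ℝ} (h : Function.Injective lam)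
    {z : Fin n → ℂ} (hz : z ∈ openDomain n) (L : Fin n → ZMod 2) :
    numerator z L (realDiag lam) * vdm z * (vdm lam : ℝ) = vdm (stair ℂ n) * chiDet z L lam := by
  obtain ⟨σ, hσ⟩ := exists_perm_strictAnti h
  have h1 := detFormula n _ hσ z hz L
  rw [numerator_comp_perm, vdm_comp_perm, chiDet_comp_perm] at h1
  have h2 : (((Equiv.Perm.sign σ : ℤ) : ℂ)) ≠ 0 := by
    rcases Int.units_eq_one_or (Equiv.Perm.sign σ) with h | h <;> simp [h]
  refine mul_left_cancel₀ h2 ?_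
  push_cast at h1
  linear_combination h1

theorem vdm_ne_zero_of_injective {n : ℕ} {lam : Fin n → ℝ} (h : Function.Injective lam) :
    vdm lam ≠ 0 := by
  refine Finset.prod_ne_zero_iff.2 fun i _ => Finset.prod_ne_zero_iff.2 fun j _ => ?_
  split_ifs with hij
  · exact sub_ne_zero.2 fun h2 => hij.ne (h h2)
  · exact one_ne_zero

/-- The divided difference of the exponential function. -/
def expSlope (x y : ℝ) : ℝ := Real.exp y * dslope Real.exp 0 (x - y)

theorem sub_mul_expSlope (x y : ℝ) : (x - y) * expSlope x y = Real.exp x - Real.exp y := by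
  have h := sub_smul_dslope Real.exp 0 (x - y)
  rw [sub_zero, smul_eq_mul, Real.exp_zero] at h
  have h2 : Real.exp x = Real.exp y * Real.exp (x - y) := by rw [← Real.exp_add]; congr 1; ring
  rw [expSlope, h2]
  linear_combination Real.exp y * h

theorem expSlope_ne_zero (x y : ℝ) : expSlope x y ≠ 0 := by
  intro h
  rcases eq_or_ne x y with rfl | hxy
  · simp [expSlope, dslope_same] at h
  · have := sub_mul_expSlope x y
    rw [h, mul_zero] at this
    exact hxy (Real.exp_injective (sub_eq_zero.1 this.symm))

theorem continuous_expSlope : Continuous fun p : ℝ × ℝ => expSlope p.1 p.2 := by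
  have h : Continuous (dslope Real.exp 0) := by
    rw [← continuousOn_univ, continuousOn_dslope univ_mem]
    exact ⟨Real.continuous_exp.continuousOn, Real.differentiableAt_exp⟩
  unfold expSlope
  fun_prop

/-- The sign with which a class of eigenvalues is labelled. -/
def boolSign (b : Bool) : ℝ := if b then 1 else -1

/-- The eigenvalues with the signs `c` and the logarithms `u`. -/
def signedExp {n : ℕ} (c : Fin n → Bool) (u : Fin n → ℝ) : Fin n → ℝ := fun i =>
  boolSign (c i) * Real.exp (u i)

theorem boolSign_ne_zero (b : Bool) : boolSign b ≠ 0 := by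
  unfold boolSign; split_ifs <;> norm_num

theorem signedExp_ne_zero {n : ℕ} (c : Fin n → Bool) (u : Fin n → ℝ) (i : Fin n) :
    signedExp c u i ≠ 0 := mul_ne_zero (boolSign_ne_zero _) (Real.exp_ne_zero _)

theorem continuous_signedExp {n : ℕ} (c : Fin n → Bool) : Continuous (signedExp c) := by
  unfold signedExp
  fun_prop

theorem signedExp_log {n : ℕ} {lam : Fin n → ℝ} (h : ∀ i, lam i ≠ 0) :
    signedExp (fun i => decide (0 < lam i)) (fun i => Real.log |lam i|) = lam := by
  funext i
  rw [signedExp, Real.exp_log (abs_pos.2 (h i)), boolSign]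
  rcases lt_or_gt_of_ne (h i) with h1 | h1
  · rw [if_neg (by simpa using h1.le), abs_of_neg h1]; ring
  · rw [if_pos (by simpa using h1), abs_of_pos h1]; ring

theorem chi_signedExp {n : ℕ} (c : Fin n → Bool) (u : Fin n → ℝ) (i : Fin n) (ε : ZMod 2) (w : ℂ) :
    chi ε w (signedExp c u i)
      = (signPow ε (boolSign (c i)) : ℂ) * Complex.exp ((u i : ℂ) * w) := by
  rw [signedExp, chi_mul, chi_of_pos _ _ (Real.exp_pos _), chi]
  have h1 : |boolSign (c i)| = 1 := by unfold boolSign; split_ifs <;> simp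
  rw [h1, Complex.ofReal_one, Complex.one_cpow, mul_one,
    Complex.cpow_def_of_ne_zero (by simp), ← Complex.ofReal_log (Real.exp_pos _).le, Real.log_exp]

/-- The factor of the Vandermonde product of the eigenvalues that does not vanish when eigenvalues
coincide. -/
def slopeProd {n : ℕ} (c : Fin n → Bool) (u : Fin n → ℝ) : ℝ :=
  ∏ a, ∏ p, if p < a then
    (if c p = c a then boolSign (c a) * expSlope (u p) (u a)
      else signedExp c u p - signedExp c u a) else 1

theorem slopeProd_ne_zero {n : ℕ} (c : Fin n → Bool) (u : Fin n → ℝ) : slopeProd c u ≠ 0 := by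
  refine Finset.prod_ne_zero_iff.2 fun a _ => Finset.prod_ne_zero_iff.2 fun p _ => ?_
  split_ifs with h1 h2
  · exact mul_ne_zero (boolSign_ne_zero _) (expSlope_ne_zero _ _)
  · have h3 := Real.exp_pos (u p)
    have h4 := Real.exp_pos (u a)
    unfold signedExp boolSign
    rcases hp : c p <;> rcases ha : c a
    · simp [hp, ha] at h2
    · simp only [Bool.false_eq_true, ↓reduceIte]; intro h; linarith
    · simp only [Bool.false_eq_true, ↓reduceIte]; intro h; linarith
    · simp [hp, ha] at h2
  · exact one_ne_zero

theorem continuous_slopeProd {n : ℕ} (c : Fin n → Bool) : Continuous (slopeProd c) := by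
  unfold slopeProd
  refine continuous_finsetProd _ fun a _ => continuous_finsetProd _ fun p _ => ?_
  split_ifs
  · have : Continuous fun u : Fin n → ℝ => expSlope (u p) (u a) :=
      continuous_expSlope.comp (by fun_prop : Continuous fun u : Fin n → ℝ => (u p, u a))
    exact continuous_const.mul this
  · have := continuous_signedExp c
    fun_prop
  · exact continuous_const

theorem vdm_signedExp {n : ℕ} (c : Fin n → Bool) (u : Fin n → ℝ) :
    ((vdm (signedExp c u) : ℝ) : ℂ) = classVdm c (fun i => (u i : ℂ)) * (slopeProd c u : ℝ) := by
  have h1 : vdm (signedExp c u)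
      = (∏ a, ∏ p, if p < a ∧ c p = c a then u p - u a else 1) * slopeProd c u := by
    unfold vdm slopeProd
    rw [Finset.prod_comm, ← Finset.prod_mul_distrib]
    refine Finset.prod_congr rfl fun a _ => ?_
    rw [← Finset.prod_mul_distrib]
    refine Finset.prod_congr rfl fun p _ => ?_
    by_cases h : p < a
    · by_cases h2 : c p = c a
      · simp only [h, h2, if_true, and_self]
        rw [signedExp, signedExp, h2]
        linear_combination -boolSign (c a) * sub_mul_expSlope (u p) (u a)
      · simp [h, h2]
    · simp [h]
  rw [h1, classVdm]
  push_cast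
  congr 1
  refine Finset.prod_congr rfl fun a _ => Finset.prod_congr rfl fun p _ => ?_
  split_ifs <;> simp

/-- The function `E(u, z)`, entire in `z`, that extends the numerator of the spherical function of
`diag(c_i e^{u_i})` times the product of the `z_p - z_a` with `L_p ≠ L_a`. -/
def entireExp {n : ℕ} (c : Fin n → Bool) (L : Fin n → ZMod 2) (u : Fin n → ℝ) (z : Fin n → ℂ) : ℂ :=
  vdm (stair ℂ n) * (confluent (fun b ε => (signPow ε (boolSign b) : ℂ)) c L
    (fun i => (u i : ℂ)) z).det / (slopeProd c u : ℝ)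

theorem continuous_entireExp {n : ℕ} (c : Fin n → Bool) (L : Fin n → ZMod 2) :
    Continuous fun p : (Fin n → ℝ) × (Fin n → ℂ) => entireExp c L p.1 p.2 := by
  unfold entireExp
  refine Continuous.div (continuous_const.mul ?_) ?_ fun p =>
    Complex.ofReal_ne_zero.2 (slopeProd_ne_zero c p.1)
  · have h := (continuous_det_confluent (fun b ε => (signPow ε (boolSign b) : ℂ)) c L).comp
      (by fun_prop : Continuous fun p : (Fin n → ℝ) × (Fin n → ℂ) => ((fun i => (p.1 i : ℂ)), p.2))
    exact h
  · exact Complex.continuous_ofReal.comp ((continuous_slopeProd c).comp continuous_fst)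

theorem analyticOnNhd_entireExp {n : ℕ} (c : Fin n → Bool) (L : Fin n → ZMod 2) (u : Fin n → ℝ) :
    AnalyticOnNhd ℂ (entireExp c L u) Set.univ := by
  unfold entireExp
  simp only [div_eq_mul_inv]
  exact (analyticOnNhd_const.mul (analyticOnNhd_det_confluent _ c L _)).mul analyticOnNhd_const

theorem entireExp_mul {n : ℕ} (c : Fin n → Bool) (L : Fin n → ZMod 2) (u : Fin n → ℝ)
    (z : Fin n → ℂ) :
    entireExp c L u z * classVdm L z * (vdm (signedExp c u) : ℝ)
      = vdm (stair ℂ n) * chiDet z L (signedExp c u) := by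
  have h := det_exp_eq (fun b ε => (signPow ε (boolSign b) : ℂ)) c L (fun i => (u i : ℂ)) z
  rw [chiDet]
  simp only [chi_signedExp]
  rw [h, vdm_signedExp, entireExp]
  have := Complex.ofReal_ne_zero.2 (slopeProd_ne_zero c u)
  field_simp

theorem dense_injective (n : ℕ) : Dense {u : Fin n → ℝ | Function.Injective u} := by
  intro u
  refine mem_closure_of_tendsto (f := fun t : ℝ => fun i : Fin n => u i + t * i) (b := 𝓝[≠] 0) ?_ ?_
  · have h : Continuous fun t : ℝ => fun i : Fin n => u i + t * i := by fun_prop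
    have h2 := h.tendsto 0
    simp only [zero_mul, add_zero] at h2
    exact h2.mono_left nhdsWithin_le_nhds
  · have h1 : ∀ i j : Fin n, i ≠ j → ∀ᶠ t : ℝ in 𝓝[≠] 0, u i + t * i ≠ u j + t * j := by
      intro i j hij
      have hne : ((j : ℝ) - i) ≠ 0 := sub_ne_zero.2 (by
        simpa [Fin.ext_iff, eq_comm] using hij)
      by_cases hu : u i = u j
      · filter_upwards [self_mem_nhdsWithin] with t ht h
        have ht : t ≠ 0 := ht
        have : t * ((j : ℝ) - i) = 0 := by linear_combination hu - h
        exact (mul_ne_zero ht hne) this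
      · refine Filter.Eventually.filter_mono nhdsWithin_le_nhds ?_
        have hc : Continuous fun t : ℝ => u i + t * i - (u j + t * j) := by fun_prop
        have := hc.continuousAt.eventually_ne (x := 0) (y := 0) (by simpa [sub_eq_zero] using hu)
        filter_upwards [this] with t ht h
        exact ht (sub_eq_zero.2 h)
    have h2 : ∀ᶠ t : ℝ in 𝓝[≠] 0, ∀ i j : Fin n, i ≠ j → u i + t * i ≠ u j + t * j := by
      simp only [eventually_all]
      exact h1
    filter_upwards [h2] with t ht i j hij
    by_contra hne
    exact ht i j hne hij

theorem injective_signedExp {n : ℕ} (c : Fin n → Bool) {u : Fin n → ℝ}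
    (h : Function.Injective u) : Function.Injective (signedExp c u) := by
  intro i j hij
  unfold signedExp boolSign at hij
  have h3 := Real.exp_pos (u i)
  have h4 := Real.exp_pos (u j)
  split_ifs at hij
  · exact h (Real.exp_injective (by linarith))
  · linarith
  · linarith
  · exact h (Real.exp_injective (by linarith))

theorem classVdm_ne_zero {n : ℕ} {κ : Type*} [DecidableEq κ] (c : Fin n → κ) {z : Fin n → ℂ}
    (hz : vdm z ≠ 0) : classVdm c z ≠ 0 := fun h => hz (by
  rw [← classVdm_mul_mixedVdm c, h, zero_mul])

theorem mixedVdm_ne_zero {n : ℕ} {κ : Type*} [DecidableEq κ] (c : Fin n → κ) {z : Fin n → ℂ}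
    (hz : vdm z ≠ 0) : mixedVdm c z ≠ 0 := fun h => hz (by
  rw [← classVdm_mul_mixedVdm c, h, mul_zero])

theorem continuous_numerator_realDiag {l n : ℕ} {z : Fin n → ℂ} (hz : z ∈ openDomain n)
    (L : Fin n → ZMod 2) : Continuous fun lam : Fin l → ℝ => numerator z L (realDiag lam) := by
  simp only [numerator_eq]
  have h := continuous_parametric_integral_of_continuous (μ := haarK l) (s := Set.univ)
    (f := fun (lam : Fin l → ℝ) (k : K l) => ∏ j : Fin n, chi (gap L j) (gap z j)
      (minor (j + 1) (k.1 * realDiag lam * k.1ᴴ))) ?_ isCompact_univ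
  · simpa using h
  · refine continuous_finsetProd _ fun j _ => (continuous_chi _ (hz j)).comp
      ((continuous_minor _).comp ?_)
    have h1 : Continuous fun p : (Fin l → ℝ) × K l => realDiag p.1 := by
      unfold realDiag
      refine Continuous.matrix_diagonal ?_
      fun_prop
    have h2 : Continuous fun p : (Fin l → ℝ) × K l => p.2.1 :=
      (continuous_coeK l).comp continuous_snd
    exact (h2.matrix_mul h1).matrix_mul h2.matrix_conjTranspose

theorem numerator_mul_mixedVdm_of_mem_openDomain {n : ℕ} (c : Fin n → Bool) (L : Fin n → ZMod 2)
    (u : Fin n → ℝ) {z : Fin n → ℂ} (hz : z ∈ openDomain n) :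
    numerator z L (realDiag (signedExp c u)) * mixedVdm L z = entireExp c L u z := by
  have h1 : Continuous fun u => numerator z L (realDiag (signedExp c u)) * mixedVdm L z :=
    ((continuous_numerator_realDiag hz L).comp (continuous_signedExp c)).mul continuous_const
  have h2 := (continuous_entireExp c L).comp
    (by fun_prop : Continuous fun u : Fin n → ℝ => (u, z))
  refine congrFun (Continuous.ext_on (dense_injective n) h1 h2 fun u hu => ?_) u
  simp only [Function.comp_apply]
  have h3 := injective_signedExp c hu
  have h4 := det_formula_of_injective h3 hz L
  rw [← entireExp_mul, ← classVdm_mul_mixedVdm L] at h4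
  have hv := vdm_ne_zero_of_mem_domain (openDomain_subset _ hz)
  have h5 := classVdm_ne_zero L hv
  have h6 := Complex.ofReal_ne_zero.2 (vdm_ne_zero_of_injective h3)
  generalize entireExp c L u z = E at h4 ⊢
  generalize ((vdm (signedExp c u) : ℝ) : ℂ) = V at h4 h6
  generalize numerator z L (realDiag (signedExp c u)) = N at h4 ⊢
  generalize classVdm L z = A at h4 h5
  refine mul_right_cancel₀ (mul_ne_zero h5 h6) ?_
  linear_combination h4

theorem entireExp_stair {n : ℕ} (c : Fin n → Bool) (u : Fin n → ℝ) :
    entireExp c (stair (ZMod 2) n) u (stair ℂ n) = mixedVdm (stair (ZMod 2) n) (stair ℂ n) := by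
  have h2 := (continuous_entireExp c (stair (ZMod 2) n)).comp
    (by fun_prop : Continuous fun u : Fin n → ℝ => (u, stair ℂ n))
  refine congrFun (Continuous.ext_on (dense_injective n) h2 continuous_const fun u hu => ?_) u
  simp only [Function.comp_apply]
  have h3 := injective_signedExp c hu
  have h4 := entireExp_mul c (stair (ZMod 2) n) u (stair ℂ n)
  rw [chiDet_stair (signedExp_ne_zero c u), ← classVdm_mul_mixedVdm (stair (ZMod 2) n)] at h4
  have h5 := classVdm_ne_zero (stair (ZMod 2) n)
    (vdm_ne_zero_of_mem_domain (stair_mem_domain n))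
  have h6 := Complex.ofReal_ne_zero.2 (vdm_ne_zero_of_injective h3)
  generalize entireExp c (stair (ZMod 2) n) u (stair ℂ n) = E at h4 ⊢
  generalize ((vdm (signedExp c u) : ℝ) : ℂ) = V at h4 h6
  generalize classVdm (stair (ZMod 2) n) (stair ℂ n) = A at h4 h5
  refine mul_right_cancel₀ (mul_ne_zero h5 h6) ?_
  linear_combination h4

theorem continuous_mixedVdm {n : ℕ} {κ : Type*} [DecidableEq κ] (c : Fin n → κ) :
    Continuous (mixedVdm c) := by
  unfold mixedVdm
  refine continuous_finsetProd _ fun a _ => continuous_finsetProd _ fun p _ => ?_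
  split_ifs <;> fun_prop

theorem ae_nonvanishingMinors_realDiag {n : ℕ} {lam : Fin n → ℝ} (h : ∀ i, lam i ≠ 0) :
    ∀ᵐ k ∂haarK n, NonvanishingMinors n (realDiag lam) k := by
  rw [← signedExp_log h]
  set c : Fin n → Bool := fun i => decide (0 < lam i)
  set u : Fin n → ℝ := fun i => Real.log |lam i|
  have hs := mixedVdm_ne_zero (stair (ZMod 2) n) (vdm_ne_zero_of_mem_domain (stair_mem_domain n))
  refine ae_nonvanishingMinors_of_tendsto ?_
  have h1 := ((continuous_mixedVdm (stair (ZMod 2) n)).tendsto _).comp (tendsto_shift (stair ℂ n))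
  have h2 := ((((continuous_entireExp c (stair (ZMod 2) n)).comp
    (Continuous.prodMk continuous_const continuous_id : Continuous fun z : Fin n → ℂ =>
      (u, z))).tendsto _).comp (tendsto_shift (stair ℂ n))).div h1 hs
  simp only [Function.comp_apply, entireExp_stair, div_self hs] at h2
  refine h2.congr' ?_
  filter_upwards [self_mem_nhdsWithin] with δ hδ
  have h3 := shift_mem_openDomain hδ (stair_mem_domain n)
  simp only [Pi.div_apply, Function.comp_apply]
  rw [← numerator_mul_mixedVdm_of_mem_openDomain c _ u h3, mul_div_cancel_right₀]
  exact mixedVdm_ne_zero _ (vdm_ne_zero_of_mem_domain (openDomain_subset _ h3))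

/-- The function, entire in `z`, that extends the numerator of the spherical function of
`diag(lam)` times the product of the `z_p - z_a` with `L_p ≠ L_a`. -/
def entireNumerator {n : ℕ} (lam : Fin n → ℝ) (L : Fin n → ZMod 2) : (Fin n → ℂ) → ℂ :=
  entireExp (fun i => decide (0 < lam i)) L (fun i => Real.log |lam i|)

/-- The determinant formula for arbitrary nonzero eigenvalues, which may coincide. -/
theorem numerator_mul_mixedVdm {n : ℕ} {lam : Fin n → ℝ} (h : ∀ i, lam i ≠ 0) (L : Fin n → ZMod 2)
    {z : Fin n → ℂ} (hz : z ∈ domain n) :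
    numerator z L (realDiag lam) * mixedVdm L z = entireNumerator lam L z := by
  have h1 := (tendsto_numerator_shift (ae_nonvanishingMinors_realDiag h) hz L).mul
    (((continuous_mixedVdm L).tendsto _).comp (tendsto_shift z))
  have h2 := (((continuous_entireExp (fun i => decide (0 < lam i)) L).comp
    (Continuous.prodMk continuous_const continuous_id : Continuous fun z : Fin n → ℂ =>
      ((fun i => Real.log |lam i|), z))).tendsto _).comp (tendsto_shift z)
  refine tendsto_nhds_unique (h1.congr' ?_) h2
  filter_upwards [self_mem_nhdsWithin] with δ hδ
  have h3 := numerator_mul_mixedVdm_of_mem_openDomain (fun i => decide (0 < lam i)) L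
    (fun i => Real.log |lam i|) (shift_mem_openDomain hδ hz)
  rw [signedExp_log h] at h3
  exact h3

theorem analyticOnNhd_entireNumerator {n : ℕ} (lam : Fin n → ℝ) (L : Fin n → ZMod 2) :
    AnalyticOnNhd ℂ (entireNumerator lam L) Set.univ := analyticOnNhd_entireExp _ _ _

/-! ### Spherical functions through the nonzero eigenvalues -/

theorem realDiag_append_zero {n d : ℕ} (lam : Fin n → ℝ) :
    realDiag (Fin.append lam (0 : Fin d → ℝ))
      = proj (n + d) n * realDiag lam * proj n (n + d) := by
  ext a b
  simp only [realDiag, Matrix.mul_apply, proj, Matrix.of_apply, Matrix.diagonal_apply]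
  induction a using Fin.addCases with
  | left a =>
    rw [Finset.sum_eq_single a]
    · induction b using Fin.addCases with
      | left b =>
        by_cases hab : a = b
        · simp [hab]
        · have h1 : (a : ℕ) ≠ b := fun h => hab (Fin.ext h)
          simp [hab, h1]
      | right b =>
        have h1 : (a : ℕ) ≠ n + b := by omega
        have h2 : Fin.castAdd d a ≠ Fin.natAdd n b := fun h =>
          h1 (by simpa using congrArg Fin.val h)
        simp [h1, h2]
    · intro c _ hc
      have h1 : (a : ℕ) ≠ c := fun h => hc (Fin.ext h.symm)
      simp [h1]
    · simp
  | right a =>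
    rw [Finset.sum_eq_zero]
    · by_cases hb : Fin.natAdd n a = b
      · simp [← hb]
      · simp [hb]
    · intro c _
      have h1 : n + (a : ℕ) ≠ (c : ℕ) := by omega
      simp [h1]

/-- `lam` lists the nonzero eigenvalues of the matrix `x`. -/
def HasSpectrum {l n : ℕ} (x : Matrix (Fin l) (Fin l) ℂ) (lam : Fin n → ℝ) : Prop :=
  (∀ i, lam i ≠ 0) ∧ ∃ w : K l, x = w.1 * (proj l n * realDiag lam * proj n l) * w.1ᴴ

theorem le_of_mem_HSet {l n : ℕ} {x : Matrix (Fin l) (Fin l) ℂ} (hx : x ∈ HSet l n) : n ≤ l := by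
  rw [← hx.2]
  simpa using Matrix.rank_le_width x

theorem exists_hasSpectrum {l n : ℕ} {x : Matrix (Fin l) (Fin l) ℂ} (hx : x ∈ HSet l n) :
    ∃ lam : Fin n → ℝ, HasSpectrum x lam := by
  obtain ⟨d, rfl⟩ := Nat.exists_eq_add_of_le (le_of_mem_HSet hx)
  have hH := hx.1
  have hcard : Fintype.card {i // hH.eigenvalues i ≠ 0} = n := by
    rw [← hH.rank_eq_card_non_zero_eigs, hx.2]
  have hcard2 : Fintype.card {i // ¬ hH.eigenvalues i ≠ 0} = d := by
    have h := Fintype.card_subtype_compl fun i => hH.eigenvalues i ≠ 0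
    rw [hcard, Fintype.card_fin] at h
    omega
  let e1 := Fintype.equivFinOfCardEq hcard
  let e2 := Fintype.equivFinOfCardEq hcard2
  let σ : Fin (n + d) ≃ Fin (n + d) := finSumFinEquiv.symm.trans
    ((Equiv.sumCongr e1.symm e2.symm).trans (Equiv.sumCompl fun i => hH.eigenvalues i ≠ 0))
  have h1 : ∀ i, σ (Fin.castAdd d i) = (e1.symm i).1 := fun i => by
    simp [σ]
  have h2 : ∀ i, σ (Fin.natAdd n i) = (e2.symm i).1 := fun i => by
    simp [σ]
  refine ⟨fun i => hH.eigenvalues (e1.symm i).1, fun i => (e1.symm i).2, ?_⟩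
  rw [← realDiag_append_zero]
  refine exists_eq_conj_of_charpoly_eq hH (isHermitian_realDiag _) ?_
  have h3 : Fin.append (fun i => hH.eigenvalues (e1.symm i).1) (0 : Fin d → ℝ)
      = hH.eigenvalues ∘ σ := by
    funext i
    induction i using Fin.addCases with
    | left i => simp [h1]
    | right i =>
      have := (e2.symm i).2
      simp only [ne_eq, not_not] at this
      simp [h2, this]
  rw [h3, hH.charpoly_eq, realDiag, Matrix.charpoly_diagonal]
  exact (Equiv.prod_comp σ fun i => Polynomial.X - Polynomial.C (hH.eigenvalues i : ℂ)).symm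

theorem ae_nonvanishingMinors_proj {l n : ℕ} (h : n ≤ l) :
    ∀ᵐ k ∂haarK l, NonvanishingMinors n (proj l n * proj n l) k := by
  refine ae_nonvanishingMinors_of_tendsto ?_
  simp only [← normalization_eq]
  exact tendsto_normalization_shift h

/-- The spherical function depends only on the nonzero eigenvalues of its argument. -/
theorem HasSpectrum.numerator_eq {l n : ℕ} (h : n ≤ l) {x : Matrix (Fin l) (Fin l) ℂ}
    {lam : Fin n → ℝ} (hx : HasSpectrum x lam) {z : Fin n → ℂ} (hz : z ∈ domain n)
    (L : Fin n → ZMod 2) :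
    numerator z L x = normalization l z * numerator z L (realDiag lam) := by
  obtain ⟨-, w, rfl⟩ := hx
  rw [numerator_conj, numerator_embed h le_rfl hz L _ (Or.inr (ae_nonvanishingMinors_proj h)),
    normalization_eq]

theorem ae_nonvanishingMinors {l n : ℕ} {x : Matrix (Fin l) (Fin l) ℂ} (hx : x ∈ HSet l n) :
    ∀ᵐ k ∂haarK l, NonvanishingMinors n x k := by
  obtain ⟨lam, hlam⟩ := exists_hasSpectrum hx
  have h := le_of_mem_HSet hx
  refine ae_nonvanishingMinors_of_tendsto ?_
  have h1 := (tendsto_normalization_shift h).mul (tendsto_numerator_shift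
    (ae_nonvanishingMinors_realDiag hlam.1) (stair_mem_domain n) (stair (ZMod 2) n))
  rw [numerator_stair, mul_one] at h1
  refine h1.congr' ?_
  filter_upwards [self_mem_nhdsWithin] with δ hδ
  exact (hlam.numerator_eq h (openDomain_subset _
    (shift_mem_openDomain hδ (stair_mem_domain n))) _).symm

theorem HasSpectrum.div_eq {l n : ℕ} (h : n ≤ l) {x : Matrix (Fin l) (Fin l) ℂ}
    {lam : Fin n → ℝ} (hx : HasSpectrum x lam) {z : Fin n → ℂ} (hz : z ∈ domain n)
    (L : Fin n → ZMod 2) :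
    numerator z L x / normalization l z = numerator z L (realDiag lam) := by
  rw [hx.numerator_eq h hz, mul_div_cancel_left₀ _ (normalization_ne_zero h hz)]

theorem NonvanishingMinors.mono {l n n' : ℕ} (h : n ≤ n') {x : Matrix (Fin l) (Fin l) ℂ} {k : K l}
    (hk : NonvanishingMinors n' x k) : NonvanishingMinors n x k := fun j =>
  hk ⟨j, j.2.trans_le h⟩

/-! ### Values of meromorphic continuations -/

theorem ContinuesTo.congr {n : ℕ} {D : Set (Fin n → ℂ)} {f g : (Fin n → ℂ) → ℂ} {s : Fin n → ℂ}
    {v : ℂ} (h : ContinuesTo D f s v) (hfg : ∀ z ∈ D, f z = g z) : ContinuesTo D g s v := by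
  obtain ⟨P, Q, hP, hQ, hf, hs, hPs⟩ := h
  exact ⟨P, Q, hP, hQ, fun z hz => by rw [← hfg z hz, hf z hz], hs, hPs⟩

theorem ContinuesTo.mul {n : ℕ} {D : Set (Fin n → ℂ)} {f g : (Fin n → ℂ) → ℂ} {s : Fin n → ℂ}
    {v w : ℂ} (h : ContinuesTo D f s v) (h' : ContinuesTo D g s w) :
    ContinuesTo D (fun z => f z * g z) s (v * w) := by
  obtain ⟨P, Q, hP, hQ, hf, hs, hPs⟩ := h
  obtain ⟨P', Q', hP', hQ', hf', hs', hPs'⟩ := h'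
  refine ⟨fun z => P z * P' z, fun z => Q z * Q' z, hP.mul hP', hQ.mul hQ', fun z hz => ?_,
    mul_ne_zero hs hs', ?_⟩
  · simp only [hf z hz, hf' z hz]; ring
  · simp only [hPs, hPs']; ring

theorem ContinuesTo.continuation_eq {n : ℕ} {f : (Fin n → ℂ) → ℂ}
    {s : Fin n → ℂ} {v : ℂ} (h : ContinuesTo (domain n) f s v) :
    continuation (domain n) f s = v := by
  unfold continuation
  split_ifs with h1 h2
  · obtain ⟨P, Q, hP, hQ, hf, hs, hPs⟩ := h
    exact mul_left_cancel₀ hs (by rw [← hf s h1, hPs])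
  · exact h2.choose_spec.unique (interior_domain_nonempty n) h
  · exact absurd ⟨v, h⟩ h2

theorem ContinuesTo.continuation {n : ℕ} {f : (Fin n → ℂ) → ℂ}
    {s : Fin n → ℂ} {v : ℂ} (h : ContinuesTo (domain n) f s v) :
    ContinuesTo (domain n) f s (continuation (domain n) f s) := by
  rwa [h.continuation_eq]

theorem continuation_of_mem {n : ℕ} {f : (Fin n → ℂ) → ℂ} {s : Fin n → ℂ} (hs : s ∈ domain n) :
    continuation (domain n) f s = f s := if_pos hs

theorem analyticOnNhd_ext {r : ℕ} (d : ℕ) :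
    AnalyticOnNhd ℂ (fun s : Fin r → ℂ => ext d s) Set.univ := by
  intro s _
  rw [analyticAt_pi_iff]
  intro j
  induction j using Fin.addCases with
  | left j =>
    simp only [ext, Fin.append_left]
    exact ((ContinuousLinearMap.proj (R := ℂ) (φ := fun _ : Fin r => ℂ) j).analyticAt s).add
      analyticAt_const
  | right j =>
    simp only [ext, Fin.append_right]
    exact analyticAt_const

theorem ContinuesTo.comp_ext {r d : ℕ} {f : (Fin (r + d) → ℂ) → ℂ} {s : Fin r → ℂ} {v : ℂ}
    (h : ContinuesTo (domain (r + d)) f (ext d s) v) :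
    ContinuesTo (domain r) (fun z => f (ext d z)) s v := by
  obtain ⟨P, Q, hP, hQ, hf, hs, hPs⟩ := h
  refine ⟨fun z => P (ext d z), fun z => Q (ext d z), ?_, ?_,
    fun z hz => hf _ (ext_mem_domain d hz), hs, hPs⟩
  · exact fun z hz => AnalyticAt.comp (f := fun z : Fin r → ℂ => ext d z) (hP _ trivial)
      (analyticOnNhd_ext d z hz)
  · exact fun z hz => AnalyticAt.comp (f := fun z : Fin r → ℂ => ext d z) (hQ _ trivial)
      (analyticOnNhd_ext d z hz)

theorem analyticAt_coord {n : ℕ} (j : Fin n) (z : Fin n → ℂ) :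
    AnalyticAt ℂ (fun z : Fin n → ℂ => z j) z :=
  (ContinuousLinearMap.proj (R := ℂ) (φ := fun _ : Fin n => ℂ) j).analyticAt z

theorem analyticOnNhd_mixedVdm {n : ℕ} {κ : Type*} [DecidableEq κ] (c : Fin n → κ) :
    AnalyticOnNhd ℂ (mixedVdm c) Set.univ := by
  unfold mixedVdm
  refine Finset.analyticOnNhd_fun_prod _ fun a _ => Finset.analyticOnNhd_fun_prod _ fun p _ => ?_
  split_ifs
  · exact fun z _ => (analyticAt_coord p z).sub (analyticAt_coord a z)
  · exact analyticOnNhd_const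

theorem mixedVdm_ne_zero_iff {n : ℕ} {κ : Type*} [DecidableEq κ] {c : Fin n → κ} {s : Fin n → ℂ} :
    mixedVdm c s ≠ 0 ↔ ∀ b b', s b = s b' → c b = c b' := by
  unfold mixedVdm
  simp only [Finset.prod_ne_zero_iff, Finset.mem_univ, true_imp_iff]
  constructor
  · intro h b b' hs
    by_contra hc
    rcases lt_trichotomy b b' with h1 | h1 | h1
    · have := h b' b
      rw [if_pos ⟨h1, hc⟩, hs, sub_self] at this
      exact this rfl
    · exact hc (by rw [h1])
    · have := h b b'
      rw [if_pos ⟨h1, fun h2 => hc h2.symm⟩, hs, sub_self] at this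
      exact this rfl
  · intro h a p
    split_ifs with h1
    · exact sub_ne_zero.2 fun h2 => h1.2 (h _ _ h2)
    · exact one_ne_zero

theorem mixedVdm_zero_ne_zero {n : ℕ} (s : Fin n → ℂ) : mixedVdm (0 : Fin n → ZMod 2) s ≠ 0 :=
  mixedVdm_ne_zero_iff.2 fun _ _ _ => rfl

theorem analyticOnNhd_normDen (l n : ℕ) :
    AnalyticOnNhd ℂ (fun z : Fin n → ℂ => normDen l z) Set.univ := by
  unfold normDen
  refine Finset.analyticOnNhd_fun_prod _ fun i _ => Finset.analyticOnNhd_fun_prod _ fun j _ => ?_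
  exact fun z _ => ((analyticAt_coord j z).add analyticAt_const).add analyticAt_const

theorem continuesTo_C {l n : ℕ} (h : n ≤ l) {s : Fin n → ℂ} (hs : normDen l s ≠ 0) :
    ContinuesTo (domain n) (normalization l) s (C l n s) := by
  have h1 : ContinuesTo (domain n) (normalization l) s (normDen l (stair ℂ n) / normDen l s) :=
    ⟨fun _ => normDen l (stair ℂ n), normDen l, analyticOnNhd_const, analyticOnNhd_normDen l n,
      fun z hz => by rw [mul_comm, normalization_mul_normDen h hz], hs,
      (mul_div_cancel₀ _ hs).symm⟩
  exact h1.continuation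

theorem normDen_ext_ne_zero {m r d : ℕ} {s : Fin r → ℂ} (hs : NormRegular m d s) :
    normDen m (ext d s) ≠ 0 := by
  refine Finset.prod_ne_zero_iff.2 fun i hi => Finset.prod_ne_zero_iff.2 fun j _ => ?_
  have hi := Finset.mem_range.1 hi
  induction j using Fin.addCases with
  | left j =>
    rw [ext, Fin.append_left]
    intro h
    refine hs j (d + 1 + i) (by omega) (by omega) ?_
    push_cast
    linear_combination h
  | right j =>
    rw [ext, Fin.append_right, stair]
    exact_mod_cast (by omega : ((Fin.rev j : Fin d) : ℕ) + 1 + i ≠ 0)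

/-! ### Semidefinite matrices -/

/-- The sign by which the numerator changes when a positive semidefinite matrix is negated. -/
def negSign {n : ℕ} (L : Fin n → ZMod 2) : ℝ :=
  ∏ j : Fin n, signPow (gap L j) ((-1) ^ ((j : ℕ) + 1))

theorem signPow_mul_self (ε : ZMod 2) {t : ℝ} (ht : t ≠ 0) : signPow ε t * signPow ε t = 1 := by
  rw [← signPow_mul, signPow_of_pos ε (mul_self_pos.2 ht)]

theorem negSign_ne_zero {n : ℕ} (L : Fin n → ZMod 2) : negSign L ≠ 0 :=
  Finset.prod_ne_zero_iff.2 fun j _ h => by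
    have := signPow_mul_self (gap L j) (t := (-1) ^ ((j : ℕ) + 1)) (by simp)
    rw [h] at this
    simp at this

theorem minor_neg {l j : ℕ} (x : Matrix (Fin l) (Fin l) ℂ) :
    minor j (-x) = (-1) ^ j * minor j x := by
  unfold minor
  rw [Matrix.mul_neg, Matrix.neg_mul, Matrix.det_neg, Fintype.card_fin]
  have : ((-1 : ℂ)) ^ j = (((-1 : ℝ) ^ j : ℝ) : ℂ) := by push_cast; rfl
  rw [this, Complex.re_ofReal_mul]

/-- On semidefinite matrices the parameter `L` matters only through a sign. The sign is the same
for all congruent matrices. -/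
theorem exists_numerator_eq_mul {l n : ℕ} {x : Matrix (Fin l) (Fin l) ℂ}
    (hx : x.PosSemidef ∨ (-x).PosSemidef) (L L' : Fin n → ZMod 2) :
    ∃ η : ℂ, η ≠ 0 ∧ ∀ (l' : ℕ) (B : Matrix (Fin l') (Fin l) ℂ),
      (∀ᵐ k ∂haarK l', NonvanishingMinors n (B * x * Bᴴ) k) → ∀ z : Fin n → ℂ,
        numerator z L (B * x * Bᴴ) = η * numerator z L' (B * x * Bᴴ) := by
  rcases hx with hx | hx
  · refine ⟨1, one_ne_zero, fun l' B hB z => ?_⟩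
    rw [one_mul, numerator_eq, numerator_eq]
    refine integral_congr_ae ?_
    filter_upwards [hB] with k hk
    refine Finset.prod_congr rfl fun j _ => ?_
    have h1 : 0 < minor (j + 1) (k.1 * (B * x * Bᴴ) * k.1ᴴ) := (minor_nonneg
      ((hx.mul_mul_conjTranspose_same B).mul_mul_conjTranspose_same k.1)).lt_of_ne (hk j).symm
    rw [chi_of_pos _ _ h1, chi_of_pos _ _ h1]
  · refine ⟨(negSign L * negSign L' : ℝ), Complex.ofReal_ne_zero.2
      (mul_ne_zero (negSign_ne_zero L) (negSign_ne_zero L')), fun l' B hB z => ?_⟩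
    rw [numerator_eq, numerator_eq, ← integral_const_mul]
    refine integral_congr_ae ?_
    filter_upwards [hB] with k hk
    rw [negSign, negSign, ← Finset.prod_mul_distrib, Complex.ofReal_prod,
      ← Finset.prod_mul_distrib]
    refine Finset.prod_congr rfl fun j _ => ?_
    have h0 : k.1 * (B * x * Bᴴ) * k.1ᴴ = -(k.1 * (B * (-x) * Bᴴ) * k.1ᴴ) := by
      simp
    have h1 : 0 < minor (j + 1) (k.1 * (B * (-x) * Bᴴ) * k.1ᴴ) := by
      refine (minor_nonneg
        ((hx.mul_mul_conjTranspose_same B).mul_mul_conjTranspose_same k.1)).lt_of_ne fun h => ?_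
      refine hk j ?_
      rw [h0, minor_neg, ← h, mul_zero]
    rw [h0, minor_neg]
    generalize minor (j + 1) (k.1 * (B * (-x) * Bᴴ) * k.1ᴴ) = t at h1
    rw [chi_mul, chi_mul, chi_of_pos _ _ h1, chi_of_pos _ _ h1]
    have h2 : ∀ (ε : ZMod 2) (w : ℂ), chi ε w ((-1) ^ ((j : ℕ) + 1))
        = (signPow ε ((-1) ^ ((j : ℕ) + 1)) : ℂ) := fun ε w => by
      rw [chi]; simp
    have h3 := signPow_mul_self (gap L' j) (t := (-1) ^ ((j : ℕ) + 1)) (by simp)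
    have h4 : ((signPow (gap L' j) ((-1) ^ ((j : ℕ) + 1)) : ℝ) : ℂ)
        * (signPow (gap L' j) ((-1) ^ ((j : ℕ) + 1)) : ℝ) = 1 := by exact_mod_cast h3
    rw [h2, h2]
    push_cast
    linear_combination (-(signPow (gap L j) ((-1) ^ ((j : ℕ) + 1)) : ℂ) * (t : ℂ) ^ gap z j) * h4

theorem continuesTo_of_hasSpectrum {l n : ℕ} (h : n ≤ l) {x : Matrix (Fin l) (Fin l) ℂ}
    {lam : Fin n → ℝ} (hx : HasSpectrum x lam) {s : Fin n → ℂ} {L : Fin n → ZMod 2}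
    (hs : mixedVdm L s ≠ 0) :
    ContinuesTo (domain n) (fun z => numerator z L x / normalization l z) s
      (entireNumerator lam L s / mixedVdm L s) :=
  ⟨entireNumerator lam L, mixedVdm L, analyticOnNhd_entireNumerator lam L, analyticOnNhd_mixedVdm L,
    fun z hz => by
      simp only [hx.div_eq h hz]
      rw [mul_comm, numerator_mul_mixedVdm hx.1 L hz], hs,
    (mul_div_cancel₀ _ hs).symm⟩

theorem continuesTo_const {n : ℕ} (D : Set (Fin n → ℂ)) (s : Fin n → ℂ) (a : ℂ) :
    ContinuesTo D (fun _ => a) s a :=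
  ⟨fun _ => a, fun _ => 1, analyticOnNhd_const, analyticOnNhd_const, fun _ _ => by simp,
    one_ne_zero, by simp⟩

/-- The function `Φ` is regular away from its singular hyperplanes. -/
theorem continuesTo_Φ {l n : ℕ} {x : Matrix (Fin l) (Fin l) ℂ} (hx : x ∈ HSet l n)
    {s : Fin n → ℂ} {L : Fin n → ZMod 2} (hs : PhiRegular s L x) :
    ContinuesTo (domain n) (fun z => numerator z L x / normalization l z) s (Φ s L x) := by
  obtain ⟨lam, hlam⟩ := exists_hasSpectrum hx
  have h := le_of_mem_HSet hx
  suffices hv : ∃ v, ContinuesTo (domain n) (fun z => numerator z L x / normalization l z) s v by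
    obtain ⟨v, hv⟩ := hv
    exact hv.continuation
  have h1 : (x.PosSemidef ∨ (-x).PosSemidef) →
      ∃ v, ContinuesTo (domain n) (fun z => numerator z L x / normalization l z) s v := by
    intro hps
    obtain ⟨η, -, hη⟩ := exists_numerator_eq_mul hps L 0
    have h2 := hη l 1 (by simpa using ae_nonvanishingMinors hx)
    simp only [Matrix.one_mul, Matrix.conjTranspose_one, Matrix.mul_one] at h2
    refine ⟨_, ((continuesTo_const _ s η).mul
      (continuesTo_of_hasSpectrum h hlam (mixedVdm_zero_ne_zero s))).congr fun z _ => ?_⟩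
    simp only [h2]
    ring
  rcases hs with hs | hs | hs
  · exact h1 (Or.inl hs)
  · exact h1 (Or.inr hs)
  · exact ⟨_, continuesTo_of_hasSpectrum h hlam (mixedVdm_ne_zero_iff.2 hs)⟩

/-! ### The integral formula on the domain of convergence -/

section Domain

variable {l m r : ℕ} {g : Matrix (Fin l) (Fin m) ℂ} {x : Matrix (Fin m) (Fin m) ℂ}

/-- For almost all `k` the matrix `g k x k^* g^*` has the largest possible rank. -/
theorem ae_mem_HSet (hm : r ≤ m) (hxH : x.IsHermitian)
    (hg : ∀ᵐ k ∂haarK l, NonvanishingMinors r (g * gᴴ) k)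
    (hx : ∀ᵐ k ∂haarK m, NonvanishingMinors r x k)
    (hrank : ∀ k : K m, (g * k.1 * x * k.1ᴴ * gᴴ).rank ≤ r) :
    ∀ᵐ k : K m ∂haarK m, g * k.1 * x * k.1ᴴ * gᴴ ∈ HSet l r := by
  have hherm : ∀ k : K m, (g * k.1 * x * k.1ᴴ * gᴴ).IsHermitian := fun k => by
    have := isHermitian_mul_mul_conjTranspose (g * k.1) hxH
    rwa [Matrix.conjTranspose_mul, ← Matrix.mul_assoc] at this
  rcases Nat.eq_zero_or_pos r with rfl | hr
  · exact Eventually.of_forall fun k => ⟨hherm k, Nat.le_zero.1 (hrank k)⟩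
  obtain ⟨k', hk'⟩ := hg.exists
  obtain ⟨u, hu⟩ := exists_minor_conj_eq hm (k'.1 * g)
  have h1 := (measurePreserving_mul_left (haarK m) u).quasiMeasurePreserving.ae hx
  filter_upwards [h1] with k hk
  refine ⟨hherm k, le_antisymm (hrank k) ?_⟩
  have h2 := hu (k.1 * x * k.1ᴴ) r le_rfl
  have h3 := hk' ⟨r - 1, by omega⟩
  have h4 := hk ⟨r - 1, by omega⟩
  simp only [Nat.sub_add_cancel hr] at h3 h4
  have h5 : minor r (k'.1 * g * (k'.1 * g)ᴴ) ≠ 0 := by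
    rw [Matrix.conjTranspose_mul]
    simpa only [Matrix.mul_assoc] using h3
  have h6 : minor r (u.1 * (k.1 * x * k.1ᴴ) * u.1ᴴ) ≠ 0 := by
    have h7 : (u * k).1 = u.1 * k.1 := rfl
    rw [h7, Matrix.conjTranspose_mul] at h4
    simpa only [Matrix.mul_assoc] using h4
  have h8 : minor r (k'.1 * g * (k.1 * x * k.1ᴴ) * (k'.1 * g)ᴴ) ≠ 0 := by
    rw [h2]; exact mul_ne_zero h5 h6
  have h9 : (proj r l * (k'.1 * (g * k.1 * x * k.1ᴴ * gᴴ) * k'.1ᴴ) * proj l r).det ≠ 0 := by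
    intro h
    refine h8 ?_
    rw [Matrix.conjTranspose_mul]
    unfold minor
    simp only [Matrix.mul_assoc] at h ⊢
    rw [h, Complex.zero_re]
  have h10 := Matrix.rank_of_isUnit _ ((Matrix.isUnit_iff_isUnit_det _).2 (isUnit_iff_ne_zero.2 h9))
  rw [Fintype.card_fin] at h10
  calc r = _ := h10.symm
    _ ≤ _ := Matrix.rank_mul_le_left _ _
    _ ≤ _ := Matrix.rank_mul_le_right _ _
    _ ≤ _ := Matrix.rank_mul_le_left _ _
    _ ≤ _ := Matrix.rank_mul_le_right _ _

theorem integrable_numerator {z : Fin r → ℂ} (hz : z ∈ domain r) (L : Fin r → ZMod 2)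
    (g : Matrix (Fin l) (Fin m) ℂ) (x : Matrix (Fin m) (Fin m) ℂ) :
    Integrable (fun k : K m => numerator z L (g * k.1 * x * k.1ᴴ * gᴴ)) (haarK m) := by
  have h := integrable_prod_chi ((haarK m).prod (haarK l)) (gap L) (w := gap z) hz
    (f := fun j p => minor (j + 1) (p.2.1 * (g * p.1.1 * x * p.1.1ᴴ * gᴴ) * p.2.1ᴴ)) fun j => by
      refine (continuous_minor _).comp ?_
      have h1 : Continuous fun p : K m × K l => p.1.1 := (continuous_coeK m).comp continuous_fst
      have h2 : Continuous fun p : K m × K l => p.2.1 := (continuous_coeK l).comp continuous_snd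
      exact (h2.matrix_mul ((((continuous_const.matrix_mul h1).matrix_mul
        continuous_const).matrix_mul h1.matrix_conjTranspose).matrix_mul
          continuous_const)).matrix_mul h2.matrix_conjTranspose
  exact h.integral_prod_left

theorem integral_numerator_div (hm : r ≤ m)
    (hg : ∀ᵐ k ∂haarK l, NonvanishingMinors r (g * gᴴ) k)
    {z : Fin r → ℂ} (hz : z ∈ domain r) (L : Fin r → ZMod 2) :
    ∫ k : K m, numerator z L (g * k.1 * x * k.1ᴴ * gᴴ) / normalization l z ∂haarK m
      = numerator z (stair (ZMod 2) r) (g * gᴴ) * numerator z L x / normalization l z := by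
  rw [integral_div, integral_numerator hm hz L g x (Or.inr hg)
    fun k j => minor_conj_gram_nonneg g k _]

end Domain

/-! ### A bound by divided differences -/

/-- The function `f` has `k` continuous derivatives, and `f` and these are bounded by `A` on
`[-M, M]`. -/
def SmoothBound (M A : ℝ) : ℕ → (ℝ → ℂ) → Prop
  | 0, f => Continuous f ∧ ∀ t, |t| ≤ M → ‖f t‖ ≤ A
  | k + 1, f => (Continuous f ∧ ∀ t, |t| ≤ M → ‖f t‖ ≤ A) ∧
      ∃ f', (∀ t, HasDerivAt f (f' t) t) ∧ SmoothBound M A k f'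

/-- The iterated divided differences of `f` of order at most `k` are bounded by `A` on
`[-M, M]`. -/
def DividedBound (M A : ℝ) : ℕ → (ℝ → ℂ) → Prop
  | 0, f => ∀ t, |t| ≤ M → ‖f t‖ ≤ A
  | k + 1, f => (∀ t, |t| ≤ M → ‖f t‖ ≤ A) ∧
      ∀ a, |a| ≤ M → ∃ g, DividedBound M A k g ∧ ∀ t, f t - f a = (t - a) * g t

theorem SmoothBound.continuous {M A : ℝ} {k : ℕ} {f : ℝ → ℂ} (h : SmoothBound M A k f) :
    Continuous f := by
  cases k with
  | zero => exact h.1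
  | succ k => exact h.1.1

theorem DividedBound.bound {M A : ℝ} {k : ℕ} {f : ℝ → ℂ} (h : DividedBound M A k f) :
    ∀ t, |t| ≤ M → ‖f t‖ ≤ A := by
  cases k with
  | zero => exact h
  | succ k => exact h.1

/-- The average of `f` over the segment from `a` to `t`, with the weight `θ^i`. -/
def segmentMean (a : ℝ) (i : ℕ) (f : ℝ → ℂ) (t : ℝ) : ℂ :=
  ∫ θ in (0 : ℝ)..1, (θ : ℂ) ^ i * f (a + θ * (t - a))

theorem continuous_segmentMean (a : ℝ) (i : ℕ) {f : ℝ → ℂ} (hf : Continuous f) :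
    Continuous (segmentMean a i f) := by
  unfold segmentMean
  refine intervalIntegral.continuous_parametric_intervalIntegral_of_continuous' ?_ 0 1
  fun_prop

theorem norm_segmentMean_le {M A a : ℝ} (ha : |a| ≤ M) (i : ℕ) {f : ℝ → ℂ}
    (hf : ∀ t, |t| ≤ M → ‖f t‖ ≤ A) (t : ℝ) (ht : |t| ≤ M) : ‖segmentMean a i f t‖ ≤ A := by
  have hA : 0 ≤ A := (norm_nonneg _).trans (hf t ht)
  have h := intervalIntegral.norm_integral_le_of_norm_le_const (a := (0 : ℝ)) (b := 1) (C := A)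
    (f := fun θ : ℝ => (θ : ℂ) ^ i * f (a + θ * (t - a))) fun θ hθ => by
      rw [Set.uIoc_of_le zero_le_one] at hθ
      have h1 : |a + θ * (t - a)| ≤ M := by
        have h2 : a + θ * (t - a) = (1 - θ) * a + θ * t := by ring
        rw [h2]
        calc _ ≤ |(1 - θ) * a| + |θ * t| := abs_add_le _ _
          _ = (1 - θ) * |a| + θ * |t| := by
            rw [abs_mul, abs_mul, abs_of_nonneg (sub_nonneg.2 hθ.2), abs_of_pos hθ.1]
          _ ≤ (1 - θ) * M + θ * M := by
            have := sub_nonneg.2 hθ.2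
            have := hθ.1
            gcongr
          _ = M := by ring
      rw [norm_mul, norm_pow, Complex.norm_real, Real.norm_eq_abs, abs_of_pos hθ.1]
      calc _ ≤ 1 * A := mul_le_mul (pow_le_one₀ hθ.1.le hθ.2) (hf _ h1) (norm_nonneg _) zero_le_one
        _ = A := one_mul A
  simpa [segmentMean] using h

theorem hasDerivAt_segmentMean (a : ℝ) (i : ℕ) {f f' : ℝ → ℂ}
    (hf : ∀ t, HasDerivAt f (f' t) t) (hf' : Continuous f') (t : ℝ) :
    HasDerivAt (segmentMean a i f) (segmentMean a (i + 1) f' t) t := by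
  have hfc : Continuous f := continuous_iff_continuousAt.2 fun t => (hf t).continuousAt
  have hG : Continuous fun p : ℝ × ℝ => (p.1 : ℂ) ^ (i + 1) * f' (a + p.1 * (p.2 - a)) := by
    fun_prop
  obtain ⟨B, hB⟩ := (isCompact_Icc (a := (0 : ℝ)) (b := 1)).prod
    (isCompact_closedBall t 1) |>.exists_bound_of_continuousOn hG.continuousOn
  refine (intervalIntegral.hasDerivAt_integral_of_dominated_loc_of_deriv_le (μ := volume)
    (F := fun s θ => (θ : ℂ) ^ i * f (a + θ * (s - a)))
    (F' := fun s θ => (θ : ℂ) ^ (i + 1) * f' (a + θ * (s - a)))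
    (bound := fun _ => B) (Metric.closedBall_mem_nhds t one_pos) ?_ ?_ ?_ ?_ ?_ ?_).2
  · refine Eventually.of_forall fun s => Continuous.aestronglyMeasurable ?_
    fun_prop
  · refine Continuous.intervalIntegrable ?_ _ _
    fun_prop
  · refine Continuous.aestronglyMeasurable ?_
    fun_prop
  · refine Eventually.of_forall fun θ hθ s hs => ?_
    rw [Set.uIoc_of_le zero_le_one] at hθ
    exact hB (θ, s) ⟨Set.Ioc_subset_Icc_self hθ, hs⟩
  · exact intervalIntegrable_const
  · refine Eventually.of_forall fun θ _ s _ => ?_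
    have h1 : HasDerivAt (fun s : ℝ => a + θ * (s - a)) θ s := by
      simpa using (((hasDerivAt_id s).sub_const a).const_mul θ).const_add a
    have h2 := ((hf (a + θ * (s - a))).scomp s h1).const_mul ((θ : ℂ) ^ i)
    refine h2.congr_deriv ?_
    rw [Complex.real_smul]
    ring

theorem SmoothBound.segmentMean {M A a : ℝ} (ha : |a| ≤ M) {k : ℕ} {f : ℝ → ℂ}
    (h : SmoothBound M A k f) (i : ℕ) : SmoothBound M A k (segmentMean a i f) := by
  induction k generalizing f i with
  | zero => exact ⟨continuous_segmentMean a i h.1, norm_segmentMean_le ha i h.2⟩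
  | succ k ih =>
    obtain ⟨h1, f', hf', h2⟩ := h
    exact ⟨⟨continuous_segmentMean a i h1.1, norm_segmentMean_le ha i h1.2⟩, _,
      hasDerivAt_segmentMean a i hf' h2.continuous, ih h2 (i + 1)⟩

theorem SmoothBound.dividedBound {M A : ℝ} {k : ℕ} {f : ℝ → ℂ} (h : SmoothBound M A k f) :
    DividedBound M A k f := by
  induction k generalizing f with
  | zero => exact h.2
  | succ k ih =>
    obtain ⟨h1, f', hf', h2⟩ := h
    refine ⟨h1.2, fun a ha => ⟨_, ih (h2.segmentMean ha 0), fun t => ?_⟩⟩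
    have h3 : ∀ θ : ℝ, HasDerivAt (fun θ : ℝ => f (a + θ * (t - a)))
        ((t - a) • f' (a + θ * (t - a))) θ := fun θ => by
      have h4 : HasDerivAt (fun θ : ℝ => a + θ * (t - a)) (t - a) θ := by
        simpa using ((hasDerivAt_id θ).mul_const (t - a)).const_add a
      exact (hf' _).scomp θ h4
    have hc := h2.continuous
    have h5 := intervalIntegral.integral_eq_sub_of_hasDerivAt (a := 0) (b := 1)
      (fun θ _ => h3 θ) (Continuous.intervalIntegrable (by fun_prop) _ _)
    simp only [one_mul, zero_mul, add_zero, add_sub_cancel] at h5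
    rw [← h5, intervalIntegral.integral_smul, Complex.real_smul, SphericalFactorization.segmentMean]
    simp

theorem vdm_succ {R : Type*} [CommRing R] {n : ℕ} (x : Fin (n + 1) → R) :
    vdm x = (∏ i : Fin n, (x 0 - x i.succ)) * vdm fun i : Fin n => x i.succ := by
  simp [vdm, Fin.prod_univ_succ]

/-- The constant in the bound of a determinant of functions by divided differences. -/
def dividedConst (A : ℝ) : ℕ → ℝ
  | 0 => 1
  | n + 1 => (n + 1) * (A * dividedConst A n)

/-- By induction: subtracting the first row from the others and dividing by `lam_i - lam_0` leaves
divided differences in these rows. -/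
theorem norm_det_le_of_dividedBound {M A : ℝ} {n : ℕ} {f : Fin n → ℝ → ℂ}
    (hf : ∀ j, DividedBound M A n (f j)) {lam : Fin n → ℝ} (hlam : ∀ i, |lam i| ≤ M) :
    ‖(Matrix.of fun i j => f j (lam i)).det‖ ≤ dividedConst A n * |vdm lam| := by
  induction n with
  | zero => simp [dividedConst, vdm]
  | succ n ih =>
    have h1 : ∀ j, ∃ g, DividedBound M A n g ∧
        ∀ t, f j t - f j (lam 0) = (t - lam 0) * g t := fun j => (hf j).2 _ (hlam 0)
    choose g hg1 hg2 using h1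
    let w : Fin (n + 1) → ℂ := Fin.cases 1 fun i => ((lam i.succ - lam 0 : ℝ) : ℂ)
    let G : Matrix (Fin (n + 1)) (Fin (n + 1)) ℂ := Matrix.of
      fun i j => Fin.cases (motive := fun _ => ℂ) (f j (lam 0)) (fun i => g j (lam i.succ)) i
    have h2 : (Matrix.of fun i j => f j (lam i)).det = (∏ i, w i) * G.det := by
      rw [← Matrix.det_mul_column]
      refine Matrix.det_eq_of_forall_row_eq_smul_add_const (fun i => if i = 0 then 0 else 1) 0
        (by simp) fun i j => ?_
      induction i using Fin.cases with
      | zero => simp [w, G]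
      | succ i =>
        simp only [Matrix.of_apply, Fin.cases_succ, Fin.cases_zero, w, G, Fin.succ_ne_zero,
          if_false, one_mul]
        have := hg2 j (lam i.succ)
        push_cast
        linear_combination this
    have h3 : ‖G.det‖ ≤ (n + 1) * (A * (dividedConst A n * |vdm fun i : Fin n => lam i.succ|)) := by
      rw [Matrix.det_succ_row_zero]
      refine (norm_sum_le _ _).trans ?_
      calc _ ≤ ∑ _j : Fin (n + 1), A * (dividedConst A n * |vdm fun i : Fin n => lam i.succ|) := by
            refine Finset.sum_le_sum fun j _ => ?_
            rw [norm_mul, norm_mul, norm_pow, norm_neg, norm_one, one_pow, one_mul]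
            refine mul_le_mul ((hf j).bound _ (hlam 0)) ?_ (norm_nonneg _)
              ((norm_nonneg _).trans ((hf j).bound _ (hlam 0)))
            exact ih (f := fun j' => g (j.succAbove j')) (fun j' => hg1 _) fun i => hlam i.succ
        _ = _ := by simp
    have h4 : ‖∏ i, w i‖ = |∏ i : Fin n, (lam 0 - lam i.succ)| := by
      rw [Fin.prod_univ_succ, Finset.abs_prod, norm_mul, norm_prod]
      simp only [w, Fin.cases_zero, Fin.cases_succ, norm_one, one_mul, Complex.norm_real,
        Real.norm_eq_abs]
      exact Finset.prod_congr rfl fun i _ => abs_sub_comm _ _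
    rw [h2, norm_mul, h4, vdm_succ, abs_mul, dividedConst]
    calc _ ≤ |∏ i : Fin n, (lam 0 - lam i.succ)|
          * ((n + 1) * (A * (dividedConst A n * |vdm fun i : Fin n => lam i.succ|))) :=
          mul_le_mul_of_nonneg_left h3 (abs_nonneg _)
      _ = _ := by ring

theorem hasDerivAt_chi' (ε : ZMod 2) {w : ℂ} (hw : 0 < w.re) (t : ℝ) :
    HasDerivAt (chi (ε + 1) (w + 1)) ((w + 1) * chi ε w t) t := by
  rcases eq_or_ne t 0 with rfl | ht
  · refine hasDerivAt_of_hasDerivAt_of_ne (g := fun t => (w + 1) * chi ε w t)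
      (fun y hy => hasDerivAt_chi ε w hy) ?_ ?_
    · exact (continuous_chi _ (by simp; linarith)).continuousAt
    · exact ((continuous_chi ε hw).const_smul (w + 1)).continuousAt
  · exact hasDerivAt_chi ε w ht

theorem smoothBound_chi {M A R : ℝ} (hR : 1 ≤ R) (k : ℕ) (ε : ZMod 2) {w : ℂ} (a : ℂ)
    (hw : (k : ℝ) < w.re) (hwR : ∀ i : ℕ, i ≤ k → ‖w - i‖ ≤ R)
    (hA : ‖a‖ * R ^ k * (max M 1) ^ R ≤ A) :
    SmoothBound M A k fun t => a * chi ε w t := by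
  have hw0 : 0 < w.re := (Nat.cast_nonneg k).trans_lt hw
  have h1 : Continuous fun t => a * chi ε w t := (continuous_chi ε hw0).const_smul a
  have h2 : ∀ t, |t| ≤ M → ‖a * chi ε w t‖ ≤ A := fun t ht => by
    rw [norm_mul]
    calc _ ≤ ‖a‖ * (max M 1) ^ R := by
          gcongr
          refine (norm_chi_le ε w t).trans ?_
          calc _ ≤ (max M 1) ^ w.re :=
                Real.rpow_le_rpow (abs_nonneg t) (ht.trans (le_max_left _ _)) hw0.le
            _ ≤ _ := Real.rpow_le_rpow_of_exponent_le (le_max_right _ _)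
                ((Complex.re_le_norm w).trans (by simpa using hwR 0 (Nat.zero_le _)))
      _ = ‖a‖ * 1 * (max M 1) ^ R := by ring
      _ ≤ ‖a‖ * R ^ k * (max M 1) ^ R := by
          gcongr
          exact one_le_pow₀ hR
      _ ≤ A := hA
  induction k generalizing w ε a with
  | zero => exact ⟨h1, h2⟩
  | succ k ih =>
    push_cast at hw
    have hre : (k : ℝ) < (w - 1).re := by simp; linarith
    have hε : ∀ ε : ZMod 2, ε + 1 + 1 = ε := by decide
    have h3 : ∀ t, HasDerivAt (fun t => a * chi ε w t) (a * w * chi (ε + 1) (w - 1) t) t :=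
      fun t => by
        have h4 := (hasDerivAt_chi' (ε + 1) ((Nat.cast_nonneg k).trans_lt hre) t).const_mul a
        rw [hε ε, sub_add_cancel] at h4
        rwa [mul_assoc]
    have hre0 : 0 < (w - 1).re := (Nat.cast_nonneg k).trans_lt hre
    have hwR' : ∀ i : ℕ, i ≤ k → ‖w - 1 - i‖ ≤ R := fun i hi => by
      have := hwR (i + 1) (by omega)
      push_cast at this
      rwa [sub_sub, add_comm (1 : ℂ)]
    have hA' : ‖a * w‖ * R ^ k * (max M 1) ^ R ≤ A := by
      refine le_trans ?_ hA
      rw [norm_mul, pow_succ]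
      have hwn : ‖w‖ ≤ R := by simpa using hwR 0 (Nat.zero_le _)
      calc _ = ‖a‖ * (R ^ k * ‖w‖) * (max M 1) ^ R := by ring
        _ ≤ ‖a‖ * (R ^ k * R) * (max M 1) ^ R := by gcongr
    refine ⟨⟨h1, h2⟩, _, h3, ih (ε + 1) (a * w) hre hwR' hA' hre0 ?_ ?_⟩
    · exact (continuous_chi _ hre0).const_smul (a * w)
    · intro t ht
      rw [norm_mul]
      calc _ ≤ ‖a * w‖ * (max M 1) ^ R := by
            gcongr
            refine (norm_chi_le _ _ t).trans ?_
            calc _ ≤ (max M 1) ^ (w - 1).re :=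
                  Real.rpow_le_rpow (abs_nonneg t) (ht.trans (le_max_left _ _)) hre0.le
              _ ≤ _ := Real.rpow_le_rpow_of_exponent_le (le_max_right _ _)
                  ((Complex.re_le_norm _).trans (by simpa using hwR' 0 (Nat.zero_le _)))
        _ = ‖a * w‖ * 1 * (max M 1) ^ R := by ring
        _ ≤ ‖a * w‖ * R ^ k * (max M 1) ^ R := by
            gcongr
            exact one_le_pow₀ hR
        _ ≤ A := hA'

/-- A bound of the entire numerators that is uniform in the eigenvalues. -/
theorem exists_norm_entireNumerator_le (n : ℕ) (M R : ℝ) :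
    ∃ B, ∀ lam : Fin n → ℝ, (∀ i, lam i ≠ 0) → (∀ i, |lam i| ≤ M) → ∀ (L : Fin n → ZMod 2)
      (z : Fin n → ℂ), (∀ j, (n : ℝ) < (z j).re) → (∀ j, ‖z j‖ ≤ R) →
        ‖entireNumerator lam L z * classVdm L z‖ ≤ B := by
  set R' : ℝ := max 1 (R + n)
  have hR' : 1 ≤ R' := le_max_left _ _
  set A : ℝ := R' ^ n * (max (M + 1) 1) ^ R'
  refine ⟨‖vdm (stair ℂ n)‖ * dividedConst A n, fun lam h0 hM L z hz hzR => ?_⟩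
  set c : Fin n → Bool := fun i => decide (0 < lam i)
  set u : Fin n → ℝ := fun i => Real.log |lam i|
  have hu : signedExp c u = lam := signedExp_log h0
  let U : Set (Fin n → ℝ) := {u | ∀ i, |signedExp c u i| < M + 1}
  have hU : IsOpen U := by
    simp only [U, Set.ofPred_forall]
    refine isOpen_iInter_of_finite fun i => isOpen_lt ?_ continuous_const
    exact continuous_abs.comp ((continuous_apply i).comp (continuous_signedExp c))
  have huU : u ∈ U := fun i => by
    rw [hu]
    linarith [hM i]
  have hcl : IsClosed {u : Fin n → ℝ | ‖entireExp c L u z * classVdm L z‖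
      ≤ ‖vdm (stair ℂ n)‖ * dividedConst A n} := by
    refine isClosed_le (continuous_norm.comp (Continuous.mul ?_ continuous_const)) continuous_const
    have h := (continuous_entireExp c L).comp (by fun_prop : Continuous fun u : Fin n → ℝ => (u, z))
    exact h
  refine closure_minimal (s := U ∩ {u | Function.Injective u}) ?_ hcl
    ((dense_injective n).open_subset_closure_inter hU huU)
  -- by continuity it suffices to bound the quotient for distinct eigenvalues
  rintro v ⟨hvU, hv⟩
  have h1 := entireExp_mul c L v z
  have h2 := vdm_ne_zero_of_injective (injective_signedExp c hv)
  have h3 : ‖chiDet z L (signedExp c v)‖ ≤ dividedConst A n * |vdm (signedExp c v)| := by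
    refine norm_det_le_of_dividedBound (M := M + 1) (f := fun j => chi (L j) (z j)) (fun j => ?_)
      fun i => (hvU i).le
    have h4 := smoothBound_chi (M := M + 1) (A := A) hR' n (L j) (w := z j) 1 (hz j) ?_ ?_
    · simpa using h4.dividedBound
    · intro i hi
      refine (norm_sub_le _ _).trans ((add_le_add (hzR j) ?_).trans (le_max_right _ _))
      rw [Complex.norm_natCast]
      exact_mod_cast hi
    · simp [A]
  have h5 := congrArg norm h1
  rw [norm_mul _ (((vdm (signedExp c v) : ℝ)) : ℂ), norm_mul (vdm (stair ℂ n)), Complex.norm_real,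
    Real.norm_eq_abs] at h5
  refine le_of_mul_le_mul_right (a := |vdm (signedExp c v)|) ?_ (abs_pos.2 h2)
  rw [h5, mul_assoc]
  exact mul_le_mul_of_nonneg_left h3 (norm_nonneg _)

/-! ### Integrals of families of entire functions -/

section EntireFamily

variable {α : Type*} [MeasurableSpace α] {μ : Measure α}

/-- A family of entire functions that is measurable in the parameter on an open set of arguments is
so for all arguments, by Taylor expansion. -/
theorem aestronglyMeasurable_of_entire {f : ℂ → α → ℂ}
    (hf : ∀ a, Differentiable ℂ fun w => f w a) {U : Set ℂ} (hU : IsOpen U) (hne : U.Nonempty)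
    (hm : ∀ w ∈ U, AEStronglyMeasurable (f w) μ) (w : ℂ) : AEStronglyMeasurable (f w) μ := by
  have h1 : ∀ (n : ℕ), ∀ w ∈ U,
      AEStronglyMeasurable (fun a => iteratedDeriv n (fun w => f w a) w) μ := by
    intro n
    induction n with
    | zero => simpa using hm
    | succ n ih =>
      intro w hw
      obtain ⟨ε, hε, hball⟩ := Metric.isOpen_iff.1 hU w hw
      have hstep : ∀ N : ℕ, 0 < ε / (N + 2) := fun N => by positivity
      have hmem : ∀ N : ℕ, w + ((ε / (N + 2) : ℝ) : ℂ) ∈ U := fun N => hball (by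
        rw [Metric.mem_ball, dist_eq_norm, add_sub_cancel_left, Complex.norm_real,
          Real.norm_of_nonneg (hstep N).le]
        exact div_lt_self hε (by have : (0 : ℝ) ≤ N := N.cast_nonneg; linarith))
      have hlim : Tendsto (fun N : ℕ => (ε / (N + 2) : ℝ)) atTop (𝓝 0) := by
        refine tendsto_const_nhds.div_atTop ?_
        exact tendsto_atTop_add_const_right _ _ tendsto_natCast_atTop_atTop
      refine aestronglyMeasurable_of_tendsto_ae atTop (f := fun (N : ℕ) a =>
        ((ε / (N + 2) : ℝ) : ℂ)⁻¹ * (iteratedDeriv n (fun w => f w a) (w + ((ε / (N + 2) : ℝ) : ℂ))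
          - iteratedDeriv n (fun w => f w a) w)) (fun N => ?_) ?_
      · exact ((ih _ (hmem N)).sub (ih w hw)).const_mul _
      · refine Eventually.of_forall fun a => ?_
        have hd : HasDerivAt (iteratedDeriv n fun w => f w a)
            (iteratedDeriv (n + 1) (fun w => f w a) w) w := by
          rw [iteratedDeriv_succ]
          exact (((hf a).contDiff (n := ⊤)).differentiable_iteratedDeriv n
            (by exact_mod_cast WithTop.coe_lt_top _) w).hasDerivAt
        have h2 := hd.tendsto_slope_zero
        have h3 : Tendsto (fun N : ℕ => ((ε / (N + 2) : ℝ) : ℂ)) atTop (𝓝[≠] 0) := by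
          refine tendsto_nhdsWithin_iff.2 ⟨?_, Eventually.of_forall fun N => ?_⟩
          · exact_mod_cast (Complex.continuous_ofReal.tendsto 0).comp hlim
          · exact Complex.ofReal_ne_zero.2 (hstep N).ne'
        exact h2.comp h3
  obtain ⟨c, hc⟩ := hne
  refine aestronglyMeasurable_of_tendsto_ae atTop (f := fun (N : ℕ) a =>
    ∑ n ∈ Finset.range N, ((n.factorial : ℂ)⁻¹ • (w - c) ^ n • iteratedDeriv n (fun w => f w a) c))
    (fun N => ?_) ?_
  · refine Finset.aestronglyMeasurable_fun_sum _ fun n _ => ?_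
    have h4 := ((h1 n c hc).const_smul ((w - c) ^ n)).const_smul ((n.factorial : ℂ)⁻¹)
    exact h4
  · refine Eventually.of_forall fun a => ?_
    exact (Complex.hasSum_taylorSeries_of_entire (hf a) c w).tendsto_sum_nat

/-- The integral of a family of entire functions is holomorphic where the family is locally
dominated by integrable functions. -/
theorem differentiableOn_integral_of_entire {f : ℂ → α → ℂ}
    (hf : ∀ a, Differentiable ℂ fun w => f w a) (hm : ∀ w, AEStronglyMeasurable (f w) μ)
    {V : Set ℂ} (hb : ∀ w ∈ V, ∃ ρ > 0, ∃ g : α → ℝ, Integrable g μ ∧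
      ∀ w' ∈ Metric.ball w ρ, ∀ a, ‖f w' a‖ ≤ g a) :
    DifferentiableOn ℂ (fun w => ∫ a, f w a ∂μ) V := by
  intro w hw
  obtain ⟨ρ, hρ, g, hg, hfg⟩ := hb w hw
  have hd : ∀ a w', HasDerivAt (fun w => f w a) (deriv (fun w => f w a) w') w' := fun a w' =>
    (hf a w').hasDerivAt
  have hmd : AEStronglyMeasurable (fun a => deriv (fun w => f w a) w) μ := by
    have hne : ∀ N : ℕ, ((1 / ((N : ℝ) + 1) : ℝ) : ℂ) ≠ 0 := fun N =>
      Complex.ofReal_ne_zero.2 (by positivity)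
    refine aestronglyMeasurable_of_tendsto_ae atTop (f := fun (N : ℕ) a =>
        ((1 / ((N : ℝ) + 1) : ℝ) : ℂ)⁻¹ * (f (w + ((1 / ((N : ℝ) + 1) : ℝ) : ℂ)) a - f w a))
        (fun N => ((hm _).sub (hm _)).const_mul _) (Eventually.of_forall fun a => ?_)
    have h2 := (hd a w).tendsto_slope_zero
    have h3 : Tendsto (fun N : ℕ => ((1 / ((N : ℝ) + 1) : ℝ) : ℂ)) atTop (𝓝[≠] 0) := by
      refine tendsto_nhdsWithin_iff.2 ⟨?_, Eventually.of_forall hne⟩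
      exact_mod_cast (Complex.continuous_ofReal.tendsto 0).comp
        tendsto_one_div_add_atTop_nhds_zero_nat
    exact h2.comp h3
  refine (hasDerivAt_integral_of_dominated_loc_of_deriv_le (𝕜 := ℂ) (F := f)
    (F' := fun w a => deriv (fun w => f w a) w) (bound := fun a => g a / (ρ / 2))
    (Metric.ball_mem_nhds w (half_pos hρ)) (Eventually.of_forall hm) ?_ hmd ?_ ?_ ?_).2
      |>.differentiableAt.differentiableWithinAt
  · exact hg.mono' (hm w) (Eventually.of_forall fun a => hfg w (Metric.mem_ball_self hρ) a)
  · refine Eventually.of_forall fun a w' hw' => ?_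
    refine Complex.norm_deriv_le_of_forall_mem_sphere_norm_le (half_pos hρ)
      (hf a).diffContOnCl fun z hz => hfg z ?_ a
    rw [Metric.mem_ball] at hw' ⊢
    rw [Metric.mem_sphere] at hz
    linarith [dist_triangle z w' w]
  · exact hg.div_const _
  · exact Eventually.of_forall fun a w' _ => hd a w'

end EntireFamily

/-- A uniform bound of `q(w) f(w, a)` gives one of `f(w, a)`, even where the function `q` vanishes,
by the maximum principle. -/
theorem exists_bound_of_mul {α : Type*} {f : ℂ → α → ℂ} (hf : ∀ a, Differentiable ℂ fun w => f w a)
    {q : ℂ → ℂ} (hq : Differentiable ℂ q) (hq0 : ∃ w, q w ≠ 0) {w : ℂ} {ρ B : ℝ} (hρ : 0 < ρ)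
    (hB : ∀ w' ∈ Metric.ball w ρ, ∀ a, ‖f w' a * q w'‖ ≤ B) :
    ∃ δ > 0, ∃ B', ∀ w' ∈ Metric.ball w δ, ∀ a, ‖f w' a‖ ≤ B' := by
  have hqa : AnalyticOnNhd ℂ q Set.univ := fun z _ => hq.analyticAt z
  have h1 : ∀ᶠ z in 𝓝[≠] w, q z ≠ 0 := by
    rcases (hqa w trivial).eventually_eq_zero_or_eventually_ne_zero with h | h
    · exfalso
      obtain ⟨w₁, hw₁⟩ := hq0
      exact hw₁ (hqa.eqOn_zero_of_preconnected_of_eventuallyEq_zero isPreconnected_univ trivial h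
        trivial)
    · exact h
  obtain ⟨ε, hε, hball⟩ := Metric.mem_nhdsWithin_iff.1 h1
  set δ := min ε ρ / 2
  have hmin : 0 < min ε ρ := lt_min hε hρ
  have hδ : 0 < δ := half_pos hmin
  have hδε : δ < ε := (half_lt_self hmin).trans_le (min_le_left _ _)
  have hδρ : δ < ρ := (half_lt_self hmin).trans_le (min_le_right _ _)
  have hsph : ∀ z ∈ Metric.sphere w δ, q z ≠ 0 := fun z hz =>
    hball ⟨Metric.mem_ball.2 ((Metric.mem_sphere.1 hz).trans_lt hδε),
      Metric.ne_of_mem_sphere hz hδ.ne'⟩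
  have hcont : ContinuousOn (fun z => (q z)⁻¹) (Metric.sphere w δ) :=
    hq.continuous.continuousOn.inv₀ hsph
  obtain ⟨b, hb⟩ := (isCompact_sphere w δ).exists_bound_of_continuousOn hcont
  refine ⟨δ, hδ, B * b, fun w' hw' a => ?_⟩
  refine Complex.norm_le_of_forall_mem_frontier_norm_le Metric.isBounded_ball
    (hf a).diffContOnCl (fun z hz => ?_) (subset_closure hw')
  rw [frontier_ball w hδ.ne'] at hz
  have h2 := hB z (Metric.mem_ball.2 ((Metric.mem_sphere.1 hz).trans_lt hδρ)) a
  have h3 : f z a = f z a * q z * (q z)⁻¹ := by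
    rw [mul_assoc, mul_inv_cancel₀ (hsph z hz), mul_one]
  rw [h3, norm_mul]
  exact mul_le_mul h2 (hb z hz) (norm_nonneg _) ((norm_nonneg _).trans h2)

/-! ### Integrals of numerators outside the domain -/

theorem mixedVdm_add_const {n : ℕ} {κ : Type*} [DecidableEq κ] (c : Fin n → κ) (z : Fin n → ℂ)
    (τ : ℂ) : mixedVdm c (fun j => z j + τ) = mixedVdm c z := by
  simp [mixedVdm]

theorem add_const_mem_domain {n : ℕ} {z : Fin n → ℂ} (hz : z ∈ domain n) {τ : ℂ}
    (hτ : 0 ≤ τ.re) : (fun j => z j + τ) ∈ domain n := by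
  intro j
  have h := hz j
  unfold gap at h ⊢
  split_ifs at h ⊢ with hj
  · simpa using h
  · simp only [Complex.sub_re, Complex.add_re] at h ⊢
    linarith

theorem numerator_add_const {n : ℕ} {lam : Fin (n + 1) → ℝ} (h : ∀ i, lam i ≠ 0)
    (z : Fin (n + 1) → ℂ) (τ : ℂ) (L : Fin (n + 1) → ZMod 2) :
    numerator (fun j => z j + τ) L (realDiag lam)
      = ((∏ i, |lam i| : ℝ) : ℂ) ^ τ * numerator z L (realDiag lam) := by
  have h3 : (realDiag lam).det.re = ∏ i, lam i := by
    rw [realDiag, Matrix.det_diagonal, ← Complex.ofReal_prod, Complex.ofReal_re]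
  have h4 : reduce (fun j => z j + τ) = reduce z := by
    funext j
    simp [reduce]
  have h5 : ∏ i, lam i ≠ 0 := Finset.prod_ne_zero_iff.2 fun i _ => h i
  rw [numerator_succ, numerator_succ z, h3, h4, ← add_zero (L (Fin.last n)),
    chi_add_of_ne_zero _ _ _ _ h5, add_zero, chi.eq_def 0, ← Finset.abs_prod]
  simp only [signPow, if_true, Complex.ofReal_one, one_mul]
  ring

/-- The parameters `z_j + τ` give the numerator a factor `|det|^τ`. -/
theorem entireNumerator_add_const {n : ℕ} {lam : Fin (n + 1) → ℝ} (h : ∀ i, lam i ≠ 0)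
    (L : Fin (n + 1) → ZMod 2) (z : Fin (n + 1) → ℂ) {τ : ℂ} (hτ : 0 ≤ τ.re) :
    entireNumerator lam L (fun j => z j + τ)
      = ((∏ i, |lam i| : ℝ) : ℂ) ^ τ * entireNumerator lam L z := by
  have hE := analyticOnNhd_entireNumerator lam L
  have h1 : AnalyticOnNhd ℂ (fun z : Fin (n + 1) → ℂ => entireNumerator lam L fun j => z j + τ)
      Set.univ := fun z _ => by
    refine AnalyticAt.comp (f := fun z : Fin (n + 1) → ℂ => fun j => z j + τ) (hE _ trivial) ?_
    rw [analyticAt_pi_iff]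
    exact fun j => (analyticAt_coord j z).add analyticAt_const
  have h2 : AnalyticOnNhd ℂ (fun z : Fin (n + 1) → ℂ =>
      ((∏ i, |lam i| : ℝ) : ℂ) ^ τ * entireNumerator lam L z) Set.univ :=
    analyticOnNhd_const.mul hE
  obtain ⟨z₀, hz₀⟩ := interior_domain_nonempty (n + 1)
  refine congrFun (h1.eq_of_eventuallyEq (z₀ := z₀) h2 ?_) z
  filter_upwards [isOpen_interior.mem_nhds hz₀] with z hz
  have hz' := interior_subset hz
  rw [← numerator_mul_mixedVdm h L hz', ← numerator_mul_mixedVdm h L (add_const_mem_domain hz' hτ),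
    mixedVdm_add_const, numerator_add_const h]
  ring

theorem differentiable_entireNumerator {n : ℕ} (lam : Fin n → ℝ) (L : Fin n → ZMod 2) :
    Differentiable ℂ (entireNumerator lam L) := fun z =>
  (analyticOnNhd_entireNumerator lam L z trivial).differentiableAt

theorem differentiable_shift {n : ℕ} (s : Fin n → ℂ) : Differentiable ℂ fun w => shift w s := by
  unfold shift
  fun_prop

theorem differentiable_classVdm {n : ℕ} {κ : Type*} [DecidableEq κ] (c : Fin n → κ) :
    Differentiable ℂ (classVdm c) := by
  unfold classVdm
  have h : ∀ a p : Fin n, Differentiable ℂ fun x : Fin n → ℂ =>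
      if p < a ∧ c p = c a then x p - x a else 1 := fun a p => by
    split_ifs <;> fun_prop
  fun_prop

theorem differentiable_of_analyticOnNhd_univ {n : ℕ} {P : (Fin n → ℂ) → ℂ}
    (hP : AnalyticOnNhd ℂ P Set.univ) : Differentiable ℂ P := fun z =>
  (hP z trivial).differentiableAt

theorem isOpen_re_gt (a : ℝ) : IsOpen {w : ℂ | a < w.re} :=
  isOpen_lt continuous_const Complex.continuous_re

theorem isPreconnected_re_gt (a : ℝ) : IsPreconnected {w : ℂ | a < w.re} :=
  (convex_halfSpace_re_gt a).isPreconnected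

theorem shift_mem_domain {n : ℕ} (s : Fin n → ℂ) {w : ℂ} (hw : ∑ j, ‖gap s j‖ ≤ w.re) :
    shift w s ∈ domain n := fun j => by
  have h1 : ‖gap s j‖ ≤ ∑ j, ‖gap s j‖ :=
    Finset.single_le_sum (f := fun j => ‖gap s j‖) (fun _ _ => norm_nonneg _) (Finset.mem_univ j)
  have h2 := (abs_le.1 ((Complex.abs_re_le_norm (gap s j)))).1
  rw [gap_shift, Complex.add_re]
  linarith

theorem stair_add_one_eq {n : ℕ} (j : Fin n) :
    stair ℂ n j + 1 = ((((Fin.rev j : Fin n) : ℕ) + 1 : ℝ) : ℂ) := by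
  simp [stair]

theorem lt_re_shift {n : ℕ} {s : Fin n → ℂ} (hs : ∀ j, 2 * (n : ℝ) < (s j).re) {w : ℂ}
    (hw : -1 < w.re) (j : Fin n) : (n : ℝ) < (shift w s j).re := by
  have h1 : (((Fin.rev j : Fin n) : ℕ) : ℝ) + 1 ≤ n := by exact_mod_cast (Fin.rev j).2
  have h0 : (0 : ℝ) ≤ (((Fin.rev j : Fin n) : ℕ) : ℝ) := Nat.cast_nonneg _
  have h2 := hs j
  unfold shift
  rw [stair_add_one_eq, Complex.add_re, Complex.re_mul_ofReal]
  nlinarith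

theorem aestronglyMeasurable_entireNumerator {α : Type*} [MeasurableSpace α] {μ : Measure α}
    {n : ℕ} {lam : α → Fin n → ℝ} {L : Fin n → ZMod 2}
    (hmeas : ∀ z ∈ domain n, AEStronglyMeasurable (fun a => entireNumerator (lam a) L z) μ)
    (s : Fin n → ℂ) (w : ℂ) :
    AEStronglyMeasurable (fun a => entireNumerator (lam a) L (shift w s)) μ := by
  refine aestronglyMeasurable_of_entire (f := fun w a => entireNumerator (lam a) L (shift w s))
    (fun a => (differentiable_entireNumerator (lam a) L).comp (differentiable_shift s))
    (isOpen_re_gt (∑ j, ‖gap s j‖)) ⟨((∑ j, ‖gap s j‖ + 1 : ℝ) : ℂ), by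
      simp only [Set.mem_ofPred_eq, Complex.ofReal_re]; linarith⟩ (fun w hw => ?_) w
  exact hmeas _ (shift_mem_domain s (le_of_lt hw))

/-- The integral identity holds for parameters with large real parts: these are joined to the
domain by a line on which the entire numerators are bounded uniformly in the eigenvalues. -/
theorem integral_identity_of_re_large {α : Type*} [MeasurableSpace α] {μ : Measure α}
    [IsFiniteMeasure μ] {n : ℕ} {lam : α → Fin n → ℝ} {L : Fin n → ZMod 2}
    (h0 : ∀ a i, lam a i ≠ 0) {M : ℝ}
    (hM : ∀ a i, |lam a i| ≤ M)
    (hmeas : ∀ z ∈ domain n, AEStronglyMeasurable (fun a => entireNumerator (lam a) L z) μ)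
    {P Q : (Fin n → ℂ) → ℂ} (hP : AnalyticOnNhd ℂ P Set.univ) (hQ : AnalyticOnNhd ℂ Q Set.univ)
    (hPQ : ∀ z ∈ domain n, Q z * ∫ a, entireNumerator (lam a) L z ∂μ = mixedVdm L z * P z)
    {s : Fin n → ℂ} (hs : ∀ j, 2 * (n : ℝ) < (s j).re) :
    Q s * ∫ a, entireNumerator (lam a) L s ∂μ = mixedVdm L s * P s := by
  set Λ : ℝ := ∑ j, ‖gap s j‖
  have hΛ : 0 ≤ Λ := Finset.sum_nonneg fun j _ => norm_nonneg _
  have hf : ∀ a, Differentiable ℂ fun w => entireNumerator (lam a) L (shift w s) := fun a =>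
    (differentiable_entireNumerator (lam a) L).comp (differentiable_shift s)
  have hq : Differentiable ℂ fun w => classVdm L (shift w s) :=
    (differentiable_classVdm L).comp (differentiable_shift s)
  have hq0 : ∃ w, classVdm L (shift w s) ≠ 0 :=
    ⟨(Λ : ℂ), classVdm_ne_zero L (vdm_ne_zero_of_mem_domain (shift_mem_domain s le_rfl))⟩
  -- the line `w ↦ shift w s` enters the domain for large `Re w`, and the bound by divided
  -- differences holds on it for `Re w > -1`
  have hd : DifferentiableOn ℂ (fun w => ∫ a, entireNumerator (lam a) L (shift w s) ∂μ)
      {w : ℂ | -1 < w.re} := by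
    refine differentiableOn_integral_of_entire hf
      (aestronglyMeasurable_entireNumerator hmeas s) fun w hw => ?_
    have hw : -1 < w.re := hw
    set ρ : ℝ := w.re + 1
    have hρ : 0 < ρ := by simp only [ρ]; linarith
    obtain ⟨R, hR⟩ := (isCompact_closedBall w ρ).exists_bound_of_continuousOn
      (differentiable_shift s).continuous.continuousOn
    obtain ⟨B, hB⟩ := exists_norm_entireNumerator_le n M R
    obtain ⟨δ, hδ, B', hB'⟩ := exists_bound_of_mul hf hq hq0 hρ (B := B) fun w' hw' a => by
      refine hB (lam a) (h0 a) (hM a) L _ (fun j => lt_re_shift hs ?_ j) fun j => ?_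
      · have h1 : |(w' - w).re| < ρ :=
          (Complex.abs_re_le_norm _).trans_lt (by rwa [Metric.mem_ball, dist_eq_norm] at hw')
        have h2 := (abs_lt.1 h1).1
        rw [Complex.sub_re] at h2
        simp only [ρ] at h2
        linarith
      · exact (norm_le_pi_norm _ j).trans (hR w' (Metric.ball_subset_closedBall hw'))
    exact ⟨δ, hδ, fun _ => B', integrable_const _, hB'⟩
  have hopen := isOpen_re_gt (-1)
  have hA := hd.analyticOnNhd hopen
  have hcomp : ∀ {P : (Fin n → ℂ) → ℂ}, Differentiable ℂ P →
      AnalyticOnNhd ℂ (fun w => P (shift w s)) {w : ℂ | -1 < w.re} := fun hP =>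
    (hP.comp (differentiable_shift s)).differentiableOn.analyticOnNhd hopen
  have h1 := (hcomp (differentiable_of_analyticOnNhd_univ hQ)).mul hA
  have h2 := (hcomp (differentiable_of_analyticOnNhd_univ (analyticOnNhd_mixedVdm L))).mul
    (hcomp (differentiable_of_analyticOnNhd_univ hP))
  have h3 := h1.eqOn_of_preconnected_of_eventuallyEq h2 (isPreconnected_re_gt (-1))
    (z₀ := ((Λ + 1 : ℝ) : ℂ)) (by
      simp only [Set.mem_ofPred_eq, Complex.ofReal_re]; linarith) (by
      filter_upwards [(isOpen_re_gt Λ).mem_nhds (show ((Λ + 1 : ℝ) : ℂ) ∈ {w : ℂ | Λ < w.re} by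
        simp only [Set.mem_ofPred_eq, Complex.ofReal_re]; linarith)] with w hw
      exact hPQ _ (shift_mem_domain s (le_of_lt hw)))
  have h4 := h3 (show (0 : ℂ) ∈ {w : ℂ | -1 < w.re} by simp)
  have h5 : shift 0 s = s := by funext j; simp [shift]
  simp only [h5] at h4
  exact h4

/-- The integral identity holds wherever the integral converges: adding `τ` to all parameters
multiplies the entire numerators by the `τ`-th power of a bounded function. -/
theorem integral_identity {α : Type*} [MeasurableSpace α] {μ : Measure α} [IsFiniteMeasure μ]
    {n : ℕ} {lam : α → Fin (n + 1) → ℝ} {L : Fin (n + 1) → ZMod 2} (h0 : ∀ a i, lam a i ≠ 0)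
    {M : ℝ} (hM : ∀ a i, |lam a i| ≤ M)
    (hmeas : ∀ z ∈ domain (n + 1),
      AEStronglyMeasurable (fun a => entireNumerator (lam a) L z) μ)
    {P Q : (Fin (n + 1) → ℂ) → ℂ} (hP : AnalyticOnNhd ℂ P Set.univ)
    (hQ : AnalyticOnNhd ℂ Q Set.univ)
    (hPQ : ∀ z ∈ domain (n + 1),
      Q z * ∫ a, entireNumerator (lam a) L z ∂μ = mixedVdm L z * P z)
    {s : Fin (n + 1) → ℂ} (hs : Integrable (fun a => entireNumerator (lam a) L s) μ) :
    Q s * ∫ a, entireNumerator (lam a) L s ∂μ = mixedVdm L s * P s := by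
  -- for `T < Re τ` the parameters `s_j + τ` have large real parts
  set T : ℝ := ∑ j, ‖s j‖ + 2 * ((n + 1 : ℕ) : ℝ)
  have hT : 0 ≤ T := add_nonneg (Finset.sum_nonneg fun j _ => norm_nonneg _) (by positivity)
  have hlarge : ∀ τ : ℂ, T < τ.re → ∀ j, 2 * ((n + 1 : ℕ) : ℝ) < (s j + τ).re := fun τ hτ j => by
    have h1 : ‖s j‖ ≤ ∑ j, ‖s j‖ :=
      Finset.single_le_sum (f := fun j => ‖s j‖) (fun _ _ => norm_nonneg _) (Finset.mem_univ j)
    have h2 := (abs_le.1 ((Complex.abs_re_le_norm (s j)))).1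
    rw [Complex.add_re]
    simp only [T] at hτ
    linarith
  set ρ : α → ℝ := fun a => ∏ i, |lam a i|
  have hρ : ∀ a, 0 < ρ a := fun a => Finset.prod_pos fun i _ => abs_pos.2 (h0 a i)
  set X : ℝ := max 1 (M ^ (n + 1))
  have hX : 1 ≤ X := le_max_left _ _
  have hρX : ∀ a, ρ a ≤ X := fun a => by
    refine le_trans ?_ (le_max_right _ _)
    calc _ ≤ ∏ _i : Fin (n + 1), M :=
          Finset.prod_le_prod (fun i _ => abs_nonneg _) fun i _ => hM a i
      _ = _ := by simp
  -- `f τ` is the entire numerator at the parameters `s_j + τ`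
  set f : ℂ → α → ℂ := fun τ a => ((ρ a : ℝ) : ℂ) ^ τ * entireNumerator (lam a) L s
  have hf : ∀ a, Differentiable ℂ fun τ => f τ a := fun a => by
    have h1 : ((ρ a : ℝ) : ℂ) ≠ 0 := Complex.ofReal_ne_zero.2 (hρ a).ne'
    refine Differentiable.mul_const ?_ _
    exact fun τ => (differentiableAt_id.const_cpow (Or.inl h1))
  have hfE : ∀ τ : ℂ, 0 ≤ τ.re → ∀ a, entireNumerator (lam a) L (fun j => s j + τ) = f τ a :=
    fun τ hτ a => entireNumerator_add_const (h0 a) L s hτ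
  have hbound : ∀ (τ : ℂ) (y : ℝ), 0 ≤ τ.re → τ.re ≤ y → ∀ a,
      ‖f τ a‖ ≤ X ^ y * ‖entireNumerator (lam a) L s‖ := fun τ y hτ hy a => by
    rw [norm_mul, Complex.norm_cpow_eq_rpow_re_of_pos (hρ a)]
    refine mul_le_mul_of_nonneg_right ?_ (norm_nonneg _)
    exact (Real.rpow_le_rpow (hρ a).le (hρX a) hτ).trans (Real.rpow_le_rpow_of_exponent_le hX hy)
  have hm : ∀ τ, AEStronglyMeasurable (f τ) μ := by
    refine aestronglyMeasurable_of_entire hf (isOpen_re_gt T) ⟨((T + 1 : ℝ) : ℂ), by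
      simp only [Set.mem_ofPred_eq, Complex.ofReal_re]; linarith⟩ fun τ hτ => ?_
    have hτ : T < τ.re := hτ
    have h1 := aestronglyMeasurable_entireNumerator hmeas (fun j => s j + τ) 0
    have h5 : shift 0 (fun j => s j + τ) = fun j => s j + τ := by funext j; simp [shift]
    rw [h5] at h1
    simpa only [hfE τ (hT.trans hτ.le)] using h1
  have hd : DifferentiableOn ℂ (fun τ => ∫ a, f τ a ∂μ) {τ : ℂ | 0 < τ.re} := by
    refine differentiableOn_integral_of_entire hf hm fun τ hτ => ?_
    refine ⟨τ.re, hτ, fun a => X ^ (2 * τ.re) * ‖entireNumerator (lam a) L s‖,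
      hs.norm.const_mul _, fun τ' hτ' a => ?_⟩
    have h1 : |(τ' - τ).re| < τ.re :=
      (Complex.abs_re_le_norm _).trans_lt (by rwa [Metric.mem_ball, dist_eq_norm] at hτ')
    rw [Complex.sub_re] at h1
    have h2 := abs_lt.1 h1
    exact hbound τ' _ (by linarith) (by linarith) a
  have hopen := isOpen_re_gt 0
  have hA := hd.analyticOnNhd hopen
  have hadd : Differentiable ℂ fun τ : ℂ => fun j => s j + τ := by fun_prop
  have hcomp : ∀ {P : (Fin (n + 1) → ℂ) → ℂ}, Differentiable ℂ P →
      AnalyticOnNhd ℂ (fun τ => P fun j => s j + τ) {w : ℂ | 0 < w.re} := fun hP =>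
    (hP.comp hadd).differentiableOn.analyticOnNhd hopen
  have hQd := differentiable_of_analyticOnNhd_univ hQ
  have hPd := differentiable_of_analyticOnNhd_univ hP
  have h1 := (hcomp hQd).mul hA
  have h2 := (analyticOnNhd_const (v := mixedVdm L s)).mul (hcomp hPd)
  have h3 := h1.eqOn_of_preconnected_of_eventuallyEq h2 (isPreconnected_re_gt 0)
    (z₀ := ((T + 1 : ℝ) : ℂ)) (by
      simp only [Set.mem_ofPred_eq, Complex.ofReal_re]; linarith) (by
      filter_upwards [(isOpen_re_gt T).mem_nhds (show ((T + 1 : ℝ) : ℂ) ∈ {w : ℂ | T < w.re} by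
        simp only [Set.mem_ofPred_eq, Complex.ofReal_re]; linarith)] with τ hτ
      have hτ : T < τ.re := hτ
      have h4 := integral_identity_of_re_large h0 hM hmeas hP hQ hPQ (hlarge τ hτ)
      simp only [hfE τ (hT.trans hτ.le), mixedVdm_add_const] at h4
      exact h4)
  have hlim : ∀ {P : (Fin (n + 1) → ℂ) → ℂ}, Differentiable ℂ P →
      Tendsto (fun τ : ℝ => P fun j => s j + τ) (𝓝[>] 0) (𝓝 (P s)) := fun hP => by
    have h := ((hP.continuous.comp hadd.continuous).comp Complex.continuous_ofReal).tendsto 0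
    simp only [Function.comp_apply, Complex.ofReal_zero, add_zero] at h
    exact h.mono_left nhdsWithin_le_nhds
  have hint : Tendsto (fun τ : ℝ => ∫ a, f τ a ∂μ) (𝓝[>] 0)
      (𝓝 (∫ a, entireNumerator (lam a) L s ∂μ)) := by
    refine tendsto_integral_filter_of_dominated_convergence
      (fun a => X ^ (1 : ℝ) * ‖entireNumerator (lam a) L s‖)
      (Eventually.of_forall fun τ => hm _) ?_ (hs.norm.const_mul _)
      (Eventually.of_forall fun a => ?_)
    · filter_upwards [Ioo_mem_nhdsGT (show (0 : ℝ) < 1 from one_pos)] with τ hτ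
      exact Eventually.of_forall fun a => hbound τ 1 (by simpa using hτ.1.le)
        (by simpa using hτ.2.le) a
    · have h := ((hf a).continuous.comp Complex.continuous_ofReal).tendsto 0
      simp only [Function.comp_apply, Complex.ofReal_zero, f, Complex.cpow_zero, one_mul] at h
      exact h.mono_left nhdsWithin_le_nhds
  refine tendsto_nhds_unique (((hlim hQd).mul hint).congr' ?_) ((hlim hPd).const_mul _)
  filter_upwards [self_mem_nhdsWithin] with τ hτ
  have h4 := h3 (show (τ : ℂ) ∈ {w : ℂ | 0 < w.re} by simpa using hτ)
  exact h4

/-! ### The integral formula and its continuation -/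

theorem HasSpectrum.trace_mul_self {l n : ℕ} (h : n ≤ l) {x : Matrix (Fin l) (Fin l) ℂ}
    {lam : Fin n → ℝ} (hx : HasSpectrum x lam) : (x * x).trace.re = ∑ i, lam i ^ 2 := by
  obtain ⟨-, w, rfl⟩ := hx
  have h1 := conjTranspose_mul_coe w
  have h2 : proj n l * proj l n = 1 := by rw [proj_mul_proj h, proj_self]
  have h3 : (w.1 * (proj l n * realDiag lam * proj n l) * w.1ᴴ
      * (w.1 * (proj l n * realDiag lam * proj n l) * w.1ᴴ)).trace
      = (realDiag lam * realDiag lam).trace := by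
    calc _ = (w.1 * (proj l n * realDiag lam * proj n l * (w.1ᴴ * w.1)
          * (proj l n * realDiag lam * proj n l)) * w.1ᴴ).trace := by
          simp only [Matrix.mul_assoc]
      _ = (w.1ᴴ * w.1 * (proj l n * realDiag lam * proj n l * (w.1ᴴ * w.1)
          * (proj l n * realDiag lam * proj n l))).trace := by
          rw [Matrix.trace_mul_comm]
          simp only [Matrix.mul_assoc]
      _ = (proj l n * (realDiag lam * (proj n l * proj l n) * realDiag lam * proj n l)).trace := by
          rw [h1, Matrix.one_mul, Matrix.mul_one]
          simp only [Matrix.mul_assoc]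
      _ = _ := by
          rw [h2, Matrix.mul_one, Matrix.trace_mul_comm, Matrix.mul_assoc, h2, Matrix.mul_one]
  rw [h3, realDiag, Matrix.diagonal_mul_diagonal, Matrix.trace_diagonal, Complex.re_sum]
  refine Finset.sum_congr rfl fun i _ => ?_
  rw [← Complex.ofReal_mul, Complex.ofReal_re, sq]

theorem HasSpectrum.abs_le {l n : ℕ} (h : n ≤ l) {x : Matrix (Fin l) (Fin l) ℂ}
    {lam : Fin n → ℝ} (hx : HasSpectrum x lam) (i : Fin n) :
    |lam i| ≤ 1 + (x * x).trace.re := by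
  rw [hx.trace_mul_self h]
  have h1 : lam i ^ 2 ≤ ∑ i, lam i ^ 2 :=
    Finset.single_le_sum (f := fun i => lam i ^ 2) (fun _ _ => sq_nonneg _) (Finset.mem_univ i)
  have h2 : |lam i| ≤ 1 + lam i ^ 2 := by
    rw [← sq_abs]
    nlinarith [abs_nonneg (lam i), sq_nonneg (|lam i| - 1)]
  linarith

/-- The integral formula, given a continuation of its right hand side. -/
theorem haarIntegralEq_of_continuesTo {l m r : ℕ} (hr : 0 < r) (hl : r ≤ l) (hm : r ≤ m)
    {g : Matrix (Fin l) (Fin m) ℂ} {x : Matrix (Fin m) (Fin m) ℂ} (hxH : x.IsHermitian)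
    (hg : ∀ᵐ k ∂haarK l, NonvanishingMinors r (g * gᴴ) k)
    (hx : ∀ᵐ k ∂haarK m, NonvanishingMinors r x k)
    (hrank : ∀ k : K m, (g * k.1 * x * k.1ᴴ * gᴴ).rank ≤ r)
    {s : Fin r → ℂ} {L : Fin r → ZMod 2}
    (hreg : (x.PosSemidef ∨ (-x).PosSemidef) ∨ ∀ b c, s b = s c → L b = L c) {v : ℂ}
    (hv : ContinuesTo (domain r) (fun z => numerator z (stair (ZMod 2) r) (g * gᴴ)
      * numerator z L x / normalization l z) s v) :
    HaarIntegralEq m (fun z k => Φ z L (g * k.1 * x * k.1ᴴ * gᴴ)) s v := by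
  have hF : ∀ z ∈ domain r, ∀ k : K m, Φ z L (g * k.1 * x * k.1ᴴ * gᴴ)
      = numerator z L (g * k.1 * x * k.1ᴴ * gᴴ) / normalization l z := fun z hz k =>
    continuation_of_mem hz
  have hI : ∀ z ∈ domain r,
      Integrable (fun k : K m => Φ z L (g * k.1 * x * k.1ᴴ * gᴴ)) (haarK m) := fun z hz => by
    simp only [hF z hz]
    exact (integrable_numerator hz L g x).div_const _
  have hcont : ContinuesTo (domain r)
      (fun z => ∫ k : K m, Φ z L (g * k.1 * x * k.1ᴴ * gᴴ) ∂haarK m) s v :=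
    hv.congr fun z hz => by
      simp only [hF z hz]
      exact (integral_numerator_div hm hg hz L).symm
  refine ⟨fun hs => hI s hs, fun hint => ?_, hcont⟩
  have hgood := ae_mem_HSet hm hxH hg hx hrank
  -- the parameter `L` may be replaced by one for which `s` is not at a pole
  obtain ⟨L', η, hη0, hmix, hη⟩ : ∃ (L' : Fin r → ZMod 2) (η : ℂ), η ≠ 0 ∧ mixedVdm L' s ≠ 0 ∧
      ∀ᵐ k : K m ∂haarK m, ∀ z : Fin r → ℂ, numerator z L (g * k.1 * x * k.1ᴴ * gᴴ)
        = η * numerator z L' (g * k.1 * x * k.1ᴴ * gᴴ) := by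
    rcases hreg with hps | hL
    · obtain ⟨η, hη0, hη⟩ := exists_numerator_eq_mul hps L 0
      refine ⟨0, η, hη0, mixedVdm_zero_ne_zero s, ?_⟩
      filter_upwards [hgood] with k hk
      have h1 : g * k.1 * x * k.1ᴴ * gᴴ = (g * k.1) * x * (g * k.1)ᴴ := by
        rw [Matrix.conjTranspose_mul, ← Matrix.mul_assoc]
      rw [h1] at hk ⊢
      exact hη l (g * k.1) (ae_nonvanishingMinors hk)
    · exact ⟨L, 1, one_ne_zero, mixedVdm_ne_zero_iff.2 hL,
        Eventually.of_forall fun k z => (one_mul _).symm⟩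
  -- the eigenvalues are uniformly bounded
  have hycont : Continuous fun k : K m => g * k.1 * x * k.1ᴴ * gᴴ :=
    (((continuous_const.matrix_mul (continuous_coeK m)).matrix_mul
      continuous_const).matrix_mul (continuous_coeK m).matrix_conjTranspose).matrix_mul
      continuous_const
  obtain ⟨b, hb⟩ := isCompact_univ.exists_bound_of_continuousOn
    (Complex.continuous_re.comp (hycont.matrix_mul hycont).matrix_trace).continuousOn
  set M : ℝ := 1 + |b|
  have hspec : ∀ k : K m, ∃ lam : Fin r → ℝ, (∀ i, lam i ≠ 0) ∧ (∀ i, |lam i| ≤ M) ∧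
      (g * k.1 * x * k.1ᴴ * gᴴ ∈ HSet l r → HasSpectrum (g * k.1 * x * k.1ᴴ * gᴴ) lam) := by
    intro k
    by_cases hk : g * k.1 * x * k.1ᴴ * gᴴ ∈ HSet l r
    · obtain ⟨lam, hlam⟩ := exists_hasSpectrum hk
      refine ⟨lam, hlam.1, fun i => (hlam.abs_le hl i).trans ?_, fun _ => hlam⟩
      have h1 := (Real.le_norm_self _).trans (hb k trivial)
      have h2 := le_abs_self b
      simp only [Function.comp_apply] at h1
      simp only [M]
      linarith
    · refine ⟨fun _ => 1, fun _ => one_ne_zero, fun _ => ?_, fun h => absurd h hk⟩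
      simp [M]
  choose lam h0 hM hlam using hspec
  have hdom : ∀ z ∈ domain r, ∀ᵐ k : K m ∂haarK m, entireNumerator (lam k) L' z
      = η⁻¹ * mixedVdm L' z * Φ z L (g * k.1 * x * k.1ᴴ * gᴴ) := by
    intro z hz
    filter_upwards [hgood, hη] with k hk hηk
    have hsp := hlam k hk
    rw [hF z hz k, hηk z, ← numerator_mul_mixedVdm hsp.1 L' hz, mul_div_assoc, hsp.div_eq hl hz]
    field_simp
  have hat : ∀ᵐ k : K m ∂haarK m, entireNumerator (lam k) L' s
      = η⁻¹ * mixedVdm L' s * Φ s L (g * k.1 * x * k.1ᴴ * gᴴ) := by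
    filter_upwards [hgood, hη] with k hk hηk
    have h1 := ((continuesTo_const _ s η).mul
      (continuesTo_of_hasSpectrum hl (hlam k hk) hmix)).congr
        (g := fun z => numerator z L (g * k.1 * x * k.1ᴴ * gᴴ) / normalization l z)
        fun z _ => by rw [hηk z]; ring
    have h2 : Φ s L (g * k.1 * x * k.1ᴴ * gᴴ) = _ := h1.continuation_eq
    rw [h2]
    field_simp
  obtain ⟨P, Q, hP, hQ, hPQ, hQs, hPs⟩ := hcont
  have hmeas : ∀ z ∈ domain r,
      AEStronglyMeasurable (fun k => entireNumerator (lam k) L' z) (haarK m) := fun z hz =>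
    ((hI z hz).aestronglyMeasurable.const_mul (η⁻¹ * mixedVdm L' z)).congr
      (EventuallyEq.symm (hdom z hz))
  have hints : Integrable (fun k => entireNumerator (lam k) L' s) (haarK m) :=
    (hint.const_mul (η⁻¹ * mixedVdm L' s)).congr (EventuallyEq.symm hat)
  obtain ⟨n, rfl⟩ := Nat.exists_eq_succ_of_ne_zero hr.ne'
  have hid := integral_identity h0 hM hmeas (P := fun z => η⁻¹ * P z)
    (analyticOnNhd_const.mul hP) hQ (fun z hz => by
      rw [integral_congr_ae (hdom z hz), integral_const_mul, hPQ z hz]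
      ring) hints
  rw [integral_congr_ae hat, integral_const_mul, hPs] at hid
  have h1 : Q s * (η⁻¹ * mixedVdm L' s) ≠ 0 :=
    mul_ne_zero hQs (mul_ne_zero (inv_ne_zero hη0) hmix)
  refine mul_left_cancel₀ h1 ?_
  linear_combination hid

theorem mul_conjTranspose_mem_HSet {l m n : ℕ} {g : Matrix (Fin l) (Fin m) ℂ}
    (hg : g ∈ GSet l m n) : g * gᴴ ∈ HSet l n :=
  ⟨isHermitian_mul_conjTranspose_self g, by rw [Matrix.rank_self_mul_conjTranspose]; exact hg⟩

theorem phiRegular_mul_conjTranspose {l m n : ℕ} (g : Matrix (Fin l) (Fin m) ℂ) (s : Fin n → ℂ)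
    (L : Fin n → ZMod 2) : PhiRegular s L (g * gᴴ) :=
  Or.inl (Matrix.posSemidef_self_mul_conjTranspose g)

theorem continuesTo_Ψ {l m n : ℕ} {g : Matrix (Fin l) (Fin m) ℂ} (hg : g ∈ GSet l m n)
    (s : Fin n → ℂ) : ContinuesTo (domain n)
      (fun z => numerator z (stair (ZMod 2) n) (g * gᴴ) / normalization l z) s (Ψ s g) :=
  continuesTo_Φ (mul_conjTranspose_mem_HSet hg) (phiRegular_mul_conjTranspose g s _)

theorem haarIntegralEq_left {l m r d : ℕ} (hr : 0 < r) {g : Matrix (Fin l) (Fin m) ℂ}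
    (hg : g ∈ GSet l m r) {x : Matrix (Fin m) (Fin m) ℂ} (hx : x ∈ HSet m (r + d))
    {s : Fin r → ℂ} {L : Fin r → ZMod 2} (hs : NormRegular m d s)
    (hreg : PhiRegular (ext d s) (ext d L) x) :
    HaarIntegralEq m (fun z k => Φ z L (g * k.1 * x * k.1ᴴ * gᴴ)) s
      (C m (r + d) (ext d s) * (Ψ s g * Φ (ext d s) (ext d L) x)) := by
  have hgg := mul_conjTranspose_mem_HSet hg
  have hm := le_of_mem_HSet hx
  have hrank : g.rank = r := hg
  refine haarIntegralEq_of_continuesTo hr (le_of_mem_HSet hgg) (by omega) hx.1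
    (ae_nonvanishingMinors hgg)
    ((ae_nonvanishingMinors hx).mono fun k hk => hk.mono (Nat.le_add_right r d)) (fun k => ?_) ?_ ?_
  · simp only [Matrix.mul_assoc]
    exact (Matrix.rank_mul_le_left _ _).trans hrank.le
  · rcases hreg with h | h | h
    · exact Or.inl (Or.inl h)
    · exact Or.inl (Or.inr h)
    · refine Or.inr fun b c hbc => ?_
      have := h (Fin.castAdd d b) (Fin.castAdd d c)
      simp only [ext, Fin.append_left, hbc, add_left_inj, true_imp_iff] at this
      exact this
  · refine ((continuesTo_C hm (normDen_ext_ne_zero hs)).comp_ext.mul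
      ((continuesTo_Ψ hg s).mul (continuesTo_Φ hx hreg).comp_ext)).congr fun z hz => ?_
    have h1 := normalization_ne_zero hm (ext_mem_domain d hz)
    simp only [numerator_ext]
    field_simp

theorem haarIntegralEq_right {l m r d : ℕ} (hr : 0 < r) {g : Matrix (Fin l) (Fin m) ℂ}
    (hg : g ∈ GSet l m (r + d)) {x : Matrix (Fin m) (Fin m) ℂ} (hx : x ∈ HSet m r)
    {s : Fin r → ℂ} {L : Fin r → ZMod 2} (hs : NormRegular m d s) (hreg : PhiRegular s L x) :
    HaarIntegralEq m (fun z k => Φ z L (g * k.1 * x * k.1ᴴ * gᴴ)) s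
      (C m (r + d) (ext d s) * (Ψ (ext d s) g * Φ s L x)) := by
  have hgg := mul_conjTranspose_mem_HSet hg
  have hl := le_of_mem_HSet hgg
  have hm : r + d ≤ m := by
    have hrank : g.rank = r + d := hg
    rw [← hrank]
    simpa using Matrix.rank_le_width g
  have hrank : x.rank = r := hx.2
  refine haarIntegralEq_of_continuesTo hr (by omega) (by omega) hx.1
    ((ae_nonvanishingMinors hgg).mono fun k hk => hk.mono (Nat.le_add_right r d))
    (ae_nonvanishingMinors hx) (fun k => ?_) ?_ ?_
  · exact (Matrix.rank_mul_le_left _ _).trans ((Matrix.rank_mul_le_left _ _).trans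
      ((Matrix.rank_mul_le_right _ _).trans hrank.le))
  · rcases hreg with h | h | h
    · exact Or.inl (Or.inl h)
    · exact Or.inl (Or.inr h)
    · exact Or.inr h
  · refine ((continuesTo_C hm (normDen_ext_ne_zero hs)).comp_ext.mul
      ((continuesTo_Ψ hg (ext d s)).comp_ext.mul (continuesTo_Φ hx hreg))).congr fun z hz => ?_
    have h1 := normalization_ne_zero hm (ext_mem_domain d hz)
    have h2 := normalization_ne_zero hl (ext_mem_domain d hz)
    have h3 := normalization_ne_zero (l := r + d) (Nat.le_add_right r d) hz
    simp only [← ext_stair, numerator_ext]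
    rw [normalization_chain hm hz, normalization_chain hl hz]
    field_simp

theorem mul_mul_mul_conjTranspose {l m o : ℕ} (g₁ : Matrix (Fin l) (Fin m) ℂ)
    (k : Matrix (Fin m) (Fin m) ℂ) (g₂ : Matrix (Fin m) (Fin o) ℂ) :
    g₁ * k * g₂ * (g₁ * k * g₂)ᴴ = g₁ * k * (g₂ * g₂ᴴ) * kᴴ * g₁ᴴ := by
  simp only [Matrix.conjTranspose_mul, Matrix.mul_assoc]

end SphericalFactorization

end

open SphericalFactorization in
theorem proposition1 (l m r d : ℕ) (hr : 0 < r) :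
    -- products `g k x k^* g^*`, case `n₁ = r`, `n₂ = r + d`
    (∀ g ∈ GSet l m r, ∀ x ∈ HSet m (r + d), ∀ (s : Fin r → ℂ) (L : Fin r → ZMod 2),
      NormRegular m d s → PhiRegular (ext d s) (ext d L) x →
      HaarIntegralEq m
        (fun z k => Φ z L (g * k.1 * x * k.1ᴴ * gᴴ)) s
        (C m (r + d) (ext d s) * (Ψ s g * Φ (ext d s) (ext d L) x))) ∧
    -- products `g k x k^* g^*`, case `n₁ = r + d`, `n₂ = r`
    (∀ g ∈ GSet l m (r + d), ∀ x ∈ HSet m r, ∀ (s : Fin r → ℂ) (L : Fin r → ZMod 2),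
      NormRegular m d s → PhiRegular s L x →
      HaarIntegralEq m
        (fun z k => Φ z L (g * k.1 * x * k.1ᴴ * gᴴ)) s
        (C m (r + d) (ext d s) * (Ψ (ext d s) g * Φ s L x))) ∧
    -- products `g₁ k g₂`, case `n₁ = r`, `n₂ = r + d`
    (∀ (o : ℕ), ∀ g₁ ∈ GSet l m r, ∀ g₂ ∈ GSet m o (r + d), ∀ s : Fin r → ℂ,
      NormRegular m d s →
      HaarIntegralEq m
        (fun z k => Ψ z (g₁ * k.1 * g₂)) s
        (C m (r + d) (ext d s) * (Ψ s g₁ * Ψ (ext d s) g₂))) ∧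
    -- products `g₁ k g₂`, case `n₁ = r + d`, `n₂ = r`
    (∀ (o : ℕ), ∀ g₁ ∈ GSet l m (r + d), ∀ g₂ ∈ GSet m o r, ∀ s : Fin r → ℂ,
      NormRegular m d s →
      HaarIntegralEq m
        (fun z k => Ψ z (g₁ * k.1 * g₂)) s
        (C m (r + d) (ext d s) * (Ψ (ext d s) g₁ * Ψ s g₂))) := by
  refine ⟨fun g hg x hx s L hs hreg => haarIntegralEq_left hr hg hx hs hreg,
    fun g hg x hx s L hs hreg => haarIntegralEq_right hr hg hx hs hreg,
    fun o g₁ hg₁ g₂ hg₂ s hs => ?_, fun o g₁ hg₁ g₂ hg₂ s hs => ?_⟩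
  · have h := haarIntegralEq_left (L := stair (ZMod 2) r) hr hg₁ (mul_conjTranspose_mem_HSet hg₂) hs
      (phiRegular_mul_conjTranspose _ _ _)
    rw [ext_stair] at h
    simp only [Ψ, mul_mul_mul_conjTranspose] at h ⊢
    exact h
  · have h := haarIntegralEq_right (L := stair (ZMod 2) r) hr hg₁ (mul_conjTranspose_mem_HSet hg₂)
      hs (phiRegular_mul_conjTranspose _ _ _)
    simp only [Ψ, mul_mul_mul_conjTranspose] at h ⊢
    exact h
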